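/- Let $k$ be a commutative ring, $A$ an associative unital $k$-algebra, $e=e^2\in A$ and $\Lambda:=eAe$. Let $R=R(A,e)$ be the mirror-reflective algebra: its underlying $k$-module is $A\oplus (Ae\otimes_\Lambda eA)$, with multiplication $$(a,s)(b,t)=(ab,\;at+sb+st),\qquad (x\otimes y)(x'\otimes y'):=xyx'\otimes y'\quad (x,x'\in Ae,\ y,y'\in eA).$$ Regard $A$ as a subalgebra of $R$, and put $\bar e:=e\otimes e\in R$ and $e_0:=(1-e)+\bar e$; then $\bar e$, $e-\bar e$ and $e_0$ are idempotents of $R$. Let $S=S(A,e):=e_0Re_0=(1-e)A(1-e)\oplus (Ae\otimes_\Lambda eA)$ be the reduced mirror-reflective algebra, and put $I:=R\bar eR$ and $J:=R(e-\bar e)R$. For a positive integer $m$, an ideal $K$ of an algebra $B$ is called $m$-idempotent if for all left $B/K$-modules $X,Y$ the canonical map $\operatorname{Ext}^i_{B/K}(X,Y)\to\operatorname{Ext}^i_B(X,Y)$ is an isomorphism for $1\le i\le m$; it is called strong idempotent if it is $m$-idempotent for all $m\ge1$. Write $D(B)$ for the unbounded derived category of all left $B$-modules. For $f=f^2\in B$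 such that $BfB$ is strong idempotent, the standard recollement induced by $BfB$ is the recollement $(D(B/BfB),D(B),D(fBf))$ of triangulated categories in which $i_*:D(B/BfB)\to D(B)$ is the derived restriction functor and $j^*:D(B)\to D(fBf)$ is the derived functor of $M\mapsto fM$. 1. The ideals $I$ and $J$ of $R$ are $2$-idempotent. 2. For every integer $n\ge1$ the following are equivalent: $I$ is $(n+2)$-idempotent; $J$ is $(n+2)$-idempotent; $\operatorname{Tor}_i^{\Lambda}(Ae,eA)=0$ for all $1\le i\le n$. 3. Suppose $\operatorname{Tor}_i^{\Lambda}(Ae,eA)=0$ for all $i\ge1$. Then $R\bar eR$ and $S\bar eS$ are strong idempotent ideals of $R$ and of $S$, and there are standard recollements $$(D(A),\,D(R),\,D(eAe))\qquad\text{and}\qquad (D((1-e)A(1-e)),\,D(S),\,D(eAe))$$ induced by $R\bar eR$ and $S\bar eS$, respectively. Here $R/R\bar eR$ is identified with $A$ and $S/S\bar eS$ with $(1-e)A(1-e)$ via the surjections $(a,t)\mapsto a$, whose kernels are $R\bar eR$ and $S\bar eS$; and $eAe$ is identified with $\bar eR\bar e=\bar eS\bar e$ via $\lambda\mapsto\lambda\bar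 e$. -/

import Mathlib

open CategoryTheory CategoryTheory.Limits CategoryTheory.Pretriangulated
open scoped TensorProduct

universe w v u

noncomputable section

namespace MirrorReflective

/-! ## Corner rings and corner modules

For an idempotent `f` of a ring `B`, the ring `fBf` (with identity `f`) is `hf.Corner`,
where `hf : IsIdempotentElem f`. -/

section Corner

variable {B : Type u} [Ring B] {f : B} (hf : IsIdempotentElem f)

/-- `fBf` is a `k`-algebra if `B` is. -/
instance cornerAlgebra {k : Type v} [CommRing k] [Algebra k B] : Algebra k hf.Corner where
  smul c x := ⟨c • x.1, by
    obtain ⟨y, hy⟩ := x.2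
    refine ⟨c • y, ?_⟩
    have hy' : f * y * f = x.1 := hy
    change f * (c • y) * f = c • x.1
    rw [mul_smul_comm, smul_mul_assoc, hy']⟩
  algebraMap :=
    { toFun := fun c => ⟨f * algebraMap k B c * f, _, rfl⟩
      map_one' := Subtype.ext (by
        change f * algebraMap k B 1 * f = f
        rw [map_one, mul_one, hf.eq])
      map_mul' := fun c d => Subtype.ext (by
        have h (c : k) : f * algebraMap k B c * f = algebraMap k B c * f := by
          rw [← Algebra.commutes c f, mul_assoc, hf.eq]
        change f * algebraMap k B (c * d) * f
          = (f * algebraMap k B c * f) * (f * algebraMap k B d * f)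
        rw [h, h, h, map_mul, mul_assoc (algebraMap k B c) f, ← mul_assoc f, h, mul_assoc])
      map_zero' := Subtype.ext (by
        change f * algebraMap k B 0 * f = 0
        rw [map_zero, mul_zero, zero_mul])
      map_add' := fun c d => Subtype.ext (by
        change f * algebraMap k B (c + d) * f
          = f * algebraMap k B c * f + f * algebraMap k B d * f
        rw [map_add, mul_add, add_mul]) }
  commutes' c x := Subtype.ext (by
    have h : f * algebraMap k B c * f = algebraMap k B c * f := by
      rw [← Algebra.commutes c f, mul_assoc, hf.eq]
    obtain ⟨x, hx⟩ := x
    obtain ⟨h1, h2⟩ := (Subsemigroup.mem_corner_iff hf).mp hx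
    change f * algebraMap k B c * f * x = x * (f * algebraMap k B c * f)
    rw [h, mul_assoc, h1, Algebra.commutes c f, ← mul_assoc, h2, Algebra.commutes])
  smul_def' c x := Subtype.ext (by
    have h : f * algebraMap k B c * f = algebraMap k B c * f := by
      rw [← Algebra.commutes c f, mul_assoc, hf.eq]
    obtain ⟨x, hx⟩ := x
    obtain ⟨h1, h2⟩ := (Subsemigroup.mem_corner_iff hf).mp hx
    change c • x = f * algebraMap k B c * f * x
    rw [h, mul_assoc, h1, Algebra.smul_def])

lemma corner_smul_val {k : Type v} [CommRing k] [Algebra k B] (c : k) (x : hf.Corner) :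
    (c • x).1 = c • x.1 := rfl

/-- The additive group `fM = {f m | m ∈ M}` for a left `B`-module `M`. -/
def CornerModule (_ : IsIdempotentElem f) (M : Type u) [AddCommGroup M] [Module B M] : Type u :=
  (DistribSMul.toAddMonoidHom M f).range

instance (M : Type u) [AddCommGroup M] [Module B M] : AddCommGroup (CornerModule hf M) :=
  inferInstanceAs (AddCommGroup (DistribSMul.toAddMonoidHom M f).range)

variable {hf} in
lemma CornerModule.smul_val {M : Type u} [AddCommGroup M] [Module B M] (x : CornerModule hf M) :
    f • x.1 = x.1 := by
  obtain ⟨y, hy⟩ := x.2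
  have hy' : f • y = x.1 := hy
  rw [← hy', smul_smul, hf.eq]

/-- The element of `fM` given by an `x : M` with `f x = x`. -/
def CornerModule.mk {M : Type u} [AddCommGroup M] [Module B M] (x : M) (hx : f • x = x) :
    CornerModule hf M := ⟨x, x, hx⟩

/-- The left `fBf`-module structure on `fM`, inherited from the action of `B` on `M`. -/
instance (M : Type u) [AddCommGroup M] [Module B M] : Module hf.Corner (CornerModule hf M) where
  smul b x := CornerModule.mk hf (b.1 • x.1)
    (by rw [smul_smul, ((Subsemigroup.mem_corner_iff hf).mp b.2).1])
  one_smul x := Subtype.ext x.smul_val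
  mul_smul b c x := Subtype.ext (mul_smul b.1 c.1 x.1)
  smul_zero b := Subtype.ext (smul_zero b.1)
  smul_add b x y := Subtype.ext (smul_add b.1 x.1 y.1)
  add_smul b c x := Subtype.ext (add_smul b.1 c.1 x.1)
  zero_smul x := Subtype.ext (zero_smul B x.1)

/-- The map `fM → fN` induced by a `B`-linear map `M → N`. -/
def CornerModule.map {M N : Type u} [AddCommGroup M] [Module B M] [AddCommGroup N] [Module B N]
    (g : M →ₗ[B] N) : CornerModule hf M →ₗ[hf.Corner] CornerModule hf N where
  toFun x := CornerModule.mk hf (g x.1) (by rw [← map_smul, x.smul_val])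
  map_add' x y := Subtype.ext (map_add g x.1 y.1)
  map_smul' b x := Subtype.ext (map_smul g b.1 x.1)

/-- The functor `f · : B-Mod ⥤ fBf-Mod`, `M ↦ fM`. -/
def cornerFunctor : ModuleCat.{u} B ⥤ ModuleCat.{u} hf.Corner where
  obj M := ModuleCat.of hf.Corner (CornerModule hf M)
  map g := ModuleCat.ofHom (CornerModule.map hf g.hom)

instance : (cornerFunctor hf).Additive where

lemma cornerFunctor_shortExact (S : ShortComplex (ModuleCat.{u} B)) (hS : S.ShortExact) :
    (S.map (cornerFunctor hf)).ShortExact := by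
  have hi : Function.Injective S.f := (ModuleCat.mono_iff_injective _).mp hS.mono_f
  have hs : Function.Surjective S.g := (ModuleCat.epi_iff_surjective _).mp hS.epi_g
  have he := (ShortComplex.ShortExact.moduleCat_exact_iff_function_exact S).mp hS.exact
  refine ModuleCat.shortComplex_shortExact _ ?_ ?_ ?_
  · intro y
    constructor
    · intro hy
      obtain ⟨x, hx⟩ := (he y.1).mp (congrArg Subtype.val hy)
      refine ⟨CornerModule.mk hf x (hi ?_), Subtype.ext hx⟩
      have h := map_smul S.f.hom f x
      exact h.trans ((congrArg (f • ·) hx).trans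
        ((CornerModule.smul_val (hf := hf) y).trans hx.symm))
    · rintro ⟨x, rfl⟩
      exact Subtype.ext ((he _).mpr ⟨x.1, rfl⟩)
  · intro x y hxy
    exact Subtype.ext (hi (congrArg Subtype.val hxy))
  · intro z
    obtain ⟨y, hy⟩ := hs z.1
    refine ⟨CornerModule.mk hf (f • y) (by rw [smul_smul, hf.eq]), Subtype.ext ?_⟩
    have h := map_smul S.g.hom f y
    exact h.trans ((congrArg (f • ·) hy).trans
      (CornerModule.smul_val (hf := hf) z))

lemma cornerFunctor_exact :
    PreservesFiniteLimits (cornerFunctor hf) ∧ PreservesFiniteColimits (cornerFunctor hf) :=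
  ((Functor.exact_tfae (cornerFunctor hf)).out 0 3).mp (cornerFunctor_shortExact hf)

instance : PreservesFiniteLimits (cornerFunctor hf) := (cornerFunctor_exact hf).1

instance : PreservesFiniteColimits (cornerFunctor hf) := (cornerFunctor_exact hf).2

/-- The additive group `Bf = {b f | b ∈ B}`. -/
def LeftIdeal (_ : IsIdempotentElem f) : Type u := (AddMonoidHom.mulRight f).range

instance : AddCommGroup (LeftIdeal hf) :=
  inferInstanceAs (AddCommGroup (AddMonoidHom.mulRight f).range)

variable {hf} in
lemma LeftIdeal.val_mul (x : LeftIdeal hf) : x.1 * f = x.1 := by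
  obtain ⟨y, hy⟩ := x.2
  have hy' : y * f = x.1 := hy
  rw [← hy', mul_assoc, hf.eq]

/-- The element of `Bf` given by an `x : B` with `x f = x`. -/
def LeftIdeal.mk (x : B) (hx : x * f = x) : LeftIdeal hf := ⟨x, x, hx⟩

/-- The right `fBf`-module structure on `Bf`, given by multiplication in `B`. -/
instance : Module hf.Cornerᵐᵒᵖ (LeftIdeal hf) where
  smul b x := LeftIdeal.mk hf (x.1 * b.unop.1)
    (by rw [mul_assoc, ((Subsemigroup.mem_corner_iff hf).mp b.unop.2).2])
  one_smul x := Subtype.ext x.val_mul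
  mul_smul b c x := Subtype.ext (mul_assoc x.1 c.unop.1 b.unop.1).symm
  smul_zero b := Subtype.ext (zero_mul b.unop.1)
  smul_add b x y := Subtype.ext (add_mul x.1 y.1 b.unop.1)
  add_smul b c x := Subtype.ext (mul_add x.1 b.unop.1 c.unop.1)
  zero_smul x := Subtype.ext (mul_zero x.1)

end Corner

/-! ## Tensor products over noncommutative rings, and `Tor` -/

section Balanced

variable (Λ : Type u) [Ring Λ] (M : Type u) [AddCommGroup M] [Module Λᵐᵒᵖ M]
  (N : Type u) [AddCommGroup N] [Module Λ N]

/-- The relations `mλ ⊗ n = m ⊗ λn`. -/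
def balancedRelations : Submodule ℤ (M ⊗[ℤ] N) :=
  Submodule.span ℤ {t | ∃ (m : M) (l : Λ) (n : N),
    t = (MulOpposite.op l • m) ⊗ₜ[ℤ] n - m ⊗ₜ[ℤ] (l • n)}

/-- The tensor product `M ⊗_Λ N` of a right `Λ`-module `M` and a left `Λ`-module `N`. -/
def BalancedTensor : Type u := (M ⊗[ℤ] N) ⧸ balancedRelations Λ M N

instance : AddCommGroup (BalancedTensor Λ M N) :=
  inferInstanceAs (AddCommGroup ((M ⊗[ℤ] N) ⧸ balancedRelations Λ M N))

variable {M N}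

/-- The pure tensor `m ⊗ n` in `M ⊗_Λ N`. -/
def btmul (m : M) (n : N) : BalancedTensor Λ M N :=
  (balancedRelations Λ M N).mkQ (m ⊗ₜ[ℤ] n)

variable {Λ}

lemma btmul_balanced (m : M) (l : Λ) (n : N) :
    btmul Λ (MulOpposite.op l • m) n = btmul Λ m (l • n) :=
  (Submodule.Quotient.eq _).mpr (Submodule.subset_span ⟨m, l, n, rfl⟩)

lemma btmul_add (m : M) (n n' : N) : btmul Λ m (n + n') = btmul Λ m n + btmul Λ m n' := by
  simp only [btmul, TensorProduct.tmul_add]; exact map_add _ _ _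

lemma add_btmul (m m' : M) (n : N) : btmul Λ (m + m') n = btmul Λ m n + btmul Λ m' n := by
  simp only [btmul, TensorProduct.add_tmul]; exact map_add _ _ _

lemma btmul_induction {p : BalancedTensor Λ M N → Prop} (zero : p 0)
    (tmul : ∀ m n, p (btmul Λ m n)) (add : ∀ x y, p x → p y → p (x + y))
    (t : BalancedTensor Λ M N) : p t := by
  obtain ⟨t, rfl⟩ := (balancedRelations Λ M N).mkQ_surjective t
  induction t using TensorProduct.induction_on with
  | zero => exact zero
  | tmul m n => exact tmul m n
  | add x y hx hy =>
    have := add _ _ hx hy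
    rwa [map_add]

/-- The additive map out of `M ⊗_Λ N` induced by a `Λ`-balanced biadditive map. -/
def BalancedTensor.lift {P : Type*} [AddCommGroup P] (φ : M →+ N →+ P)
    (h : ∀ (m : M) (l : Λ) (n : N), φ (MulOpposite.op l • m) n = φ m (l • n)) :
    BalancedTensor Λ M N →+ P :=
  ((balancedRelations Λ M N).liftQ
    (TensorProduct.lift (LinearMap.mk₂ ℤ (fun m n => φ m n)
      (fun m m' n => by simp) (fun c m n => by simp)
      (fun m n n' => by simp) (fun c m n => by simp)))
    (by
      rw [balancedRelations, Submodule.span_le]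
      rintro _ ⟨m, l, n, rfl⟩
      exact LinearMap.mem_ker.mpr ((map_sub (TensorProduct.lift _) _ _).trans
        (sub_eq_zero.mpr (h m l n))))).toAddMonoidHom

lemma BalancedTensor.lift_btmul {P : Type*} [AddCommGroup P] (φ : M →+ N →+ P)
    (h : ∀ (m : M) (l : Λ) (n : N), φ (MulOpposite.op l • m) n = φ m (l • n)) (m : M) (n : N) :
    BalancedTensor.lift φ h (btmul Λ m n) = φ m n := rfl

lemma BalancedTensor.hom_ext {P : Type*} [AddCommGroup P] {φ ψ : BalancedTensor Λ M N →+ P}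
    (h : ∀ m n, φ (btmul Λ m n) = ψ (btmul Λ m n)) : φ = ψ := by
  ext t
  induction t using btmul_induction with
  | zero => simp
  | tmul m n => exact h m n
  | add x y hx hy => simp [hx, hy]

variable {M' : Type u} [AddCommGroup M'] [Module Λᵐᵒᵖ M'] {N' : Type u} [AddCommGroup N']
  [Module Λ N']

/-- The map `g ⊗ h : M ⊗_Λ N → M' ⊗_Λ N'`. -/
def BalancedTensor.map (g : M →ₗ[Λᵐᵒᵖ] M') (h : N →ₗ[Λ] N') :
    BalancedTensor Λ M N →+ BalancedTensor Λ M' N' :=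
  BalancedTensor.lift
    (AddMonoidHom.mk' (fun m => AddMonoidHom.mk' (fun n => btmul Λ (g m) (h n))
      (fun n n' => by rw [map_add, btmul_add]))
      (fun m m' => by ext n; simp [add_btmul]))
    (fun m l n => by simp [btmul_balanced])

lemma BalancedTensor.map_btmul (g : M →ₗ[Λᵐᵒᵖ] M') (h : N →ₗ[Λ] N') (m : M) (n : N) :
    BalancedTensor.map g h (btmul Λ m n) = btmul Λ (g m) (h n) := rfl

variable (Λ M)

/-- The functor `M ⊗_Λ - : Λ-Mod ⥤ Ab`, abelian groups being taken as `ℤ`-modules. -/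
def tensorFunctor : ModuleCat.{u} Λ ⥤ ModuleCat.{u} ℤ where
  obj N := ModuleCat.of ℤ (BalancedTensor Λ M N)
  map g := ModuleCat.ofHom (BalancedTensor.map (LinearMap.id (R := Λᵐᵒᵖ) (M := M))
    g.hom).toIntLinearMap
  map_id N := by
    ext t
    exact DFunLike.congr_fun (BalancedTensor.hom_ext (φ := BalancedTensor.map _ _)
      (ψ := AddMonoidHom.id _) (fun m n => rfl)) t
  map_comp g h := by
    ext t
    exact DFunLike.congr_fun (BalancedTensor.hom_ext (φ := BalancedTensor.map _ _)
      (ψ := (BalancedTensor.map _ _).comp (BalancedTensor.map _ _)) (fun m n => rfl)) t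

instance : (tensorFunctor Λ M).Additive where
  map_add {N N' g h} := by
    ext t
    exact DFunLike.congr_fun (BalancedTensor.hom_ext
      (φ := BalancedTensor.map LinearMap.id (g + h).hom)
      (ψ := BalancedTensor.map LinearMap.id g.hom + BalancedTensor.map LinearMap.id h.hom)
      (fun m n => by
        rw [ModuleCat.hom_add, AddMonoidHom.add_apply]
        exact btmul_add (Λ := Λ) m (g.hom n) (h.hom n))) t

variable (N)

/-- `Tor_i^Λ(M, N)`, the `i`-th left derived functor of `M ⊗_Λ -` at `N`. -/
def NCTor (i : ℕ) : ModuleCat.{u} ℤ :=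
  ((tensorFunctor Λ M).leftDerived i).obj (ModuleCat.of Λ N)

end Balanced

/-! ## The mirror-reflective algebra `R(A, e)` -/

section Mirror

variable {A : Type u} [Ring A] {e : A} (he : IsIdempotentElem e)

/-- The `A`-`A`-bimodule `Ae ⊗_Λ eA` with `Λ = eAe`. -/
abbrev MirrorBimodule : Type u :=
  BalancedTensor he.Corner (LeftIdeal he) (CornerModule he A)

/-- The `Λ`-linear endomorphism `xe ↦ axe` of `Ae`. -/
def leftMul (a : A) : LeftIdeal he →ₗ[he.Cornerᵐᵒᵖ] LeftIdeal he where
  toFun x := LeftIdeal.mk he (a * x.1) (by rw [mul_assoc, x.val_mul])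
  map_add' x y := Subtype.ext (mul_add a x.1 y.1)
  map_smul' b x := Subtype.ext (mul_assoc a x.1 b.unop.1).symm

/-- The `Λ`-linear endomorphism `ey ↦ eya` of `eA`. -/
def rightMul (a : A) : CornerModule he A →ₗ[he.Corner] CornerModule he A where
  toFun y := CornerModule.mk he (y.1 * a)
    (by rw [smul_eq_mul, ← mul_assoc, ← smul_eq_mul e, y.smul_val])
  map_add' x y := Subtype.ext (add_mul x.1 y.1 a)
  map_smul' b x := Subtype.ext (mul_assoc b.1 x.1 a)

/-- The left action `a (x ⊗ y) = ax ⊗ y`. -/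
def lact (a : A) : MirrorBimodule he →+ MirrorBimodule he :=
  BalancedTensor.map (leftMul he a) LinearMap.id

/-- The right action `(x ⊗ y) a = x ⊗ ya`. -/
def ract (a : A) : MirrorBimodule he →+ MirrorBimodule he :=
  BalancedTensor.map LinearMap.id (rightMul he a)

/-- The multiplication map `Ae ⊗_Λ eA → A`, `x ⊗ y ↦ xy`. -/
def mulMap : MirrorBimodule he →+ A :=
  BalancedTensor.lift
    (AddMonoidHom.mk' (fun x => AddMonoidHom.mk' (fun y => x.1 * y.1)
      (fun y y' => mul_add x.1 y.1 y'.1))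
      (fun x x' => by ext y; exact add_mul x.1 x'.1 y.1))
    (fun x l y => mul_assoc x.1 l.1 y.1)

section Bimodule

variable {he}

lemma lact_btmul (a : A) (x : LeftIdeal he) (y : CornerModule he A) :
    lact he a (btmul he.Corner x y) = btmul he.Corner (leftMul he a x) y := rfl

lemma ract_btmul (a : A) (x : LeftIdeal he) (y : CornerModule he A) :
    ract he a (btmul he.Corner x y) = btmul he.Corner x (rightMul he a y) := rfl

lemma mulMap_btmul (x : LeftIdeal he) (y : CornerModule he A) :
    mulMap he (btmul he.Corner x y) = x.1 * y.1 := rfl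

lemma lact_one (t : MirrorBimodule he) : lact he 1 t = t :=
  DFunLike.congr_fun (BalancedTensor.hom_ext (ψ := AddMonoidHom.id _) (fun x y => by
    rw [lact_btmul]; congr 1; exact Subtype.ext (one_mul x.1))) t

lemma ract_one (t : MirrorBimodule he) : ract he 1 t = t :=
  DFunLike.congr_fun (BalancedTensor.hom_ext (ψ := AddMonoidHom.id _) (fun x y => by
    rw [ract_btmul]; congr 1; exact Subtype.ext (mul_one y.1))) t

lemma lact_mul (a b : A) (t : MirrorBimodule he) : lact he (a * b) t = lact he a (lact he b t) :=
  DFunLike.congr_fun (BalancedTensor.hom_ext (ψ := (lact he a).comp (lact he b)) (fun x y => by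
    rw [AddMonoidHom.comp_apply, lact_btmul, lact_btmul, lact_btmul]
    congr 1; exact Subtype.ext (mul_assoc a b x.1))) t

lemma ract_mul (a b : A) (t : MirrorBimodule he) : ract he (a * b) t = ract he b (ract he a t) :=
  DFunLike.congr_fun (BalancedTensor.hom_ext (ψ := (ract he b).comp (ract he a)) (fun x y => by
    rw [AddMonoidHom.comp_apply, ract_btmul, ract_btmul, ract_btmul]
    congr 1; exact Subtype.ext (mul_assoc y.1 a b).symm)) t

lemma lact_ract (a b : A) (t : MirrorBimodule he) :
    lact he a (ract he b t) = ract he b (lact he a t) :=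
  DFunLike.congr_fun (BalancedTensor.hom_ext (φ := (lact he a).comp (ract he b))
    (ψ := (ract he b).comp (lact he a)) (fun _ _ => rfl)) t

lemma lact_add (a b : A) (t : MirrorBimodule he) :
    lact he (a + b) t = lact he a t + lact he b t :=
  DFunLike.congr_fun (BalancedTensor.hom_ext (ψ := lact he a + lact he b) (fun x y => by
    rw [AddMonoidHom.add_apply, lact_btmul, lact_btmul, lact_btmul, ← add_btmul]
    congr 1; exact Subtype.ext (add_mul a b x.1))) t

lemma ract_add (a b : A) (t : MirrorBimodule he) :
    ract he (a + b) t = ract he a t + ract he b t :=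
  DFunLike.congr_fun (BalancedTensor.hom_ext (ψ := ract he a + ract he b) (fun x y => by
    rw [AddMonoidHom.add_apply, ract_btmul, ract_btmul, ract_btmul, ← btmul_add]
    congr 1; exact Subtype.ext (mul_add y.1 a b))) t

lemma lact_zero (t : MirrorBimodule he) : lact he 0 t = 0 := by
  have := lact_add 0 0 t
  rwa [add_zero, left_eq_add] at this

lemma ract_zero (t : MirrorBimodule he) : ract he 0 t = 0 := by
  have := ract_add 0 0 t
  rwa [add_zero, left_eq_add] at this

lemma mulMap_lact (a : A) (t : MirrorBimodule he) : mulMap he (lact he a t) = a * mulMap he t :=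
  DFunLike.congr_fun (BalancedTensor.hom_ext (φ := (mulMap he).comp (lact he a))
    (ψ := (AddMonoidHom.mulLeft a).comp (mulMap he)) (fun x y => mul_assoc a x.1 y.1)) t

lemma mulMap_ract (a : A) (t : MirrorBimodule he) : mulMap he (ract he a t) = mulMap he t * a :=
  DFunLike.congr_fun (BalancedTensor.hom_ext (φ := (mulMap he).comp (ract he a))
    (ψ := (AddMonoidHom.mulRight a).comp (mulMap he))
    (fun x y => (mul_assoc x.1 y.1 a).symm)) t

/-- For `s = x ⊗ y` and `t = x' ⊗ y'` this says `x y x' ⊗ y' = x ⊗ y x' y'`. -/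
lemma lact_mulMap_eq_ract (s t : MirrorBimodule he) :
    lact he (mulMap he s) t = ract he (mulMap he t) s := by
  induction s using btmul_induction with
  | zero => rw [map_zero, map_zero, lact_zero]
  | add s s' hs hs' => rw [map_add, lact_add, map_add, hs, hs']
  | tmul x y =>
    induction t using btmul_induction with
    | zero => rw [map_zero, map_zero, ract_zero]
    | add t t' ht ht' => rw [map_add, ht, ht', map_add, ract_add]
    | tmul x' y' =>
      rw [mulMap_btmul, mulMap_btmul, lact_btmul, ract_btmul]
      have hy : e * y.1 = y.1 := y.smul_val
      let l : he.Corner := ⟨y.1 * x'.1, y.1 * x'.1, by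
        change e * (y.1 * x'.1) * e = y.1 * x'.1
        rw [← mul_assoc, hy, mul_assoc, x'.val_mul]⟩
      have h1 : leftMul he (x.1 * y.1) x' = MulOpposite.op l • x :=
        Subtype.ext (mul_assoc x.1 y.1 x'.1)
      have h2 : rightMul he (x'.1 * y'.1) y = l • y' :=
        Subtype.ext (mul_assoc y.1 x'.1 y'.1).symm
      rw [h1, h2, btmul_balanced]

lemma lact_algebraMap {k : Type v} [CommRing k] [Algebra k A] (c : k) (t : MirrorBimodule he) :
    lact he (algebraMap k A c) t = ract he (algebraMap k A c) t := by
  induction t using btmul_induction with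
  | zero => rw [map_zero, map_zero]
  | add t t' ht ht' => rw [map_add, ht, ht', map_add]
  | tmul x y =>
    have h1 : leftMul he (algebraMap k A c) x = MulOpposite.op (c • (1 : he.Corner)) • x :=
      Subtype.ext (by
        change algebraMap k A c * x.1 = x.1 * (c • e)
        rw [mul_smul_comm, x.val_mul, Algebra.smul_def])
    have h2 : rightMul he (algebraMap k A c) y = (c • (1 : he.Corner)) • y :=
      Subtype.ext (by
        change y.1 * algebraMap k A c = c • e * y.1
        have hy : e * y.1 = y.1 := y.smul_val
        rw [smul_mul_assoc, hy, Algebra.smul_def, Algebra.commutes])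
    rw [lact_btmul, ract_btmul, h1, h2, btmul_balanced]

end Bimodule

/-- The mirror-reflective algebra `R(A, e) = A ⊕ Ae ⊗_Λ eA`, `Λ = eAe`. -/
@[ext]
structure Mirror (he : IsIdempotentElem e) : Type u where
  base : A
  tens : MirrorBimodule he

namespace Mirror

/-- The underlying additive group is `A ⊕ Ae ⊗_Λ eA`. -/
def equivProd (he : IsIdempotentElem e) : Mirror he ≃ A × MirrorBimodule he where
  toFun r := (r.base, r.tens)
  invFun p := ⟨p.1, p.2⟩

instance : AddCommGroup (Mirror he) := (equivProd he).addCommGroup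

/-- `(a, s) (b, t) = (ab, at + sb + st)` where, for `s = x ⊗ y` and `t = x' ⊗ y'`, the product
`st` is `x y x' ⊗ y'`, see `btmul_mul_btmul`. -/
instance : Mul (Mirror he) where
  mul r r' := ⟨r.base * r'.base,
    lact he r.base r'.tens + ract he r'.base r.tens + lact he (mulMap he r.tens) r'.tens⟩

instance : One (Mirror he) where
  one := ⟨1, 0⟩

variable {he}

lemma mul_def (r r' : Mirror he) : r * r' = ⟨r.base * r'.base,
    lact he r.base r'.tens + ract he r'.base r.tens + lact he (mulMap he r.tens) r'.tens⟩ := rfl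

lemma btmul_mul_btmul (x x' : LeftIdeal he) (y y' : CornerModule he A) :
    (⟨0, btmul he.Corner x y⟩ : Mirror he) * (⟨0, btmul he.Corner x' y'⟩ : Mirror he) =
      ⟨0, btmul he.Corner (leftMul he (x.1 * y.1) x') y'⟩ := by
  rw [mul_def]
  refine Mirror.ext (mul_zero 0) ?_
  change lact he 0 _ + ract he 0 _ + lact he _ _ = _
  rw [lact_zero, ract_zero, zero_add, zero_add, mulMap_btmul, lact_btmul]

instance : Ring (Mirror he) where
  __ := (inferInstance : AddCommGroup (Mirror he))
  __ := (inferInstance : Mul (Mirror he))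
  __ := (inferInstance : One (Mirror he))
  left_distrib r s t := by
    refine Mirror.ext (mul_add r.1 s.1 t.1) ?_
    change lact he r.1 (s.2 + t.2) + ract he (s.1 + t.1) r.2 + lact he (mulMap he r.2) (s.2 + t.2)
      = (lact he r.1 s.2 + ract he s.1 r.2 + lact he (mulMap he r.2) s.2)
        + (lact he r.1 t.2 + ract he t.1 r.2 + lact he (mulMap he r.2) t.2)
    rw [map_add, map_add, ract_add]
    abel
  right_distrib r s t := by
    refine Mirror.ext (add_mul r.1 s.1 t.1) ?_
    change lact he (r.1 + s.1) t.2 + ract he t.1 (r.2 + s.2) + lact he (mulMap he (r.2 + s.2)) t.2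
      = (lact he r.1 t.2 + ract he t.1 r.2 + lact he (mulMap he r.2) t.2)
        + (lact he s.1 t.2 + ract he t.1 s.2 + lact he (mulMap he s.2) t.2)
    rw [map_add, map_add, lact_add, lact_add]
    abel
  zero_mul r := by
    refine Mirror.ext (zero_mul r.1) ?_
    change lact he 0 r.2 + ract he r.1 0 + lact he (mulMap he 0) r.2 = 0
    simp only [map_zero, lact_zero, add_zero]
  mul_zero r := by
    refine Mirror.ext (mul_zero r.1) ?_
    change lact he r.1 0 + ract he 0 r.2 + lact he (mulMap he r.2) 0 = 0
    simp only [map_zero, ract_zero, add_zero]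
  mul_assoc r s t := by
    refine Mirror.ext (mul_assoc r.1 s.1 t.1) ?_
    change lact he (r.1 * s.1) t.2
        + ract he t.1 (lact he r.1 s.2 + ract he s.1 r.2 + lact he (mulMap he r.2) s.2)
        + lact he (mulMap he (lact he r.1 s.2 + ract he s.1 r.2 + lact he (mulMap he r.2) s.2)) t.2
      = lact he r.1 (lact he s.1 t.2 + ract he t.1 s.2 + lact he (mulMap he s.2) t.2)
        + ract he (s.1 * t.1) r.2
        + lact he (mulMap he r.2) (lact he s.1 t.2 + ract he t.1 s.2 + lact he (mulMap he s.2) t.2)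
    simp only [map_add, lact_add, lact_mul, ract_mul, mulMap_lact, mulMap_ract, lact_ract]
    rw [← lact_ract, lact_mulMap_eq_ract r.2]
    abel
  one_mul r := by
    refine Mirror.ext (one_mul r.1) ?_
    change lact he 1 r.2 + ract he r.1 0 + lact he (mulMap he 0) r.2 = r.2
    simp only [map_zero, lact_zero, add_zero, lact_one]
  mul_one r := by
    refine Mirror.ext (mul_one r.1) ?_
    change lact he r.1 0 + ract he 1 r.2 + lact he (mulMap he r.2) 0 = r.2
    simp only [map_zero, add_zero, zero_add, ract_one]

/-- The inclusion `A → R(A, e)`. -/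
def incl (he : IsIdempotentElem e) : A →+* Mirror he where
  toFun a := ⟨a, 0⟩
  map_one' := rfl
  map_zero' := rfl
  map_add' a b := Mirror.ext rfl (add_zero (0 : MirrorBimodule he)).symm
  map_mul' a b := Mirror.ext rfl (by
    change 0 = lact he a 0 + ract he b 0 + lact he (mulMap he 0) 0
    simp only [map_zero, add_zero])

instance {k : Type v} [CommRing k] [Algebra k A] : Algebra k (Mirror he) :=
  RingHom.toAlgebra' ((incl he).comp (algebraMap k A)) (fun c r => by
    refine Mirror.ext (Algebra.commutes c r.1) ?_
    change lact he (algebraMap k A c) r.2 + ract he r.1 0 + lact he (mulMap he 0) r.2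
      = lact he r.1 0 + ract he (algebraMap k A c) r.2 + lact he (mulMap he r.2) 0
    simp only [map_zero, lact_zero, add_zero, zero_add, lact_algebraMap])

/-- The idempotent `ē = e ⊗ e` of `R(A, e)`. -/
def eBar (he : IsIdempotentElem e) : Mirror he :=
  ⟨0, btmul he.Corner (LeftIdeal.mk he e he.eq) (CornerModule.mk he e he.eq)⟩

lemma eBar_idem (he : IsIdempotentElem e) : IsIdempotentElem (eBar he) := by
  refine (btmul_mul_btmul _ _ _ _).trans ?_
  refine Mirror.ext rfl ?_
  change btmul _ _ _ = btmul _ _ _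
  congr 1
  exact Subtype.ext (show e * e * e = e by rw [he.eq, he.eq])

lemma incl_mul (a : A) (r : Mirror he) : incl he a * r = ⟨a * r.1, lact he a r.2⟩ := by
  refine Mirror.ext rfl ?_
  change lact he a r.2 + ract he r.1 0 + lact he (mulMap he 0) r.2 = _
  simp only [map_zero, lact_zero, add_zero]

lemma mul_incl (a : A) (r : Mirror he) : r * incl he a = ⟨r.1 * a, ract he a r.2⟩ := by
  refine Mirror.ext rfl ?_
  change lact he r.1 0 + ract he a r.2 + lact he (mulMap he r.2) 0 = _
  simp only [map_zero, add_zero, zero_add]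

lemma incl_mul_eBar : incl he e * eBar he = eBar he := by
  rw [incl_mul]
  refine Mirror.ext (mul_zero e) ?_
  change btmul _ _ _ = btmul _ _ _
  congr 1
  exact Subtype.ext he.eq

lemma eBar_mul_incl : eBar he * incl he e = eBar he := by
  rw [mul_incl]
  refine Mirror.ext (zero_mul e) ?_
  change btmul _ _ _ = btmul _ _ _
  congr 1
  exact Subtype.ext he.eq

/-- The idempotent `e₀ = (1 - e) + ē` of `R(A, e)`. -/
def eZero (he : IsIdempotentElem e) : Mirror he := incl he (1 - e) + eBar he

lemma eZero_idem (he : IsIdempotentElem e) : IsIdempotentElem (eZero he) := by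
  have h := he.one_sub.map (incl he)
  have h1 : incl he (1 - e) * eBar he = 0 := by
    rw [map_sub, map_one, sub_mul, one_mul, incl_mul_eBar, sub_self]
  have h2 : eBar he * incl he (1 - e) = 0 := by
    rw [map_sub, map_one, mul_sub, mul_one, eBar_mul_incl, sub_self]
  change (incl he (1 - e) + eBar he) * (incl he (1 - e) + eBar he) = _
  rw [add_mul, mul_add, mul_add, h1, h2, h.eq, (eBar_idem he).eq, add_zero, zero_add, eZero]

/-- The surjection `π₁ : R(A, e) → A`, `(a, t) ↦ a`. -/
def piOne (k : Type v) [CommRing k] [Algebra k A] (he : IsIdempotentElem e) :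
    Mirror he →ₐ[k] A where
  toFun r := r.1
  map_one' := rfl
  map_zero' := rfl
  map_add' _ _ := rfl
  map_mul' _ _ := rfl
  commutes' _ := rfl

/-- The surjection `π₂ : R(A, e) → A`, `(a, ∑ xᵢ ⊗ yᵢ) ↦ a + ∑ xᵢ yᵢ`. -/
def piTwo (k : Type v) [CommRing k] [Algebra k A] (he : IsIdempotentElem e) :
    Mirror he →ₐ[k] A where
  toFun r := r.1 + mulMap he r.2
  map_one' := (congrArg ((1 : A) + ·) (map_zero (mulMap he))).trans (add_zero 1)
  map_zero' := (congrArg ((0 : A) + ·) (map_zero (mulMap he))).trans (add_zero 0)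
  map_add' r s := by
    change r.1 + s.1 + mulMap he (r.2 + s.2) = _
    rw [map_add]; abel
  map_mul' r s := by
    change r.1 * s.1 + mulMap he (lact he r.1 s.2 + ract he s.1 r.2 + lact he (mulMap he r.2) s.2)
      = _
    rw [map_add, map_add, mulMap_lact, mulMap_lact, mulMap_ract, add_mul, mul_add, mul_add]
    abel
  commutes' c := (congrArg (algebraMap k A c + ·) (map_zero (mulMap he))).trans (add_zero _)

lemma mul_eBar (r : Mirror he) : r * eBar he = incl he (r.base + mulMap he r.tens) * eBar he := by
  rw [incl_mul, mul_def]
  refine Mirror.ext ((mul_zero r.base).trans (mul_zero _).symm) ?_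
  change lact he r.base _ + ract he 0 r.tens + lact he (mulMap he r.tens) _ = lact he _ _
  rw [ract_zero, add_zero, lact_add]

lemma piTwo_eBar (k : Type v) [CommRing k] [Algebra k A] : piTwo k he (eBar he) = e := by
  change 0 + e * e = e
  rw [zero_add, he.eq]

lemma piTwo_incl (k : Type v) [CommRing k] [Algebra k A] (a : A) :
    piTwo k he (incl he a) = a := by
  change a + mulMap he 0 = a
  rw [map_zero, add_zero]

lemma eBar_mul_incl_mul_eBar {a : A} (ha : a ∈ Subsemigroup.corner e) :
    eBar he * (incl he a * eBar he) = incl he a * eBar he := by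
  have h : piTwo ℤ he (eBar he * incl he a) = a := by
    rw [map_mul, piTwo_eBar, piTwo_incl, ((Subsemigroup.mem_corner_iff he).mp ha).1]
  rw [← mul_assoc, mul_eBar]
  exact congrArg (fun a => incl he a * eBar he) h

/-- The algebra isomorphism `eAe ≃ ēRē`, `a ↦ a ē`, whose inverse is induced by `π₂`. -/
def cornerEquiv (k : Type v) [CommRing k] [Algebra k A] (he : IsIdempotentElem e) :
    he.Corner ≃ₐ[k] (eBar_idem he).Corner where
  toFun a := ⟨incl he a.1 * eBar he, incl he a.1 * eBar he, by
    change eBar he * (incl he a.1 * eBar he) * eBar he = _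
    rw [eBar_mul_incl_mul_eBar a.2, mul_assoc, (eBar_idem he).eq]⟩
  invFun r := ⟨piTwo k he r.1, piTwo k he r.1, by
    obtain ⟨h1, h2⟩ := (Subsemigroup.mem_corner_iff (eBar_idem he)).mp r.2
    have h3 := congrArg (piTwo k he) h1
    have h4 := congrArg (piTwo k he) h2
    rw [map_mul, piTwo_eBar] at h3 h4
    change e * piTwo k he r.1 * e = piTwo k he r.1
    rw [h3, h4]⟩
  left_inv a := Subtype.ext (by
    change piTwo k he (incl he a.1 * eBar he) = a.1
    rw [map_mul, piTwo_eBar, piTwo_incl]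
    exact ((Subsemigroup.mem_corner_iff he).mp a.2).2)
  right_inv r := Subtype.ext (by
    change incl he (r.1.base + mulMap he r.1.tens) * eBar he = r.1
    rw [← mul_eBar]
    exact ((Subsemigroup.mem_corner_iff (eBar_idem he)).mp r.2).2)
  map_mul' a b := Subtype.ext (by
    change incl he (a.1 * b.1) * eBar he = incl he a.1 * eBar he * (incl he b.1 * eBar he)
    rw [mul_assoc _ (eBar he), eBar_mul_incl_mul_eBar b.2, map_mul, mul_assoc])
  map_add' a b := Subtype.ext (by
    change incl he (a.1 + b.1) * eBar he = incl he a.1 * eBar he + incl he b.1 * eBar he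
    rw [map_add, add_mul])
  commutes' c := Subtype.ext (by
    change incl he (e * algebraMap k A c * e) * eBar he
      = eBar he * incl he (algebraMap k A c) * eBar he
    have hc : incl he (algebraMap k A c) * eBar he = eBar he * incl he (algebraMap k A c) :=
      Algebra.commutes c (eBar he)
    rw [map_mul, map_mul, mul_assoc _ (incl he e) (eBar he), incl_mul_eBar, mul_assoc, hc,
      ← mul_assoc, incl_mul_eBar, ← hc, mul_assoc, (eBar_idem he).eq])

end Mirror

/-! ## The reduced mirror-reflective algebra `S(A, e)` -/

/-- The reduced mirror-reflective algebra `S(A, e)`, as the subring `e₀ R(A, e) e₀` of `R(A, e)`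
with identity `e₀`. Its underlying group is `(1-e)A(1-e) ⊕ Ae ⊗_Λ eA`, see
`ReducedMirror.mem_iff`. -/
abbrev ReducedMirror (he : IsIdempotentElem e) : Type u := (Mirror.eZero_idem he).Corner

namespace ReducedMirror

variable {he}

open Mirror

lemma eZero_mul (r : Mirror he) : eZero he * r =
    ⟨(1 - e) * r.base, r.tens + (eBar he * incl he r.base).tens⟩ := by
  rw [mul_incl, mul_def]
  refine Mirror.ext (congrArg (· * r.base) (add_zero (1 - e))) ?_
  have h1 : (eZero he).base = 1 - e := add_zero _
  have h2 : (eZero he).tens = (eBar he).tens := zero_add _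
  have h3 : mulMap he (eBar he).tens = e := he.eq
  change lact he (eZero he).base r.tens + ract he r.base (eZero he).tens
    + lact he (mulMap he (eZero he).tens) r.tens = r.tens + ract he r.base (eBar he).tens
  rw [h1, h2, h3, add_right_comm, ← lact_add, sub_add_cancel, lact_one]

lemma mul_eZero (r : Mirror he) : r * eZero he =
    ⟨r.base * (1 - e), r.tens + (incl he r.base * eBar he).tens⟩ := by
  rw [incl_mul, mul_def]
  refine Mirror.ext (congrArg (r.base * ·) (add_zero (1 - e))) ?_
  have h1 : (eZero he).base = 1 - e := add_zero _
  have h2 : (eZero he).tens = (eBar he).tens := zero_add _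
  have h3 : mulMap he (eBar he).tens = e := he.eq
  change lact he r.base (eZero he).tens + ract he (eZero he).base r.tens
    + lact he (mulMap he r.tens) (eZero he).tens = r.tens + lact he r.base (eBar he).tens
  rw [h1, h2, lact_mulMap_eq_ract, h3, add_assoc, ← ract_add, sub_add_cancel, ract_one, add_comm]

/-- `S(A, e)` consists of the `(a, t)` with `a ∈ (1-e)A(1-e)` and `t ∈ Ae ⊗_Λ eA`. -/
lemma mem_iff (r : Mirror he) :
    r ∈ Subsemigroup.corner (eZero he) ↔ r.base ∈ Subsemigroup.corner (1 - e) := by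
  rw [Subsemigroup.mem_corner_iff (eZero_idem he), Subsemigroup.mem_corner_iff he.one_sub,
    eZero_mul, mul_eZero]
  constructor
  · rintro ⟨h1, h2⟩
    exact ⟨congrArg base h1, congrArg base h2⟩
  · rintro ⟨h1, h2⟩
    refine ⟨Mirror.ext h1 ?_, Mirror.ext h2 ?_⟩
    · have h : e * r.base = 0 := by
        rw [← h1, ← mul_assoc, mul_sub, mul_one, he.eq, sub_self, zero_mul]
      have : eBar he * incl he r.base = 0 := by
        rw [← eBar_mul_incl, mul_assoc, ← map_mul, h, map_zero, mul_zero]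
      rw [this]
      exact add_zero r.tens
    · have h : r.base * e = 0 := by
        rw [← h2, mul_assoc, sub_mul, one_mul, he.eq, sub_self, mul_zero]
      have : incl he r.base * eBar he = 0 := by
        rw [← incl_mul_eBar, ← mul_assoc, ← map_mul, h, map_zero, zero_mul]
      rw [this]
      exact add_zero r.tens

/-- The idempotent `ē` as an element of `S(A, e)`. -/
def eBar (he : IsIdempotentElem e) : ReducedMirror he :=
  ⟨Mirror.eBar he, (mem_iff _).mpr ⟨0, by
    change (1 - e) * 0 * (1 - e) = 0
    rw [mul_zero, zero_mul]⟩⟩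

lemma eBar_idem (he : IsIdempotentElem e) : IsIdempotentElem (eBar he) :=
  Subtype.ext (Mirror.eBar_idem he)

/-- The surjection `S(A, e) → (1-e)A(1-e)`, `(a, t) ↦ a`, induced by `π₁`. -/
def piOne (k : Type v) [CommRing k] [Algebra k A] (he : IsIdempotentElem e) :
    ReducedMirror he →ₐ[k] he.one_sub.Corner where
  toFun r := ⟨Mirror.piOne k he r.1, (mem_iff r.1).mp r.2⟩
  map_one' := Subtype.ext (add_zero (1 - e))
  map_zero' := rfl
  map_add' _ _ := rfl
  map_mul' _ _ := rfl
  commutes' c := Subtype.ext (by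
    have h : Mirror.piOne k he (eZero he) = 1 - e := add_zero (1 - e)
    change Mirror.piOne k he (eZero he * algebraMap k (Mirror he) c * eZero he)
      = (1 - e) * algebraMap k A c * (1 - e)
    rw [map_mul, map_mul, h, AlgHom.commutes])

lemma val_mem_corner (x : (eBar_idem he).Corner) :
    x.1.1 ∈ Subsemigroup.corner (Mirror.eBar he) := by
  obtain ⟨⟨x, hx⟩, y, hy⟩ := x
  exact ⟨y.1, congrArg Subtype.val hy⟩

lemma mem_of_mem_corner {x : Mirror he} (hx : x ∈ Subsemigroup.corner (Mirror.eBar he)) :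
    x ∈ Subsemigroup.corner (eZero he) := by
  obtain ⟨y, rfl⟩ := hx
  refine (mem_iff _).mpr ⟨0, ?_⟩
  change (1 - e) * 0 * (1 - e) = 0 * y.base * 0
  rw [mul_zero, mul_zero, zero_mul]

/-- `ēRē = ēSē` as algebras. -/
def cornerEquivCorner (k : Type v) [CommRing k] [Algebra k A] (he : IsIdempotentElem e) :
    (Mirror.eBar_idem he).Corner ≃ₐ[k] (eBar_idem he).Corner where
  toFun x := ⟨⟨x.1, mem_of_mem_corner x.2⟩, ⟨x.1, mem_of_mem_corner x.2⟩, Subtype.ext (by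
    obtain ⟨h1, h2⟩ := (Subsemigroup.mem_corner_iff (Mirror.eBar_idem he)).mp x.2
    change Mirror.eBar he * x.1 * Mirror.eBar he = x.1
    rw [h1, h2])⟩
  invFun x := ⟨x.1.1, val_mem_corner x⟩
  left_inv _ := rfl
  right_inv _ := rfl
  map_mul' _ _ := rfl
  map_add' _ _ := rfl
  commutes' c := Subtype.ext (Subtype.ext (by
    have h1 : Mirror.eBar he * eZero he = Mirror.eBar he :=
      ((Subsemigroup.mem_corner_iff (eZero_idem he)).mp (eBar he).2).2
    have h2 : eZero he * Mirror.eBar he = Mirror.eBar he :=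
      ((Subsemigroup.mem_corner_iff (eZero_idem he)).mp (eBar he).2).1
    change Mirror.eBar he * algebraMap k (Mirror he) c * Mirror.eBar he
      = Mirror.eBar he * (eZero he * algebraMap k (Mirror he) c * eZero he) * Mirror.eBar he
    rw [mul_assoc (Mirror.eBar he) (_ * _), mul_assoc (eZero he * _), h2, ← mul_assoc _ (_ * _),
      ← mul_assoc _ (eZero he), h1]))

/-- The algebra isomorphism `eAe ≃ ēSē`, `a ↦ a ē`. -/
def cornerEquiv (k : Type v) [CommRing k] [Algebra k A] (he : IsIdempotentElem e) :
    he.Corner ≃ₐ[k] (eBar_idem he).Corner :=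
  (Mirror.cornerEquiv k he).trans (cornerEquivCorner k he)

end ReducedMirror

end Mirror

/-! ## `n`-idempotent ideals -/

section Idempotent

section

variable {B C : Type u} [Ring B] [Ring C] (φ : B →+* C)

lemma restrictScalars_exact : PreservesFiniteLimits (ModuleCat.restrictScalars.{u} φ) ∧
    PreservesFiniteColimits (ModuleCat.restrictScalars.{u} φ) :=
  ((Functor.exact_tfae (ModuleCat.restrictScalars.{u} φ)).out 1 3).mp (fun S h => by
    rw [ShortComplex.ShortExact.moduleCat_exact_iff_function_exact] at h ⊢
    exact h)

instance : PreservesFiniteLimits (ModuleCat.restrictScalars.{u} φ) := (restrictScalars_exact φ).1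

instance : PreservesFiniteColimits (ModuleCat.restrictScalars.{u} φ) := (restrictScalars_exact φ).2

end

variable {B : Type u} [Ring B]

/-- The ideal `I` is `n`-idempotent: for all `B/I`-modules `X`, `Y` the canonical map
`Ext^i_{B/I}(X, Y) → Ext^i_B(X, Y)`, induced by restriction along `B → B/I`, is bijective
for `1 ≤ i ≤ n`. -/
def IsNIdempotent (I : Ideal B) [I.IsTwoSided] (n : ℕ) : Prop :=
  ∀ (X Y : ModuleCat.{u} (B ⧸ I)) (i : ℕ), 1 ≤ i → i ≤ n →
    Function.Bijective (fun x : Abelian.Ext.{u} X Y i =>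
      (x.mapExactFunctor (ModuleCat.restrictScalars.{u} (Ideal.Quotient.mk I)) :
        Abelian.Ext.{u} _ _ i))

/-- The ideal `I` is strong idempotent. -/
def IsStrongIdempotent (I : Ideal B) [I.IsTwoSided] : Prop :=
  ∀ n : ℕ, 1 ≤ n → IsNIdempotent I n

/-- The two-sided ideal `BfB`. -/
def idealOf (f : B) : Ideal B := (TwoSidedIdeal.span {f}).asIdeal

instance (f : B) : (idealOf f).IsTwoSided :=
  inferInstanceAs (TwoSidedIdeal.span {f}).asIdeal.IsTwoSided

end Idempotent

/-! ## Recollements -/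

section Recollement

variable (T'' T T' : Type*) [Category* T''] [Category* T] [Category* T']
  [HasZeroObject T''] [HasZeroObject T] [HasZeroObject T']
  [HasShift T'' ℤ] [HasShift T ℤ] [HasShift T' ℤ]
  [Preadditive T''] [Preadditive T] [Preadditive T']
  [∀ n : ℤ, (shiftFunctor T'' n).Additive] [∀ n : ℤ, (shiftFunctor T n).Additive]
  [∀ n : ℤ, (shiftFunctor T' n).Additive]
  [Pretriangulated T''] [Pretriangulated T] [Pretriangulated T']

/-- A recollement `(T'', T, T')` of triangulated categories. The names stand for
`iPush = i_* = i_!`, `iPull = i^*`, `iShriek = i^!`, `jPull = j^* = j^!`, `jPush = j_*` and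
`jShriek = j_!`. -/
structure Recollement where
  iPush : T'' ⥤ T
  iPull : T ⥤ T''
  iShriek : T ⥤ T''
  jPull : T ⥤ T'
  jPush : T' ⥤ T
  jShriek : T' ⥤ T
  [iPushShift : iPush.CommShift ℤ]
  [iPullShift : iPull.CommShift ℤ]
  [iShriekShift : iShriek.CommShift ℤ]
  [jPullShift : jPull.CommShift ℤ]
  [jPushShift : jPush.CommShift ℤ]
  [jShriekShift : jShriek.CommShift ℤ]
  [iPushTriangulated : iPush.IsTriangulated]
  [iPullTriangulated : iPull.IsTriangulated]
  [iShriekTriangulated : iShriek.IsTriangulated]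
  [jPullTriangulated : jPull.IsTriangulated]
  [jPushTriangulated : jPush.IsTriangulated]
  [jShriekTriangulated : jShriek.IsTriangulated]
  iPullAdj : iPull ⊣ iPush
  iShriekAdj : iPush ⊣ iShriek
  jShriekAdj : jShriek ⊣ jPull
  jPushAdj : jPull ⊣ jPush
  iPush_full : iPush.Full
  iPush_faithful : iPush.Faithful
  jPush_full : jPush.Full
  jPush_faithful : jPush.Faithful
  jShriek_full : jShriek.Full
  jShriek_faithful : jShriek.Faithful
  isZero_jPull_iPush : ∀ X : T'', IsZero (jPull.obj (iPush.obj X))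
  /-- The triangle `i_! i^! X → X → j_* j^* X → (i_! i^! X)[1]`. -/
  triangle_left : ∀ X : T, ∃ h : jPush.obj (jPull.obj X) ⟶ (iPush.obj (iShriek.obj X))⟦(1 : ℤ)⟧,
    Triangle.mk (iShriekAdj.counit.app X) (jPushAdj.unit.app X) h ∈ distTriang T
  /-- The triangle `j_! j^! X → X → i_* i^* X → (j_! j^! X)[1]`. -/
  triangle_right : ∀ X : T, ∃ h : iPush.obj (iPull.obj X) ⟶ (jShriek.obj (jPull.obj X))⟦(1 : ℤ)⟧,
    Triangle.mk (jShriekAdj.counit.app X) (iPullAdj.unit.app X) h ∈ distTriang T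

attribute [instance] Recollement.iPushShift Recollement.jPullShift

end Recollement

section Standard

variable {B C Γ : Type u} [Ring B] [Ring C] [Ring Γ]
  [HasDerivedCategory.{w} (ModuleCat.{u} B)] [HasDerivedCategory.{w} (ModuleCat.{u} C)]
  [HasDerivedCategory.{w} (ModuleCat.{u} Γ)]

/-- The recollement `Rc` of `(D(C), D(B), D(Γ))` is the standard recollement induced by `BfB`,
where `D(B/BfB)` is identified with `D(C)` by a surjection `φ : B → C` with kernel `BfB`, and
`D(fBf)` is identified with `D(Γ)` by an isomorphism `ψ : Γ ≃ fBf`: the ideal `BfB` is strong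
idempotent, `i_*` is the derived restriction functor along `φ`, and `j^*` is the derived functor
of `M ↦ fM` (as triangle functors). The four other functors are determined as adjoints. -/
structure IsStandardRecollement {f : B} (hf : IsIdempotentElem f) (φ : B →+* C)
    (ψ : Γ ≃+* hf.Corner)
    (Rc : Recollement (DerivedCategory.{w} (ModuleCat.{u} C))
      (DerivedCategory.{w} (ModuleCat.{u} B)) (DerivedCategory.{w} (ModuleCat.{u} Γ))) :
    Prop where
  strong : IsStrongIdempotent (idealOf f)
  surjective : Function.Surjective φ
  ker_eq : RingHom.ker φ = idealOf f
  iPush_iso : ∃ α : Rc.iPush ≅ (ModuleCat.restrictScalars.{u} φ).mapDerivedCategory,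
    NatTrans.CommShift α.hom ℤ
  jPull_iso : ∃ β : Rc.jPull ≅
      (cornerFunctor hf ⋙ ModuleCat.restrictScalars.{u} (ψ : Γ →+* hf.Corner)).mapDerivedCategory,
    NatTrans.CommShift β.hom ℤ

end Standard

end MirrorReflective

end

open MirrorReflective

noncomputable section

/-! ## Unbounded resolutions -/

namespace CategoryTheory.ObjectProperty

section Tower

variable {T : Type u} [Category.{v} T] [HasZeroObject T] [HasShift T ℤ] [Preadditive T]
  [∀ n : ℤ, (shiftFunctor T n).Additive] [Pretriangulated T]

lemma isColocal_of_distTriang (P : ObjectProperty T) [P.IsStableUnderShift ℤ]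
    (S : Triangle T) (hS : S ∈ distTriang T) (h : P.rightOrthogonal S.obj₃) :
    P.isColocal S.mor₁ := by
  intro Z hZ
  refine ⟨fun a b hab ↦ ?_, fun a ↦ ?_⟩
  · obtain ⟨c, hc⟩ := Triangle.coyoneda_exact₂ _ (inv_rot_of_distTriang _ hS) (a - b)
      ((Preadditive.sub_comp _ _ _).trans (sub_eq_zero.mpr hab))
    have h' : c = 0 := P.rightOrthogonal.le_shift (-1) _ h c hZ
    rw [← sub_eq_zero, hc, h']
    exact zero_comp
  · obtain ⟨c, hc⟩ := Triangle.coyoneda_exact₂ _ hS a (h _ hZ)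
    exact ⟨c, hc.symm⟩

/-- A countable tower whose transition maps have cones right orthogonal to `P`, and whose homotopy
limit is in `P`, gives a resolution of its bottom term. -/
lemma exists_rightOrthogonal_of_tower (P : ObjectProperty T) [P.IsTriangulated]
    [P.IsClosedUnderIsomorphisms] (X : ℕ → T) (t : ∀ n, X (n + 1) ⟶ X n)
    (ht : ∀ n, P.isColocal (t n)) (c : Fan X) (hc : IsLimit c) (g : c.pt ⟶ c.pt)
    (hg : ∀ n, g ≫ c.proj n = c.proj n - c.proj (n + 1) ≫ t n) (hgP : P.trW g) :
    ∃ (Y : T) (f : X 0 ⟶ Y), P.trW f ∧ P.rightOrthogonal Y := by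
  obtain ⟨W, u, δ, hT, hW⟩ := hgP
  obtain ⟨I, ι, κ, hI⟩ := distinguished_cocone_triangle₂ (δ ≫ (c.proj 0)⟦(1 : ℤ)⟧')
  refine ⟨I, ι, ⟨W, κ, _, hI, hW⟩, ?_⟩
  have lift {Z : T} (hZ : P Z) (s : ∀ n, Z ⟶ X n) (a : Z ⟶ X 0) :
      ∃ b : Z ⟶ c.pt, b ≫ c.proj 0 = a ∧ ∀ n, b ≫ g ≫ c.proj n = s n := by
    choose r hr using fun n ↦ (ht n Z hZ).2
    let y : ∀ n, Z ⟶ X n := fun n ↦ Nat.rec a (fun n z ↦ r n (z - s n)) n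
    have hy (n : ℕ) : y (n + 1) ≫ t n = y n - s n := hr n _
    have hp (n : ℕ) : Fan.IsLimit.lift hc y ≫ c.proj n = y n := Fan.IsLimit.fac hc y n
    refine ⟨Fan.IsLimit.lift hc y, hp 0, fun n ↦ ?_⟩
    rw [hg, Preadditive.comp_sub, hp, reassoc_of% hp (n + 1), hy, sub_sub_cancel]
  have inj {Z : T} (hZ : P Z) (b : Z ⟶ c.pt) (h0 : b ≫ c.proj 0 = 0) (h1 : b ≫ g = 0) :
      b = 0 := by
    have h (n : ℕ) : b ≫ c.proj n = 0 := by
      induction n with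
      | zero => exact h0
      | succ n hn =>
        refine (ht n Z hZ).1 ?_
        have := h1 =≫ c.proj n
        rw [Category.assoc, hg, Preadditive.comp_sub, hn, zero_comp, zero_sub, neg_eq_zero] at this
        simpa using this
    exact Fan.IsLimit.hom_ext hc _ _ (fun n ↦ by simpa using h n)
  have key (Z : T) (hZ : P Z) (w : Z⟦(1 : ℤ)⟧ ⟶ I) : w = 0 := by
    have hZ' : P (Z⟦(1 : ℤ)⟧) := P.le_shift 1 _ hZ
    have h31 : δ ≫ g⟦(1 : ℤ)⟧' = 0 := comp_distTriang_mor_zero₃₁ _ hT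
    have h12 : g ≫ u = 0 := comp_distTriang_mor_zero₁₂ _ hT
    have k31 : (δ ≫ (c.proj 0)⟦(1 : ℤ)⟧') ≫ ι⟦(1 : ℤ)⟧' = 0 := comp_distTriang_mor_zero₃₁ _ hI
    have k23 : κ ≫ δ ≫ (c.proj 0)⟦(1 : ℤ)⟧' = 0 := comp_distTriang_mor_zero₂₃ _ hI
    have hv : w ≫ κ = 0 := by
      obtain ⟨h, hh⟩ := (shiftFunctor T (1 : ℤ)).map_surjective (w ≫ κ ≫ δ)
      have e0 : h ≫ c.proj 0 = 0 := (shiftFunctor T (1 : ℤ)).map_injective (by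
        rw [Functor.map_comp, hh, Functor.map_zero, Category.assoc, Category.assoc, k23,
          comp_zero])
      have e1 : h ≫ g = 0 := (shiftFunctor T (1 : ℤ)).map_injective (by
        rw [Functor.map_comp, hh, Functor.map_zero, Category.assoc, Category.assoc, h31,
          comp_zero, comp_zero])
      rw [inj hZ h e0 e1, Functor.map_zero] at hh
      obtain ⟨b, hb⟩ : ∃ b : Z⟦(1 : ℤ)⟧ ⟶ c.pt, w ≫ κ = b ≫ u :=
        Triangle.coyoneda_exact₃ _ hT (w ≫ κ) ((Category.assoc _ _ _).trans hh.symm)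
      obtain ⟨y, -, hy⟩ := lift hZ' (fun n ↦ b ≫ c.proj n) 0
      have : b = y ≫ g := Fan.IsLimit.hom_ext hc _ _ (fun n ↦ by simpa using (hy n).symm)
      rw [hb, this, Category.assoc, h12, comp_zero]
    obtain ⟨a, ha⟩ : ∃ a : Z⟦(1 : ℤ)⟧ ⟶ X 0, w = a ≫ ι := Triangle.coyoneda_exact₂ _ hI w hv
    obtain ⟨b, hb0, hb⟩ := lift hZ' (fun _ ↦ 0) a
    have hbg : b ≫ g = 0 := Fan.IsLimit.hom_ext hc _ _ (fun n ↦ by simpa using hb n)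
    obtain ⟨v, hv⟩ : ∃ v : Z⟦(1 : ℤ)⟧⟦(1 : ℤ)⟧ ⟶ W, b⟦(1 : ℤ)⟧' = v ≫ δ :=
      Triangle.coyoneda_exact₁ _ hT (b⟦(1 : ℤ)⟧') (by
      change b⟦(1 : ℤ)⟧' ≫ g⟦(1 : ℤ)⟧' = 0
      rw [← Functor.map_comp, hbg, Functor.map_zero])
    rw [ha]
    refine (shiftFunctor T (1 : ℤ)).map_injective ?_
    rw [Functor.map_comp, ← hb0, Functor.map_comp, hv, Functor.map_zero, Category.assoc,
      Category.assoc]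
    rw [Category.assoc] at k31
    rw [k31, comp_zero]
  intro Z w hZ
  have e := (shiftEquiv T (1 : ℤ)).counitIso.app Z
  have := key _ (P.le_shift (-1) _ hZ) (e.hom ≫ w)
  exact (cancel_epi e.hom).1 (this.trans comp_zero.symm)

end Tower

end CategoryTheory.ObjectProperty

namespace CochainComplex

variable {C : Type u} [Category.{v} C] [Abelian C]

section Products

variable {ι : Type*} [HasProductsOfShape ι C] {X : ι → CochainComplex C ℤ} {c : Fan X}

/-- The components of a product of cochain complexes are products. -/
def isLimitFanEval (hc : IsLimit c) (m : ℤ) :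
    IsLimit (Fan.mk (c.pt.X m) (fun i ↦ (c.proj i).f m)) :=
  isLimitMapConeFanMkEquiv (HomologicalComplex.eval C (.up ℤ) m) X c.proj
    (isLimitOfPreserves _ (IsLimit.ofIsoLimit hc (Fan.ext (Iso.refl _) (by simp))))

lemma hom_ext_of_isLimitFan (hc : IsLimit c) {m : ℤ} {A : C} {a b : A ⟶ c.pt.X m}
    (h : ∀ i, a ≫ (c.proj i).f m = b ≫ (c.proj i).f m) : a = b :=
  Fan.IsLimit.hom_ext (isLimitFanEval hc m) _ _ h

/-- A homotopy to zero into a product is given by homotopies to zero into all factors. -/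
def homotopyOfIsLimitFan (hc : IsLimit c) {K : CochainComplex C ℤ} (f : K ⟶ c.pt)
    (h : ∀ i, Homotopy (f ≫ c.proj i) 0) : Homotopy f 0 where
  hom p q := Fan.IsLimit.lift (isLimitFanEval hc q) (fun i ↦ (h i).hom p q)
  zero p q hpq := hom_ext_of_isLimitFan hc (fun i ↦ by
    refine (Fan.IsLimit.fac (isLimitFanEval hc q) _ i).trans ?_
    rw [(h i).zero p q hpq, zero_comp])
  comm m := hom_ext_of_isLimitFan hc (fun i ↦ by
    have hl (p q : ℤ) : Fan.IsLimit.lift (isLimitFanEval hc q) (fun i ↦ (h i).hom p q) ≫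
        (c.proj i).f q = (h i).hom p q := Fan.IsLimit.fac (isLimitFanEval hc q) _ i
    have := (h i).comm m
    rw [Preadditive.add_comp, Preadditive.add_comp, ← dNext_comp_right, ← prevD_comp_right]
    simp only [hl]
    simpa using this)

lemma nonempty_isLimit_quotient_fan (hc : IsLimit c) :
    Nonempty (IsLimit (Fan.mk ((HomotopyCategory.quotient C (.up ℤ)).obj c.pt)
      (fun i ↦ (HomotopyCategory.quotient C (.up ℤ)).map (c.proj i)))) := by
  let q := HomotopyCategory.quotient C (.up ℤ)
  have inj {K : CochainComplex C ℤ} (m : q.obj K ⟶ q.obj c.pt)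
      (hm : ∀ i, m ≫ q.map (c.proj i) = 0) : m = 0 := by
    obtain ⟨m, rfl⟩ := q.map_surjective m
    refine (HomotopyCategory.quotient_map_eq_zero_iff _).mpr
      ⟨homotopyOfIsLimitFan hc _ (fun i ↦ HomotopyCategory.homotopyOfEq _ _ ?_)⟩
    rw [Functor.map_comp, hm i, Functor.map_zero]
  have ex (s : Fan (fun i ↦ q.obj (X i))) : ∃ l : s.pt ⟶ q.obj c.pt,
      ∀ i, l ≫ q.map (c.proj i) = s.proj i := by
    obtain ⟨K, hK⟩ := HomotopyCategory.quotient_obj_surjective s.pt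
    let e : q.obj K ≅ s.pt := eqToIso hK
    choose f hf using fun i ↦ q.map_surjective (e.hom ≫ s.proj i)
    refine ⟨e.inv ≫ q.map (Fan.IsLimit.lift hc f), fun i ↦ ?_⟩
    rw [Category.assoc, ← Functor.map_comp]
    have : Fan.IsLimit.lift hc f ≫ c.proj i = f i := Fan.IsLimit.fac hc f i
    rw [this, hf, Iso.inv_hom_id_assoc]
  choose l hl using ex
  refine ⟨Fan.IsLimit.mk _ l hl (fun s m hm ↦ ?_)⟩
  obtain ⟨K, hK⟩ := HomotopyCategory.quotient_obj_surjective s.pt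
  let e : q.obj K ≅ s.pt := eqToIso hK
  let m' : s.pt ⟶ q.obj c.pt := m
  have := inj (e.hom ≫ (m' - l s)) (fun i ↦ by
    have h1 : m' ≫ q.map (c.proj i) = s.proj i := hm i
    have h2 : l s ≫ q.map (c.proj i) = s.proj i := hl s i
    rw [Category.assoc, Preadditive.sub_comp, h1, h2, sub_self, comp_zero])
  exact sub_eq_zero.mp ((cancel_epi e.hom).1 (this.trans comp_zero.symm))

end Products

lemma homologyMap_eq_zero_of_refinement {X Y : CochainComplex C ℤ} (f : X ⟶ Y) (m : ℤ) {A : C}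
    (e : A ⟶ X.cycles m) [Epi e] (y : A ⟶ Y.X (m - 1))
    (h : e ≫ X.iCycles m ≫ f.f m = y ≫ Y.d (m - 1) m) :
    HomologicalComplex.homologyMap f m = 0 := by
  rw [← cancel_epi (X.homologyπ m), ← cancel_epi e, HomologicalComplex.homologyπ_naturality]
  have : e ≫ HomologicalComplex.cyclesMap f m = y ≫ Y.toCycles (m - 1) m := by
    rw [← cancel_mono (Y.iCycles m)]
    simpa using h
  rw [reassoc_of% this]
  simp

lemma exists_refinement_of_homologyMap_eq_zero {X Y : CochainComplex C ℤ} (f : X ⟶ Y) (m : ℤ)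
    (h : HomologicalComplex.homologyMap f m = 0) :
    ∃ (A : C) (e : A ⟶ X.cycles m) (_ : Epi e) (y : A ⟶ Y.X (m - 1)),
      e ≫ X.iCycles m ≫ f.f m = y ≫ Y.d (m - 1) m := by
  have h0 : HomologicalComplex.cyclesMap f m ≫ Y.homologyπ m = 0 := by
    rw [← HomologicalComplex.homologyπ_naturality, h, comp_zero]
  have hex : (ShortComplex.mk (Y.toCycles (m - 1) m) (Y.homologyπ m) (by simp)).Exact :=
    ShortComplex.exact_of_g_is_cokernel _ (Y.homologyIsCokernel (m - 1) m (by simp))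
  obtain ⟨A, e, he, y, hy⟩ := (ShortComplex.exact_iff_exact_up_to_refinements _).mp hex
    (HomologicalComplex.cyclesMap f m) h0
  refine ⟨A, e, he, y, ?_⟩
  dsimp at hy
  have := hy =≫ Y.iCycles m
  simpa using this

/-- If all components have zero homology, a shift endomorphism of a product has zero homology. -/
lemma homologyMap_tower_eq_zero [HasProductsOfShape ℕ C]
    (hepi : ∀ (A B : ℕ → C) (f : ∀ n, A n ⟶ B n) [∀ n, Epi (f n)], Epi (Limits.Pi.map f))
    {X : ℕ → CochainComplex C ℤ} {c : Fan X} (hc : IsLimit c) (t : ∀ n, X (n + 1) ⟶ X n) (m : ℤ)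
    (ht : ∀ n, HomologicalComplex.homologyMap (t n) m = 0) (τ : c.pt ⟶ c.pt)
    (hτ : ∀ n, τ ≫ c.proj n = c.proj (n + 1) ≫ t n) :
    HomologicalComplex.homologyMap τ m = 0 := by
  choose A e he y hy using fun n ↦ exists_refinement_of_homologyMap_eq_zero (t n) m (ht n)
  have := hepi _ _ e
  let δ : c.pt.cycles m ⟶ ∏ᶜ fun n ↦ (X (n + 1)).cycles m :=
    Pi.lift (fun n ↦ HomologicalComplex.cyclesMap (c.proj (n + 1)) m)
  refine homologyMap_eq_zero_of_refinement τ m (pullback.snd (Limits.Pi.map e) δ)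
    (Fan.IsLimit.lift (isLimitFanEval hc (m - 1))
      (fun n ↦ pullback.fst (Limits.Pi.map e) δ ≫ Pi.π _ n ≫ y n))
    (hom_ext_of_isLimitFan hc (fun n ↦ ?_))
  have hl : Fan.IsLimit.lift (isLimitFanEval hc (m - 1))
      (fun n ↦ pullback.fst (Limits.Pi.map e) δ ≫ Pi.π _ n ≫ y n) ≫ (c.proj n).f (m - 1)
      = pullback.fst (Limits.Pi.map e) δ ≫ Pi.π _ n ≫ y n :=
    Fan.IsLimit.fac (isLimitFanEval hc (m - 1)) _ n
  have h1 : τ.f m ≫ (c.proj n).f m = (c.proj (n + 1)).f m ≫ (t n).f m := by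
    simpa using congrArg (fun φ ↦ φ.f m) (hτ n)
  have h2 := pullback.condition (f := Limits.Pi.map e) (g := δ) =≫ Pi.π _ n
  simp only [Category.assoc, Limits.Pi.map_π, δ, Pi.lift_π] at h2
  simp only [Category.assoc]
  rw [h1, ← HomologicalComplex.Hom.comm, reassoc_of% hl, ← hy n, reassoc_of% h2]
  simp [δ]

lemma isKInjective_of_d_eq_zero (I : CochainComplex C ℤ) [∀ m, Injective (I.X m)]
    (hI : ∀ m n, I.d m n = 0) : I.IsKInjective where
  nonempty_homotopy_zero {K} f hK := by
    have hs (m : ℤ) : (K.sc' (m - 1) m (m + 1)).Exact :=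
      (K.exactAt_iff' (m - 1) m (m + 1) (by simp) (by simp)).mp (hK m)
    have hf (m : ℤ) : K.d (m - 1) m ≫ f.f m = 0 := by rw [← f.comm, hI, comp_zero]
    let h (m : ℤ) : K.X (m + 1) ⟶ I.X m := (hs m).descToInjective (f.f m) (hf m)
    have hh (m : ℤ) : K.d m (m + 1) ≫ h m = f.f m := (hs m).comp_descToInjective _ _
    refine ⟨{
      hom := fun p q ↦ if hpq : q + 1 = p then (K.XIsoOfEq hpq.symm).hom ≫ h q else 0
      zero := fun p q hpq ↦ dif_neg hpq
      comm := fun m ↦ ?_ }⟩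
    rw [dNext_eq _ (i' := m + 1) (by simp), prevD_eq _ (j' := m - 1) (by simp), dif_pos rfl,
      hI (m - 1) m, comp_zero, add_zero, HomologicalComplex.zero_f, add_zero, ← hh m]
    simp

lemma exists_mono_homologyMap_of_enoughInjectives [EnoughInjectives C] (X : CochainComplex C ℤ) :
    ∃ (I : CochainComplex C ℤ) (f : X ⟶ I), I.IsKInjective ∧
      ∀ m, Mono (HomologicalComplex.homologyMap f m) := by
  let J (m : ℤ) : C := Injective.under (X.homology m)
  obtain ⟨I, hI, ⟨e⟩⟩ : ∃ I : CochainComplex C ℤ, (∀ m n, I.d m n = 0) ∧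
      Nonempty (∀ m, J m ≅ I.X m) :=
    ⟨{ X := J, d := fun _ _ ↦ 0 }, fun _ _ ↦ rfl, ⟨fun _ ↦ Iso.refl _⟩⟩
  have (m : ℤ) : Injective (I.X m) :=
    Injective.of_iso (e m) (inferInstanceAs (Injective (Injective.under _)))
  let a (m : ℤ) : X.opcycles m ⟶ I.X m :=
    Injective.factorThru (Injective.ι _) (X.homologyι m) ≫ (e m).hom
  have ha (m : ℤ) : X.homologyι m ≫ a m = Injective.ι _ ≫ (e m).hom := by
    rw [← Category.assoc, Injective.comp_factorThru]
  let f : X ⟶ I :=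
    { f := fun m ↦ X.pOpcycles m ≫ a m
      comm' := fun i j _ ↦ by rw [X.d_pOpcycles_assoc, zero_comp, hI, comp_zero] }
  refine ⟨I, f, isKInjective_of_d_eq_zero I hI, fun m ↦ ?_⟩
  let r : I.opcycles m ⟶ I.X m :=
    I.descOpcycles (𝟙 _) (m - 1) (by simp) (by rw [hI, zero_comp])
  have hr : I.pOpcycles m ≫ r = 𝟙 _ := HomologicalComplex.p_descOpcycles _ _ _ _ _
  have h1 : HomologicalComplex.opcyclesMap f m ≫ r = a m := by
    rw [← cancel_epi (X.pOpcycles m), HomologicalComplex.p_opcyclesMap_assoc, hr, Category.comp_id]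
  have h2 : HomologicalComplex.homologyMap f m ≫ I.homologyι m ≫ r
      = Injective.ι _ ≫ (e m).hom := by
    rw [HomologicalComplex.homologyι_naturality_assoc, h1, ha]
  have : Mono (HomologicalComplex.homologyMap f m ≫ I.homologyι m ≫ r) := by
    rw [h2]; infer_instance
  exact mono_of_mono _ (I.homologyι m ≫ r)

lemma exists_isColocal_homologyMap_eq_zero [EnoughInjectives C] (X : CochainComplex C ℤ) :
    ∃ (X' : CochainComplex C ℤ) (t : X' ⟶ X),
      (HomotopyCategory.subcategoryAcyclic C).isColocal
        ((HomotopyCategory.quotient C (.up ℤ)).map t) ∧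
      ∀ m, HomologicalComplex.homologyMap t m = 0 := by
  let q := HomotopyCategory.quotient C (.up ℤ)
  obtain ⟨I, f, hI, hf⟩ := exists_mono_homologyMap_of_enoughInjectives X
  obtain ⟨Z, t, δ, hT⟩ := distinguished_cocone_triangle₁ (q.map f)
  obtain ⟨X', rfl⟩ := HomotopyCategory.quotient_obj_surjective Z
  obtain ⟨t, rfl⟩ := q.map_surjective t
  refine ⟨X', t, ObjectProperty.isColocal_of_distTriang _ _ hT
    ((isKInjective_iff_rightOrthogonal _).mp hI), fun m ↦ ?_⟩
  have h : q.map (t ≫ f) = 0 := (q.map_comp t f).trans (comp_distTriang_mor_zero₁₂ _ hT)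
  obtain ⟨h⟩ := (HomotopyCategory.quotient_map_eq_zero_iff _).mp h
  have := h.homologyMap_eq m
  rw [HomologicalComplex.homologyMap_comp, HomologicalComplex.homologyMap_zero] at this
  have := hf m
  exact (cancel_mono (HomologicalComplex.homologyMap f m)).mp (by rwa [zero_comp])

theorem exists_isKInjective_of_epi_piMap [EnoughInjectives C] [HasProductsOfShape ℕ C]
    (hepi : ∀ (A B : ℕ → C) (f : ∀ n, A n ⟶ B n) [∀ n, Epi (f n)], Epi (Limits.Pi.map f))
    (X : CochainComplex C ℤ) :
    ∃ (I : CochainComplex C ℤ) (f : X ⟶ I), QuasiIso f ∧ I.IsKInjective := by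
  let q := HomotopyCategory.quotient C (.up ℤ)
  choose X' t ht ht0 using exists_isColocal_homologyMap_eq_zero (C := C)
  let Xs (n : ℕ) : CochainComplex C ℤ := Nat.rec X (fun _ Y ↦ X' Y) n
  let ts (n : ℕ) : Xs (n + 1) ⟶ Xs n := t (Xs n)
  let c := limit.cone (Discrete.functor Xs)
  have hc : IsLimit c := limit.isLimit _
  let τ : c.pt ⟶ c.pt := Fan.IsLimit.lift hc (fun n ↦ Fan.proj c (n + 1) ≫ ts n)
  have hτ (n : ℕ) : τ ≫ Fan.proj c n = Fan.proj c (n + 1) ≫ ts n := Fan.IsLimit.fac hc _ n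
  have hg : (HomotopyCategory.subcategoryAcyclic C).trW (q.map (𝟙 c.pt - τ)) := by
    rw [← HomotopyCategory.quasiIso_eq_trW_subcategoryAcyclic]
    refine (HomotopyCategory.quotient_map_mem_quasiIso_iff _).mpr ?_
    rw [HomologicalComplex.mem_quasiIso_iff, quasiIso_iff]
    intro m
    rw [quasiIsoAt_iff_isIso_homologyMap, HomologicalComplex.homologyMap_sub,
      homologyMap_tower_eq_zero hepi hc ts m (fun n ↦ ht0 _ m) τ hτ, sub_zero,
      HomologicalComplex.homologyMap_id]
    infer_instance
  obtain ⟨hq⟩ := nonempty_isLimit_quotient_fan hc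
  obtain ⟨Y, f, hf, hY⟩ := ObjectProperty.exists_rightOrthogonal_of_tower
    (HomotopyCategory.subcategoryAcyclic C) (fun n ↦ q.obj (Xs n)) (fun n ↦ q.map (ts n))
    (fun n ↦ ht _) _ hq (q.map (𝟙 c.pt - τ)) (fun n ↦ by
      change q.map (𝟙 c.pt - τ) ≫ q.map (Fan.proj c n)
        = q.map (Fan.proj c n) - q.map (Fan.proj c (n + 1)) ≫ q.map (ts n)
      rw [← Functor.map_comp, ← Functor.map_comp, ← Functor.map_sub, Preadditive.sub_comp,
        Category.id_comp, hτ]) hg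
  obtain ⟨I, rfl⟩ := HomotopyCategory.quotient_obj_surjective Y
  obtain ⟨f, rfl⟩ := q.map_surjective f
  refine ⟨I, f, ?_, (isKInjective_iff_rightOrthogonal _).mpr hY⟩
  rw [← HomotopyCategory.quasiIso_eq_trW_subcategoryAcyclic] at hf
  exact (HomologicalComplex.mem_quasiIso_iff _).mp
    ((HomotopyCategory.quotient_map_mem_quasiIso_iff _).mp hf)

end CochainComplex

namespace CochainComplex

open Opposite

lemma quasiIso_of_opEquivalence_map {C : Type u} [Category.{v} C] [Abelian C]
    {K L : CochainComplex C ℤ} (g : K ⟶ L)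
    (h : QuasiIso ((opEquivalence C).functor.map g.op)) : QuasiIso g := by
  rw [← HomologicalComplex.quasiIso_opFunctor_map_iff, quasiIso_iff]
  intro m
  rw [quasiIsoAt_iff' _ (m + 1) m (m - 1) ((ComplexShape.up ℤ).symm.prev_eq' rfl)
    ((ComplexShape.up ℤ).symm.next_eq' (sub_add_cancel m 1))]
  have h1 := (quasiIso_iff _).mp h (-m)
  rw [quasiIsoAt_iff' _ (-(m + 1)) (-m) (-(m - 1)) (by simp; lia) (by simp; lia)] at h1
  change ShortComplex.QuasiIso ((HomologicalComplex.shortComplexFunctor' Cᵒᵖ _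
    (- -(m + 1)) (- -m) (- -(m - 1))).map
      ((HomologicalComplex.opFunctor C (.up ℤ)).map g.op)) at h1
  have e (i j k i' j' k' : ℤ) (hi : i = i') (hj : j = j') (hk : k = k')
      (h : ShortComplex.QuasiIso ((HomologicalComplex.shortComplexFunctor' Cᵒᵖ _ i j k).map
        ((HomologicalComplex.opFunctor C (.up ℤ)).map g.op))) :
      ShortComplex.QuasiIso ((HomologicalComplex.shortComplexFunctor' Cᵒᵖ _ i' j' k').map
        ((HomologicalComplex.opFunctor C (.up ℤ)).map g.op)) := by
    subst hi hj hk
    exact h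
  exact e _ _ _ _ _ _ (neg_neg _) (neg_neg _) (neg_neg _) h1

theorem exists_isKProjective_of_exists_isKInjective {C : Type u} [Category.{v} C] [Abelian C]
    (h : ∀ X : CochainComplex Cᵒᵖ ℤ,
      ∃ (I : CochainComplex Cᵒᵖ ℤ) (f : X ⟶ I), QuasiIso f ∧ I.IsKInjective)
    (X : CochainComplex C ℤ) :
    ∃ (P : CochainComplex C ℤ) (f : P ⟶ X), QuasiIso f ∧ P.IsKProjective := by
  obtain ⟨I, f, hf, hI⟩ := h ((opEquivalence C).functor.obj (op X))
  let P := ((opEquivalence C).inverse.obj I).unop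
  let e : (opEquivalence C).functor.obj (op P) ≅ I := (opEquivalence C).counitIso.app I
  obtain ⟨g, hg⟩ := (opEquivalence C).functor.map_surjective (f ≫ e.inv)
  refine ⟨P, g.unop, quasiIso_of_opEquivalence_map _ ?_, isKProjective_of_op ?_⟩
  · rw [Quiver.Hom.op_unop, hg]
    infer_instance
  · exact isKInjective_of_iso e.symm

end CochainComplex

namespace ModuleCat

variable (B : Type u) [Ring B]

lemma epi_piMap (X Y : ℕ → ModuleCat.{u} B) (f : ∀ n, X n ⟶ Y n) [∀ n, Epi (f n)] :
    Epi (Limits.Pi.map f) := by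
  rw [ModuleCat.epi_iff_surjective]
  intro y
  choose x hx using fun n ↦ (ModuleCat.epi_iff_surjective (f n)).mp inferInstance (Pi.π Y n y)
  let a : ModuleCat.of B B ⟶ ∏ᶜ X :=
    Pi.lift (fun n ↦ ModuleCat.ofHom (LinearMap.toSpanSingleton B (X n) (x n)))
  let b : ModuleCat.of B B ⟶ ∏ᶜ Y := ModuleCat.ofHom (LinearMap.toSpanSingleton B _ y)
  have h : a ≫ Limits.Pi.map f = b := by
    refine Pi.hom_ext _ _ (fun n ↦ ?_)
    ext
    simp [a, b, hx]
  exact ⟨a (1 : B), (ConcreteCategory.congr_hom h (1 : B)).trans (one_smul B y)⟩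

lemma mono_sigmaMap (X Y : ℕ → ModuleCat.{u} B) (f : ∀ n, X n ⟶ Y n) [∀ n, Mono (f n)] :
    Mono (Limits.Sigma.map f) := by
  have : HasCoproducts.{0} (ModuleCat.{u} B) := hasCoproducts_shrink.{0, u}
  have : AB4OfSize.{0} (ModuleCat.{u} B) := AB4OfSize_shrink.{0, u} _
  have : Mono (Discrete.natTrans (F := Discrete.functor X) (G := Discrete.functor Y)
      (fun i ↦ f i.as)) := by
    have (i : Discrete ℕ) : Mono ((Discrete.natTrans (F := Discrete.functor X)
      (G := Discrete.functor Y) (fun i ↦ f i.as)).app i) := inferInstanceAs (Mono (f i.as))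
    exact NatTrans.mono_of_mono_app _
  exact inferInstanceAs (Mono (colim.map (Discrete.natTrans (F := Discrete.functor X)
      (G := Discrete.functor Y) (fun i ↦ f i.as))))

lemma epi_piMap_op (X Y : ℕ → (ModuleCat.{u} B)ᵒᵖ) (f : ∀ n, X n ⟶ Y n) [∀ n, Epi (f n)] :
    Epi (Limits.Pi.map f) := by
  have := mono_sigmaMap B _ _ (fun n ↦ (f n).unop)
  have h : Limits.Pi.map f = (opCoproductIsoProduct (fun n ↦ (X n).unop)).inv ≫
      (Limits.Sigma.map (fun n ↦ (f n).unop)).op ≫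
        (opCoproductIsoProduct (fun n ↦ (Y n).unop)).hom := by
    rw [Iso.eq_inv_comp, ← Iso.comp_inv_eq]
    refine Quiver.Hom.unop_inj (Sigma.hom_ext _ _ (fun n ↦ Quiver.Hom.op_inj ?_))
    simp only [Category.assoc, unop_comp, op_comp, Quiver.Hom.op_unop]
    have h1 := opCoproductIsoProduct_inv_comp_ι (fun n ↦ (Y n).unop) n
    have h2 := opCoproductIsoProduct_inv_comp_ι (fun n ↦ (X n).unop) n
    have h3 : Limits.Pi.map f ≫ Pi.π Y n = Pi.π X n ≫ f n := Limits.Pi.map_π f n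
    have h4 := congrArg Quiver.Hom.op (Sigma.ι_map (fun n ↦ (f n).unop) n)
    refine (congrArg (fun z ↦ (opCoproductIsoProduct (fun n ↦ (X n).unop)).hom ≫
      Limits.Pi.map f ≫ z) h1).trans ?_
    refine (congrArg (fun z ↦ (opCoproductIsoProduct (fun n ↦ (X n).unop)).hom ≫ z) h3).trans ?_
    refine Eq.trans ?_ h4.symm
    rw [← Iso.eq_inv_comp]
    rw [op_comp, ← Category.assoc, h2]
    rfl
  rw [h]
  infer_instance

theorem exists_isKInjective (X : CochainComplex (ModuleCat.{u} B) ℤ) :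
    ∃ (I : CochainComplex (ModuleCat.{u} B) ℤ) (f : X ⟶ I), QuasiIso f ∧ I.IsKInjective :=
  CochainComplex.exists_isKInjective_of_epi_piMap (fun X Y f _ ↦ epi_piMap B X Y f) X

theorem exists_isKProjective (X : CochainComplex (ModuleCat.{u} B) ℤ) :
    ∃ (P : CochainComplex (ModuleCat.{u} B) ℤ) (f : P ⟶ X), QuasiIso f ∧ P.IsKProjective :=
  CochainComplex.exists_isKProjective_of_exists_isKInjective
    (CochainComplex.exists_isKInjective_of_epi_piMap (fun X Y f _ ↦ epi_piMap_op B X Y f)) X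

end ModuleCat

/-! ## Adjoints of derived functors -/

namespace CategoryTheory

section Universal

variable {D E : Type*} [Category* D] [Category* E] (Φ : D ⥤ E)

lemma isRightAdjoint_of_universal
    (h : ∀ X : E, ∃ (Z : D) (η : X ⟶ Φ.obj Z), ∀ Y : D,
      Function.Bijective (fun g : Z ⟶ Y ↦ η ≫ Φ.map g)) : Φ.IsRightAdjoint := by
  choose Z η hη using h
  let e (X : E) (Y : D) : (Z X ⟶ Y) ≃ (X ⟶ Φ.obj Y) := Equiv.ofBijective _ (hη X Y)
  exact ⟨_, ⟨Adjunction.adjunctionOfEquivLeft e (fun X Y Y' f g ↦ by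
    change η X ≫ Φ.map (g ≫ f) = (η X ≫ Φ.map g) ≫ Φ.map f
    rw [Functor.map_comp, Category.assoc])⟩⟩

lemma isLeftAdjoint_of_universal
    (h : ∀ X : E, ∃ (Z : D) (ε : Φ.obj Z ⟶ X), ∀ Y : D,
      Function.Bijective (fun g : Y ⟶ Z ↦ Φ.map g ≫ ε)) : Φ.IsLeftAdjoint := by
  choose Z ε hε using h
  let e (Y : D) (X : E) : (Φ.obj Y ⟶ X) ≃ (Y ⟶ Z X) := (Equiv.ofBijective _ (hε X Y)).symm
  exact ⟨_, ⟨Adjunction.adjunctionOfEquivRight e (fun Y Y' X f g ↦ by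
    refine (Equiv.symm_apply_eq _).mpr ?_
    change Φ.map f ≫ g = Φ.map (f ≫ e Y' X g) ≫ ε X
    have : Φ.map (e Y' X g) ≫ ε X = g := (Equiv.ofBijective _ (hε X Y')).apply_symm_apply g
    rw [Functor.map_comp, Category.assoc, this])⟩⟩

variable {Φ} in
lemma isIso_unit_of_universal {Ψ : E ⥤ D} (adj : Ψ ⊣ Φ) {X : E} {Z : D} (η : X ≅ Φ.obj Z)
    (h : ∀ Y : D, Function.Bijective (fun g : Z ⟶ Y ↦ η.hom ≫ Φ.map g)) :
    IsIso (adj.unit.app X) := by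
  obtain ⟨a, ha⟩ : ∃ a : Z ⟶ Ψ.obj X, η.hom ≫ Φ.map a = adj.unit.app X :=
    (h (Ψ.obj X)).2 (adj.unit.app X)
  obtain ⟨b, hb⟩ : ∃ b : Ψ.obj X ⟶ Z, adj.unit.app X ≫ Φ.map b = η.hom :=
    ⟨(adj.homEquiv _ _).symm η.hom, (adj.homEquiv_unit _ _ _).symm.trans (Equiv.apply_symm_apply _ _)⟩
  have hba : b ≫ a = 𝟙 _ := (adj.homEquiv X (Ψ.obj X)).injective (by
    refine (adj.homEquiv_unit _ _ _).trans (Eq.trans ?_ (adj.homEquiv_unit _ _ _).symm)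
    refine (congrArg (adj.unit.app X ≫ ·) (Φ.map_comp b a)).trans
      ((Category.assoc _ _ _).symm.trans ((congrArg (· ≫ Φ.map a) hb).trans (ha.trans ?_)))
    exact (Category.comp_id _).symm.trans (congrArg (adj.unit.app X ≫ ·) (Φ.map_id _).symm))
  have hab : a ≫ b = 𝟙 _ := (h Z).1 (by
    refine (congrArg (η.hom ≫ ·) (Φ.map_comp a b)).trans
      ((Category.assoc _ _ _).symm.trans ((congrArg (· ≫ Φ.map b) ha).trans (hb.trans ?_)))
    exact (Category.comp_id _).symm.trans (congrArg (η.hom ≫ ·) (Φ.map_id _).symm))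
  have : IsIso a := ⟨b, hab, hba⟩
  have : IsIso (η.hom ≫ Φ.map a) := inferInstance
  exact ha ▸ this

variable {K : Type*} [Category* K] (L : K ⥤ D) [L.EssSurj]

variable {Φ L} in
/-- A left adjoint of `L ⋙ Φ` induces a left adjoint of `Φ` if `L` is fully faithful on
morphisms out of its values. -/
def adjunctionOfPrecompRight {Λ : E ⥤ K} (adj : Λ ⊣ L ⋙ Φ)
    (h : ∀ (X : E) (y : K), Function.Bijective (L.map : (Λ.obj X ⟶ y) → _)) : Λ ⋙ L ⊣ Φ := by
  have bij (X : E) (Y : D) :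
      Function.Bijective (fun g : L.obj (Λ.obj X) ⟶ Y ↦ adj.unit.app X ≫ Φ.map g) := by
    let e := L.objObjPreimageIso Y
    have h1 : Function.Bijective (fun g : L.obj (Λ.obj X) ⟶ L.obj (L.objPreimage Y) ↦
        adj.unit.app X ≫ Φ.map g) := by
      rw [← Function.Bijective.of_comp_iff _ (h X _)]
      have := (adj.homEquiv X (L.objPreimage Y)).bijective
      rwa [show ⇑(adj.homEquiv X (L.objPreimage Y)) = _ from
        funext fun g ↦ adj.homEquiv_unit _ _ g] at this
    refine ⟨fun a b hab ↦ ?_, fun c ↦ ?_⟩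
    · rw [← cancel_mono e.inv]
      refine h1.1 ?_
      dsimp at hab ⊢
      rw [Functor.map_comp, Functor.map_comp, reassoc_of% hab]
    · obtain ⟨g, hg⟩ := h1.2 (c ≫ Φ.map e.inv)
      refine ⟨g ≫ e.hom, ?_⟩
      dsimp at hg ⊢
      rw [Functor.map_comp, reassoc_of% hg, ← Functor.map_comp, Iso.inv_hom_id, Functor.map_id,
        Category.comp_id]
  exact Adjunction.mkOfHomEquiv
    { homEquiv := fun X Y ↦ Equiv.ofBijective _ (bij X Y)
      homEquiv_naturality_left_symm := fun {X' X Y} f g ↦ by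
        rw [Equiv.symm_apply_eq]
        have hg := (Equiv.ofBijective _ (bij X Y)).apply_symm_apply g
        change adj.unit.app X ≫ Φ.map _ = g at hg
        change f ≫ g = adj.unit.app X' ≫ Φ.map (L.map (Λ.map f) ≫ _)
        have hn := adj.unit.naturality f
        dsimp at hn
        rw [Functor.map_comp, ← reassoc_of% hn, hg]
      homEquiv_naturality_right := fun {X Y Y'} f g ↦ by
        change adj.unit.app X ≫ Φ.map (f ≫ g) = (adj.unit.app X ≫ Φ.map f) ≫ Φ.map g
        rw [Functor.map_comp, Category.assoc] }

variable {Φ L} in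
lemma isLeftAdjoint_of_precomp {R : E ⥤ K} (adj : L ⋙ Φ ⊣ R)
    (h : ∀ (X : E) (y : K), Function.Bijective (L.map : (y ⟶ R.obj X) → _)) :
    Φ.IsLeftAdjoint := by
  refine isLeftAdjoint_of_universal _ (fun X ↦ ⟨L.obj (R.obj X), adj.counit.app X, fun Y ↦ ?_⟩)
  let e := L.objObjPreimageIso Y
  have h1 : Function.Bijective (fun g : L.obj (L.objPreimage Y) ⟶ L.obj (R.obj X) ↦
      Φ.map g ≫ adj.counit.app X) := by
    rw [← Function.Bijective.of_comp_iff _ (h X _)]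
    have := (adj.homEquiv (L.objPreimage Y) X).symm.bijective
    rwa [show ⇑(adj.homEquiv (L.objPreimage Y) X).symm = _ from
      funext fun g ↦ adj.homEquiv_counit _ _ g] at this
  refine ⟨fun a b hab ↦ ?_, fun c ↦ ?_⟩
  · rw [← cancel_epi e.hom]
    refine h1.1 ?_
    dsimp at hab ⊢
    rw [Functor.map_comp, Functor.map_comp, Category.assoc, hab, Category.assoc]
  · obtain ⟨g, hg⟩ := h1.2 (Φ.map e.hom ≫ c)
    refine ⟨e.inv ≫ g, ?_⟩
    dsimp at hg ⊢
    rw [Functor.map_comp, Category.assoc, hg, ← Functor.map_comp_assoc, Iso.inv_hom_id,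
      Functor.map_id, Category.id_comp]

end Universal

section HomotopyCategory

variable {A B : Type*} [Category* A] [Category* B] [Abelian A] [Abelian B]
  {F : A ⥤ B} {G : B ⥤ A} [F.Additive] [G.Additive] (adj : F ⊣ G)

/-- The unit of an adjunction, applied termwise to a complex. -/
def Adjunction.unitComplex (X : CochainComplex A ℤ) :
    X ⟶ (G.mapHomologicalComplex (.up ℤ)).obj ((F.mapHomologicalComplex (.up ℤ)).obj X) where
  f n := adj.unit.app (X.X n)
  comm' i j _ := (adj.unit.naturality (X.d i j)).symm

/-- The counit of an adjunction, applied termwise to a complex. -/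
def Adjunction.counitComplex (Y : CochainComplex B ℤ) :
    (F.mapHomologicalComplex (.up ℤ)).obj ((G.mapHomologicalComplex (.up ℤ)).obj Y) ⟶ Y where
  f n := adj.counit.app (Y.X n)
  comm' i j _ := (adj.counit.naturality (Y.d i j)).symm

/-- The adjunction between homotopy categories induced by an adjunction. -/
def Adjunction.mapHomotopyCategory :
    F.mapHomotopyCategory (.up ℤ) ⊣ G.mapHomotopyCategory (.up ℤ) where
  unit :=
    { app := fun X ↦ (HomotopyCategory.quotient A (.up ℤ)).map (adj.unitComplex X.as)
      naturality := fun X Y f ↦ by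
        obtain ⟨f, rfl⟩ := (HomotopyCategory.quotient A (.up ℤ)).map_surjective f
        refine ((HomotopyCategory.quotient A (.up ℤ)).map_comp f (adj.unitComplex Y.as)).symm.trans
          (Eq.trans ?_ ((HomotopyCategory.quotient A (.up ℤ)).map_comp (adj.unitComplex X.as)
          ((G.mapHomologicalComplex (.up ℤ)).map ((F.mapHomologicalComplex (.up ℤ)).map f))))
        congr 1
        ext n
        exact adj.unit.naturality (f.f n) }
  counit :=
    { app := fun X ↦ (HomotopyCategory.quotient B (.up ℤ)).map (adj.counitComplex X.as)
      naturality := fun X Y f ↦ by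
        obtain ⟨f, rfl⟩ := (HomotopyCategory.quotient B (.up ℤ)).map_surjective f
        refine ((HomotopyCategory.quotient B (.up ℤ)).map_comp
          ((F.mapHomologicalComplex (.up ℤ)).map ((G.mapHomologicalComplex (.up ℤ)).map f))
          (adj.counitComplex Y.as)).symm.trans
          (Eq.trans ?_ ((HomotopyCategory.quotient B (.up ℤ)).map_comp (adj.counitComplex X.as) f))
        congr 1
        ext n
        exact adj.counit.naturality (f.f n) }
  left_triangle_components X := by
    refine ((HomotopyCategory.quotient B (.up ℤ)).map_comp
      ((F.mapHomologicalComplex (.up ℤ)).map (adj.unitComplex X.as))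
      (adj.counitComplex _)).symm.trans
      (Eq.trans ?_ ((HomotopyCategory.quotient B (.up ℤ)).map_id _))
    congr 1
    ext n
    exact adj.left_triangle_components (X.as.X n)
  right_triangle_components X := by
    refine ((HomotopyCategory.quotient A (.up ℤ)).map_comp
      (adj.unitComplex _) ((G.mapHomologicalComplex (.up ℤ)).map (adj.counitComplex X.as))).symm.trans
      (Eq.trans ?_ ((HomotopyCategory.quotient A (.up ℤ)).map_id _))
    congr 1
    ext n
    exact adj.right_triangle_components (X.as.X n)

end HomotopyCategory

end CategoryTheory

namespace DerivedCategory

section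

variable {C : Type u} [Category.{v} C] [Abelian C] [HasDerivedCategory.{w} C]

lemma isLeftAdjoint_Qh
    (h : ∀ X : CochainComplex C ℤ,
      ∃ (I : CochainComplex C ℤ) (f : X ⟶ I), QuasiIso f ∧ I.IsKInjective) :
    (Qh : _ ⥤ DerivedCategory C).IsLeftAdjoint := by
  refine isLeftAdjoint_of_universal _ (fun X ↦ ?_)
  obtain ⟨I, f, hf, hI⟩ := h (Q.objPreimage X)
  let e : Qh.obj ((HomotopyCategory.quotient _ _).obj I) ≅ X :=
    (quotientCompQhIso C).app I ≪≫ (asIso (Q.map f)).symm ≪≫ Q.objObjPreimageIso X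
  refine ⟨_, e.hom, fun Y ↦ ?_⟩
  have h := (Iso.homCongr (Iso.refl (Qh.obj Y)) e).bijective.comp
    (CochainComplex.IsKInjective.Qh_map_bijective Y I)
  rwa [show _ ∘ _ = (fun g ↦ Qh.map g ≫ e.hom) from funext fun g ↦ by
    simp [Iso.homCongr_apply]] at h

lemma exists_adjunction_Qh
    (h : ∀ X : CochainComplex C ℤ,
      ∃ (P : CochainComplex C ℤ) (f : P ⟶ X), QuasiIso f ∧ P.IsKProjective) :
    ∃ (Λ : DerivedCategory C ⥤ HomotopyCategory C (.up ℤ)) (_ : Λ ⊣ Qh), Λ.Full ∧ Λ.Faithful := by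
  have huniv (X : DerivedCategory C) : ∃ (Z : HomotopyCategory C (.up ℤ)) (η : X ≅ Qh.obj Z),
      ∀ Y, Function.Bijective (fun g : Z ⟶ Y ↦ η.hom ≫ Qh.map g) := by
    obtain ⟨P, f, hf, hP⟩ := h (Q.objPreimage X)
    let e : X ≅ Qh.obj ((HomotopyCategory.quotient _ _).obj P) :=
      (Q.objObjPreimageIso X).symm ≪≫ (asIso (Q.map f)).symm ≪≫ ((quotientCompQhIso C).app P).symm
    refine ⟨_, e, fun Y ↦ ?_⟩
    have h := (Iso.homCongr e.symm (Iso.refl (Qh.obj Y))).bijective.comp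
      (CochainComplex.IsKProjective.Qh_map_bijective P Y)
    rwa [show _ ∘ _ = (fun g ↦ e.hom ≫ Qh.map g) from funext fun g ↦ by
      simp [Iso.homCongr_apply]] at h
  have : (Qh : _ ⥤ DerivedCategory C).IsRightAdjoint :=
    isRightAdjoint_of_universal _ (fun X ↦ by
      obtain ⟨Z, η, hη⟩ := huniv X
      exact ⟨Z, η.hom, hη⟩)
  let adj := Adjunction.ofIsRightAdjoint (Qh : _ ⥤ DerivedCategory C)
  have (X : DerivedCategory C) : IsIso (adj.unit.app X) := by
    obtain ⟨Z, η, hη⟩ := huniv X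
    exact isIso_unit_of_universal adj η hη
  have : IsIso adj.unit := NatIso.isIso_of_isIso_app _
  exact ⟨_, adj, ⟨adj.fullyFaithfulLOfIsIsoUnit.full, adj.fullyFaithfulLOfIsIsoUnit.faithful⟩⟩

open ZeroObject in
lemma isZero_Qh_obj {X : HomotopyCategory C (.up ℤ)}
    (hX : HomotopyCategory.subcategoryAcyclic C X) : IsZero (Qh.obj X) := by
  have h := contractible_distinguished₁ X
  have : IsIso (Qh.map (0 : (0 : HomotopyCategory C (.up ℤ)) ⟶ X)) :=
    Localization.inverts Qh (HomotopyCategory.subcategoryAcyclic C).trW _ ⟨_, _, _, h, hX⟩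
  exact (Functor.map_isZero Qh (isZero_zero _)).of_iso
    (asIso (Qh.map (0 : (0 : HomotopyCategory C (.up ℤ)) ⟶ X))).symm

end

variable {A B : Type*} [Category* A] [Category* B] [Abelian A] [Abelian B]
  [HasDerivedCategory.{w} A] [HasDerivedCategory.{w} B]
  {F : A ⥤ B} [F.Additive] [PreservesFiniteLimits F] [PreservesFiniteColimits F]

lemma isZero_mapDerivedCategory_obj_Qh {X : HomotopyCategory A (.up ℤ)}
    (hX : HomotopyCategory.subcategoryAcyclic A X) :
    IsZero (F.mapDerivedCategory.obj (Qh.obj X)) :=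
  Functor.map_isZero _ (isZero_Qh_obj hX)

theorem isLeftAdjoint_mapDerivedCategory {G : B ⥤ A} (adj : F ⊣ G)
    (h : ∀ X : CochainComplex B ℤ,
      ∃ (I : CochainComplex B ℤ) (f : X ⟶ I), QuasiIso f ∧ I.IsKInjective) :
    F.mapDerivedCategory.IsLeftAdjoint := by
  have := adj.right_adjoint_additive
  have := isLeftAdjoint_Qh h
  let adj' := (adj.mapHomotopyCategory.comp (Adjunction.ofIsLeftAdjoint Qh)).ofNatIsoLeft
    F.mapDerivedCategoryFactorsh.symm
  refine isLeftAdjoint_of_precomp adj' (fun X y ↦ ?_)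
  refine ObjectProperty.rightOrthogonal.map_bijective_of_isTriangulated
    (P := HomotopyCategory.subcategoryAcyclic A) (fun Z f hZ ↦ ?_) Qh y
  exact (adj'.homEquiv _ _).symm.injective
    ((isZero_mapDerivedCategory_obj_Qh (F := F) hZ).eq_of_src _ _)

theorem exists_leftAdjoint_mapDerivedCategory {G : B ⥤ A} (adj : G ⊣ F)
    (h : ∀ X : CochainComplex B ℤ,
      ∃ (P : CochainComplex B ℤ) (f : P ⟶ X), QuasiIso f ∧ P.IsKProjective) :
    ∃ (Ψ : DerivedCategory B ⥤ DerivedCategory A) (_ : Ψ ⊣ F.mapDerivedCategory),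
      ((G.Full ∧ G.Faithful) → (Ψ.Full ∧ Ψ.Faithful)) := by
  have := adj.left_adjoint_additive
  obtain ⟨Λ, adjΛ, hΛ, hΛ'⟩ := exists_adjunction_Qh h
  let adj' := (adjΛ.comp adj.mapHomotopyCategory).ofNatIsoRight
    F.mapDerivedCategoryFactorsh.symm
  have bij (X : DerivedCategory B) (y : HomotopyCategory A (.up ℤ)) : Function.Bijective
      (Qh.map : ((Λ ⋙ G.mapHomotopyCategory (.up ℤ)).obj X ⟶ y) → _) := by
    refine ObjectProperty.leftOrthogonal.map_bijective_of_isTriangulated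
      (P := HomotopyCategory.subcategoryAcyclic A) (fun Z f hZ ↦ ?_) Qh y
    exact (adj'.homEquiv _ _).injective
      ((isZero_mapDerivedCategory_obj_Qh (F := F) hZ).eq_of_tgt _ _)
  refine ⟨_, adjunctionOfPrecompRight adj' bij, fun ⟨h1, h2⟩ ↦ ⟨⟨fun f ↦ ?_⟩, ⟨fun {X Y f g} hfg ↦ ?_⟩⟩⟩
  · obtain ⟨a, ha⟩ := (bij _ _).2 f
    obtain ⟨b, hb⟩ := (Λ ⋙ G.mapHomotopyCategory (.up ℤ)).map_surjective a
    exact ⟨b, (congrArg Qh.map hb).trans ha⟩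
  · exact (Λ ⋙ G.mapHomotopyCategory (.up ℤ)).map_injective ((bij _ _).1 hfg)

end DerivedCategory

/-! ## Recollements from a fully faithful functor and a quotient functor -/

namespace MirrorReflective

lemma isIso_right_of_comp_eq_id {C : Type*} [Category* C] {X Y : C} {a : X ⟶ Y} {b : Y ⟶ X}
    (h : a ≫ b = 𝟙 X) (ha : IsIso a) : IsIso b := by
  have : IsIso (a ≫ b) := by rw [h]; infer_instance
  exact IsIso.of_isIso_comp_left a b

lemma isIso_left_of_comp_eq_id {C : Type*} [Category* C] {X Y : C} {a : X ⟶ Y} {b : Y ⟶ X}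
    (h : a ≫ b = 𝟙 X) (hb : IsIso b) : IsIso a := by
  have : IsIso (a ≫ b) := by rw [h]; infer_instance
  exact IsIso.of_isIso_comp_right a b

section Shift

variable {T : Type*} [Category* T] [HasShift T ℤ] [Preadditive T]
  [∀ n : ℤ, (shiftFunctor T n).Additive]

lemma eq_zero_of_shift {X Y : T} (n : ℤ) (h : ∀ g : X⟦n⟧ ⟶ Y, g = 0) (g : X ⟶ Y⟦-n⟧) : g = 0 := by
  refine (shiftFunctor T n).map_injective ?_
  rw [Functor.map_zero, ← cancel_mono ((shiftFunctorCompIsoId T (-n) n (by simp)).hom.app Y)]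
  rw [zero_comp]
  exact h _

lemma eq_zero_of_shift' {X Y : T} (n : ℤ) (h : ∀ g : X ⟶ Y⟦-n⟧, g = 0) (g : X⟦n⟧ ⟶ Y) : g = 0 := by
  refine (shiftFunctor T (-n)).map_injective ?_
  rw [Functor.map_zero,
    ← cancel_epi ((shiftFunctorCompIsoId T n (-n) (by simp)).inv.app X), comp_zero]
  exact h _

end Shift

section Triangle

variable {T : Type*} [Category* T] [HasZeroObject T] [HasShift T ℤ] [Preadditive T]
  [∀ n : ℤ, (shiftFunctor T n).Additive] [Pretriangulated T]
  {X Y Z : T} {f : X ⟶ Y} {g : Y ⟶ Z} {h : Z ⟶ X⟦(1 : ℤ)⟧}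
  (dist : Triangle.mk f g h ∈ distTriang T)

include dist

lemma comp_eq_zero₁₂ : f ≫ g = 0 := comp_distTriang_mor_zero₁₂ _ dist

lemma comp_eq_zero₃₁ : h ≫ f⟦(1 : ℤ)⟧' = 0 := comp_distTriang_mor_zero₃₁ _ dist

lemma exists_desc₂ {W : T} (a : Y ⟶ W) (ha : f ≫ a = 0) : ∃ b : Z ⟶ W, a = g ≫ b :=
  Triangle.yoneda_exact₂ _ dist a ha

lemma exists_desc₃ {W : T} (a : Z ⟶ W) (ha : g ≫ a = 0) : ∃ b : X⟦(1 : ℤ)⟧ ⟶ W, a = h ≫ b :=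
  Triangle.yoneda_exact₃ _ dist a ha

lemma exists_lift₂ {W : T} (a : W ⟶ Y) (ha : a ≫ g = 0) : ∃ b : W ⟶ X, a = b ≫ f :=
  Triangle.coyoneda_exact₂ _ dist a ha

lemma exists_lift₃ {W : T} (a : W ⟶ Z) (ha : a ≫ h = 0) : ∃ b : W ⟶ Y, a = b ≫ g :=
  Triangle.coyoneda_exact₃ _ dist a ha

lemma eq_zero_of_comp {W : T} (hW : ∀ b : W ⟶ Z⟦(-1 : ℤ)⟧, b = 0) (a : W ⟶ X)
    (ha : a ≫ f = 0) : a = 0 := by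
  obtain ⟨b, hb⟩ : ∃ b : W ⟶ Z⟦(-1 : ℤ)⟧, a = b ≫ (Triangle.mk f g h).invRotate.mor₁ :=
    Triangle.coyoneda_exact₂ _ (inv_rot_of_distTriang _ dist) a ha
  rw [hW b] at hb
  exact hb.trans zero_comp

lemma distTriang_of_iso {X' Y' Z' : T} {f' : X' ⟶ Y'} {g' : Y' ⟶ Z'} {h' : Z' ⟶ X'⟦(1 : ℤ)⟧}
    (a : X' ≅ X) (b : Y' ≅ Y) (c : Z' ≅ Z) (h₁ : f' ≫ b.hom = a.hom ≫ f)
    (h₂ : g' ≫ c.hom = b.hom ≫ g) (h₃ : h' ≫ a.hom⟦(1 : ℤ)⟧' = c.hom ≫ h) :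
    Triangle.mk f' g' h' ∈ distTriang T :=
  isomorphic_distinguished _ dist _ (Triangle.isoMk _ _ a b c h₁ h₂ h₃)

end Triangle

variable {T'' T T' : Type*} [Category* T''] [Category* T] [Category* T']
  [HasZeroObject T''] [HasZeroObject T] [HasZeroObject T']
  [HasShift T'' ℤ] [HasShift T ℤ] [HasShift T' ℤ]
  [Preadditive T''] [Preadditive T] [Preadditive T']
  [∀ n : ℤ, (shiftFunctor T'' n).Additive] [∀ n : ℤ, (shiftFunctor T n).Additive]
  [∀ n : ℤ, (shiftFunctor T' n).Additive]
  [Pretriangulated T''] [Pretriangulated T] [Pretriangulated T']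
  {i : T'' ⥤ T} {j : T ⥤ T'} [i.CommShift ℤ] [j.CommShift ℤ] [i.IsTriangulated] [j.IsTriangulated]

omit [HasZeroObject T''] [HasZeroObject T] [Preadditive T''] [Preadditive T]
  [∀ n : ℤ, (shiftFunctor T'' n).Additive] [∀ n : ℤ, (shiftFunctor T n).Additive]
  [Pretriangulated T''] [Pretriangulated T] [i.IsTriangulated] in
lemma map_bijective_shift {X : T''}
    (h : ∀ Y : T'', Function.Bijective (i.map : (X ⟶ Y) → (i.obj X ⟶ i.obj Y))) (n : ℤ) (Y : T'') :
    Function.Bijective (i.map : (X⟦n⟧ ⟶ Y) → (i.obj (X⟦n⟧) ⟶ i.obj Y)) := by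
  let e := (shiftFunctorCompIsoId T'' n (-n) (by simp)).app X
  have key (a : X⟦n⟧ ⟶ Y) : i.map (e.inv ≫ a⟦-n⟧') =
      i.map e.inv ≫ (i.commShiftIso (-n)).hom.app (X⟦n⟧) ≫ (i.map a)⟦-n⟧' ≫
        (i.commShiftIso (-n)).inv.app Y := by
    rw [i.map_comp, ← i.commShiftIso_hom_naturality_assoc, Iso.hom_inv_id_app]
    exact congrArg (i.map e.inv ≫ ·) (Category.comp_id _).symm
  constructor
  · intro a b hab
    refine (shiftFunctor T'' (-n)).map_injective ?_
    rw [← cancel_epi e.inv]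
    refine (h _).1 ?_
    rw [key, key, hab]
  · intro g
    obtain ⟨c, hc⟩ := (h (Y⟦-n⟧)).2 (i.map e.inv ≫ (i.commShiftIso (-n)).hom.app (X⟦n⟧) ≫ g⟦-n⟧' ≫
        (i.commShiftIso (-n)).inv.app Y)
    obtain ⟨a, ha⟩ := (shiftFunctor T'' (-n)).map_surjective (e.hom ≫ c)
    refine ⟨a, (shiftFunctor T (-n)).map_injective ?_⟩
    have h1 := key a
    rw [ha, Iso.inv_hom_id_assoc, hc] at h1
    rw [cancel_epi, cancel_epi, cancel_mono] at h1
    exact h1.symm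

theorem fullyFaithful_and_essImage {iR : T ⥤ T''} (adj : i ⊣ iR)
    (zero : ∀ X, IsZero (j.obj (i.obj X))) {B : T} {C : T''} (u : B ⟶ i.obj C)
    (genB : ∀ V : T, (∀ (n : ℤ) (g : B ⟶ V⟦n⟧), g = 0) → IsZero V)
    (genC : ∀ V : T'', (∀ (n : ℤ) (g : C ⟶ V⟦n⟧), g = 0) → IsZero V)
    (univ : ∀ Y : T'', Function.Bijective (fun g : C ⟶ Y ↦ u ≫ i.map g))
    {L : T} {f : L ⟶ B} {h : i.obj C ⟶ L⟦(1 : ℤ)⟧} (dist : Triangle.mk f u h ∈ distTriang T)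
    (orth : ∀ (V : T), IsZero (j.obj V) → ∀ g : L ⟶ V, g = 0) :
    i.Full ∧ i.Faithful ∧ ∀ X, IsZero (j.obj X) → ∃ Y, Nonempty (i.obj Y ≅ X) := by
  have zshift {V : T} (hV : IsZero (j.obj V)) (n : ℤ) : IsZero (j.obj (V⟦n⟧)) :=
    ((shiftFunctor T' n).map_isZero hV).of_iso ((j.commShiftIso n).app V)
  have bij (V : T) (hV : IsZero (j.obj V)) :
      Function.Bijective (fun g : i.obj C ⟶ V ↦ u ≫ g) := by
    constructor
    · intro a b hab
      rw [← sub_eq_zero]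
      obtain ⟨c, hc⟩ := exists_desc₃ dist (a - b) (by
        rw [Preadditive.comp_sub, sub_eq_zero]
        exact hab)
      have : c = 0 := eq_zero_of_shift' 1 (orth _ (zshift hV _)) c
      rw [hc, this, comp_zero]
    · intro g
      obtain ⟨c, hc⟩ := exists_desc₂ dist g (orth _ hV _)
      exact ⟨c, hc.symm⟩
  have bijC (Y : T'') : Function.Bijective (i.map : (C ⟶ Y) → (i.obj C ⟶ i.obj Y)) := by
    rw [← Function.Bijective.of_comp_iff' (bij _ (zero Y))]
    exact univ Y
  let := adj.rightAdjointCommShift ℤ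
  have := adj.commShift_of_leftAdjoint ℤ
  have : iR.IsTriangulated := adj.isTriangulated_rightAdjoint
  have isIso_unit (Y : T'') : IsIso (adj.unit.app Y) := by
    obtain ⟨η, hη⟩ : ∃ η : Y ⟶ iR.obj (i.obj Y), η = adj.unit.app Y := ⟨_, rfl⟩
    suffices IsIso η by rwa [hη] at this
    obtain ⟨V, p, q, hV⟩ := distinguished_cocone_triangle η
    suffices IsZero V from (Triangle.isZero₃_iff_isIso₁ _ hV).1 this
    have unitBij (n : ℤ) : Function.Bijective (fun g : C⟦n⟧ ⟶ Y ↦ g ≫ η) := by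
      have h1 := (adj.homEquiv (C⟦n⟧) (i.obj Y)).bijective.comp (map_bijective_shift bijC n Y)
      have h2 : adj.homEquiv (C⟦n⟧) (i.obj Y) ∘ i.map = (fun g : C⟦n⟧ ⟶ Y ↦ g ≫ η) :=
        funext fun g ↦ ((adj.homEquiv_unit _ _ _).trans (adj.unit.naturality g).symm).trans
          (congrArg (g ≫ ·) hη.symm)
      rwa [h2] at h1
    have unitInj (n : ℤ) (g : C⟦n⟧ ⟶ Y⟦(1 : ℤ)⟧) (hg : g ≫ η⟦(1 : ℤ)⟧' = 0) :
        g = 0 := by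
      let e := (shiftFunctorAdd' T'' (n - 1) 1 n (by simp)).app C
      obtain ⟨g', hg'⟩ := (shiftFunctor T'' (1 : ℤ)).map_surjective (e.inv ≫ g)
      have : g' = 0 := (unitBij (n - 1)).1 (by
        refine (shiftFunctor T'' (1 : ℤ)).map_injective ?_
        dsimp
        rw [Functor.map_comp, hg', Category.assoc, hg, comp_zero, zero_comp, Functor.map_zero])
      rw [← cancel_epi e.inv, ← hg', this, Functor.map_zero, comp_zero]
    refine genC V (fun n g ↦ ?_)
    obtain ⟨n, rfl⟩ : ∃ m : ℤ, n = -m := ⟨-n, by simp⟩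
    refine eq_zero_of_shift n (fun g ↦ ?_) g
    have h1 : g ≫ q = 0 := unitInj n _ (by
      rw [Category.assoc, comp_eq_zero₃₁ hV, comp_zero])
    obtain ⟨a, rfl⟩ := exists_lift₃ hV g h1
    obtain ⟨b, rfl⟩ := (unitBij n).2 a
    dsimp
    rw [Category.assoc, comp_eq_zero₁₂ hV, comp_zero]
  have : IsIso adj.unit := NatIso.isIso_of_isIso_app _
  refine ⟨adj.fullyFaithfulLOfIsIsoUnit.full, adj.fullyFaithfulLOfIsIsoUnit.faithful,
    fun X hX ↦ ⟨iR.obj X, ?_⟩⟩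
  suffices IsIso (adj.counit.app X) from ⟨asIso (adj.counit.app X)⟩
  obtain ⟨V, p, q, hV⟩ := distinguished_cocone_triangle (adj.counit.app X)
  suffices IsZero V from (Triangle.isZero₃_iff_isIso₁ _ hV).1 this
  have hjV : IsZero (j.obj V) := by
    have h1 := j.map_distinguished _ hV
    exact (Triangle.isZero₃_iff_isIso₁ _ h1).2
      (isIso_of_source_target_iso_zero _ (zero _).isoZero hX.isoZero)
  have hRV : IsZero (iR.obj V) := by
    have h1 := iR.map_distinguished _ hV
    refine (Triangle.isZero₃_iff_isIso₁ _ h1).2 ?_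
    have hu : IsIso (adj.unit.app (iR.obj X)) := inferInstance
    exact isIso_right_of_comp_eq_id (adj.right_triangle_components X) hu
  refine genB V (fun n g ↦ ?_)
  obtain ⟨c, rfl⟩ := (bij _ (zshift hjV n)).2 g
  have : c = 0 := (adj.homEquiv _ _).injective
    ((((shiftFunctor T'' n).map_isZero hRV).of_iso ((iR.commShiftIso n).app V)).eq_of_tgt _ _)
  dsimp
  rw [this, comp_zero]

section

variable {jS jR : T' ⥤ T} [i.Full] [i.Faithful]

omit [Pretriangulated T''] [i.CommShift ℤ] [i.IsTriangulated] [HasZeroObject T'']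
  [HasShift T'' ℤ] [Preadditive T''] [∀ n : ℤ, (shiftFunctor T'' n).Additive] in
lemma exists_shriek_universal (adjR : j ⊣ jR) [jR.Full] [jR.Faithful]
    (zero : ∀ X, IsZero (j.obj (i.obj X)))
    (ker : ∀ X, IsZero (j.obj X) → ∃ Y, Nonempty (i.obj Y ≅ X)) (X : T) :
    ∃ (Z : T'') (ε : i.obj Z ⟶ X) (h : jR.obj (j.obj X) ⟶ (i.obj Z)⟦(1 : ℤ)⟧),
      Triangle.mk ε (adjR.unit.app X) h ∈ distTriang T ∧
      ∀ Y : T'', Function.Bijective (fun g : Y ⟶ Z ↦ i.map g ≫ ε) := by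
  obtain ⟨K, f, h, hK⟩ := distinguished_cocone_triangle₁ (adjR.unit.app X)
  have hjK : IsZero (j.obj K) := by
    have h1 := j.map_distinguished _ hK
    refine (Triangle.isZero₁_iff_isIso₂ _ h1).2 ?_
    have hu : IsIso (adjR.counit.app (j.obj X)) := inferInstance
    exact isIso_left_of_comp_eq_id (adjR.left_triangle_components X) hu
  obtain ⟨Z, ⟨a⟩⟩ := ker K hjK
  have dist : Triangle.mk (a.hom ≫ f) (adjR.unit.app X) (h ≫ a.inv⟦(1 : ℤ)⟧') ∈ distTriang T :=
    distTriang_of_iso hK a (Iso.refl _) (Iso.refl _) (Category.comp_id _)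
      ((Category.comp_id _).trans (Category.id_comp _).symm) (by
        rw [Category.assoc, ← Functor.map_comp, Iso.inv_hom_id, CategoryTheory.Functor.map_id]
        exact (Category.comp_id _).trans (Category.id_comp _).symm)
  have hom_zero {Y : T''} (n : ℤ) (g : i.obj Y ⟶ (jR.obj (j.obj X))⟦n⟧) : g = 0 := by
    obtain ⟨n, rfl⟩ : ∃ m : ℤ, n = -m := ⟨-n, by simp⟩
    refine eq_zero_of_shift n (fun g ↦ ?_) g
    exact (adjR.homEquiv _ _).symm.injective (IsZero.eq_of_src
      (((shiftFunctor T' n).map_isZero (zero Y)).of_iso ((j.commShiftIso n).app _)) _ _)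
  refine ⟨Z, a.hom ≫ f, _, dist, fun Y ↦ ⟨fun b c hbc ↦ ?_, fun g ↦ ?_⟩⟩
  · dsimp at hbc
    refine i.map_injective ?_
    rw [← sub_eq_zero]
    exact eq_zero_of_comp dist (hom_zero (-1)) _ (by rw [Preadditive.sub_comp, hbc, sub_self])
  · obtain ⟨d, hd⟩ := exists_lift₂ dist g
      ((adjR.homEquiv _ _).symm.injective ((zero Y).eq_of_src _ _))
    exact ⟨i.preimage d, by dsimp; rw [i.map_preimage]; exact hd.symm⟩

omit [Pretriangulated T''] [i.CommShift ℤ] [i.IsTriangulated] [HasZeroObject T'']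
  [HasShift T'' ℤ] [Preadditive T''] [∀ n : ℤ, (shiftFunctor T'' n).Additive] in
lemma exists_pull_universal (adjS : jS ⊣ j) [jS.Full] [jS.Faithful]
    (zero : ∀ X, IsZero (j.obj (i.obj X)))
    (ker : ∀ X, IsZero (j.obj X) → ∃ Y, Nonempty (i.obj Y ≅ X)) (X : T) :
    ∃ (Z : T'') (η : X ⟶ i.obj Z) (h : i.obj Z ⟶ (jS.obj (j.obj X))⟦(1 : ℤ)⟧),
      Triangle.mk (adjS.counit.app X) η h ∈ distTriang T ∧
      ∀ Y : T'', Function.Bijective (fun g : Z ⟶ Y ↦ η ≫ i.map g) := by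
  obtain ⟨K, f, h, hK⟩ := distinguished_cocone_triangle (adjS.counit.app X)
  have hjK : IsZero (j.obj K) := by
    have h1 := j.map_distinguished _ hK
    refine (Triangle.isZero₃_iff_isIso₁ _ h1).2 ?_
    have hu : IsIso (adjS.unit.app (j.obj X)) := inferInstance
    exact isIso_right_of_comp_eq_id (adjS.right_triangle_components X) hu
  obtain ⟨Z, ⟨a⟩⟩ := ker K hjK
  have dist : Triangle.mk (adjS.counit.app X) (f ≫ a.inv) (a.hom ≫ h) ∈ distTriang T :=
    distTriang_of_iso hK (Iso.refl _) (Iso.refl _) a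
      ((Category.comp_id _).trans (Category.id_comp _).symm)
      (((Category.assoc _ _ _).trans ((congrArg (f ≫ ·) a.inv_hom_id).trans
        (Category.comp_id _))).trans (Category.id_comp _).symm)
      ((congrArg ((a.hom ≫ h) ≫ ·) (CategoryTheory.Functor.map_id _ _)).trans (Category.comp_id _))
  have hom_zero {Y : T} (hY : IsZero (j.obj Y)) (g : jS.obj (j.obj X) ⟶ Y) : g = 0 :=
    (adjS.homEquiv _ _).injective (hY.eq_of_tgt _ _)
  refine ⟨Z, f ≫ a.inv, _, dist, fun Y ↦ ⟨fun b c hbc ↦ ?_, fun g ↦ ?_⟩⟩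
  · dsimp at hbc
    refine i.map_injective ?_
    rw [← sub_eq_zero]
    obtain ⟨d, hd⟩ := exists_desc₃ dist (i.map b - i.map c)
      (by rw [Preadditive.comp_sub, hbc, sub_self])
    rw [hd, eq_zero_of_shift' 1 (hom_zero
      (((shiftFunctor T' (-1 : ℤ)).map_isZero (zero Y)).of_iso ((j.commShiftIso _).app _))) d,
      comp_zero]
  · obtain ⟨d, hd⟩ := exists_desc₂ dist g (hom_zero (zero Y) _)
    exact ⟨i.preimage d, by dsimp; rw [i.map_preimage]; exact hd.symm⟩

/-- The recollement with given `i_*` and `j^*`, if `i_*` is an equivalence onto the kernel of `j^*`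
and `j^*` has a fully faithful left adjoint and a right adjoint. -/
theorem exists_recollement (adjS : jS ⊣ j) [jS.Full] [jS.Faithful] (adjR : j ⊣ jR)
    (zero : ∀ X, IsZero (j.obj (i.obj X)))
    (ker : ∀ X, IsZero (j.obj X) → ∃ Y, Nonempty (i.obj Y ≅ X)) :
    ∃ Rc : Recollement T'' T T', (∃ α : Rc.iPush ≅ i, NatTrans.CommShift α.hom ℤ) ∧
      ∃ β : Rc.jPull ≅ j, NatTrans.CommShift β.hom ℤ := by
  have ff : jR.FullyFaithful := (Adjunction.Triple.mk adjS adjR).fullyFaithfulEquiv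
    (Functor.FullyFaithful.ofFullyFaithful jS)
  have := ff.full
  have := ff.faithful
  choose Z ε h dist bij using exists_shriek_universal adjR zero ker
  choose Z' η h' dist' bij' using exists_pull_universal adjS zero ker
  have : i.IsLeftAdjoint := isLeftAdjoint_of_universal i (fun X ↦ ⟨Z X, ε X, bij X⟩)
  have : i.IsRightAdjoint := isRightAdjoint_of_universal i (fun X ↦ ⟨Z' X, η X, bij' X⟩)
  let adji := Adjunction.ofIsLeftAdjoint i
  let adji' := Adjunction.ofIsRightAdjoint i
  let := adji.rightAdjointCommShift ℤ
  let := adji'.leftAdjointCommShift ℤ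
  let := adjR.rightAdjointCommShift ℤ
  let := adjS.leftAdjointCommShift ℤ
  have := adji.commShift_of_leftAdjoint ℤ
  have := adji'.commShift_of_rightAdjoint ℤ
  have := adjR.commShift_of_leftAdjoint ℤ
  have := adjS.commShift_of_rightAdjoint ℤ
  have := adji.isTriangulated_rightAdjoint
  have := adji'.isTriangulated_leftAdjoint
  have := adjR.isTriangulated_rightAdjoint
  have := adjS.isTriangulated_leftAdjoint
  refine ⟨{
    iPush := i
    iPull := i.leftAdjoint
    iShriek := i.rightAdjoint
    jPull := j
    jPush := jR
    jShriek := jS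
    iPullAdj := adji'
    iShriekAdj := adji
    jShriekAdj := adjS
    jPushAdj := adjR
    iPush_full := inferInstance
    iPush_faithful := inferInstance
    jPush_full := inferInstance
    jPush_faithful := inferInstance
    jShriek_full := inferInstance
    jShriek_faithful := inferInstance
    isZero_jPull_iPush := zero
    triangle_left := fun X ↦ ?_
    triangle_right := fun X ↦ ?_ }, ⟨Iso.refl _, ?_⟩, ⟨Iso.refl _, ?_⟩⟩
  · obtain ⟨a, ha⟩ : ∃ a : i.rightAdjoint.obj X ≅ Z X, i.map a.hom ≫ ε X = adji.counit.app X := by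
      obtain ⟨b, hb⟩ : ∃ b : i.rightAdjoint.obj X ⟶ Z X, i.map b ≫ ε X = adji.counit.app X :=
        (bij X _).2 (adji.counit.app X)
      obtain ⟨c, hc⟩ : ∃ c : Z X ⟶ i.rightAdjoint.obj X, i.map c ≫ adji.counit.app X = ε X :=
        ⟨adji.homEquiv _ _ (ε X), (adji.homEquiv_counit _ _ _).symm.trans
          (Equiv.symm_apply_apply _ _)⟩
      refine ⟨⟨b, c, ?_, ?_⟩, hb⟩
      · refine (adji.homEquiv (i.rightAdjoint.obj X) X).symm.injective ?_
        rw [adji.homEquiv_counit, adji.homEquiv_counit, Functor.map_comp, Category.assoc, hc, hb,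
          CategoryTheory.Functor.map_id]
        exact (Category.id_comp _).symm
      · refine (bij X _).1 ?_
        dsimp
        rw [Functor.map_comp, Category.assoc, hb, hc, CategoryTheory.Functor.map_id]
        exact (Category.id_comp _).symm
    refine ⟨h X ≫ (i.map a.inv)⟦(1 : ℤ)⟧', distTriang_of_iso (dist X)
      (i.mapIso a) (Iso.refl _) (Iso.refl _) ?_ ?_ ?_⟩
    · exact (Category.comp_id _).trans ha.symm
    · exact (Category.comp_id _).trans (Category.id_comp _).symm
    · dsimp
      rw [Category.id_comp, Category.assoc, ← Functor.map_comp, ← Functor.map_comp, Iso.inv_hom_id]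
      simp
  · obtain ⟨a, ha⟩ : ∃ a : Z' X ≅ i.leftAdjoint.obj X, η X ≫ i.map a.hom = adji'.unit.app X := by
      obtain ⟨b, hb⟩ : ∃ b : Z' X ⟶ i.leftAdjoint.obj X, η X ≫ i.map b = adji'.unit.app X :=
        (bij' X _).2 (adji'.unit.app X)
      obtain ⟨c, hc⟩ : ∃ c : i.leftAdjoint.obj X ⟶ Z' X, adji'.unit.app X ≫ i.map c = η X :=
        ⟨(adji'.homEquiv _ _).symm (η X), (adji'.homEquiv_unit _ _ _).symm.trans
          (Equiv.apply_symm_apply _ _)⟩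
      refine ⟨⟨b, c, ?_, ?_⟩, hb⟩
      · refine (bij' X _).1 ?_
        dsimp
        rw [Functor.map_comp, reassoc_of% hb, hc, CategoryTheory.Functor.map_id]
        exact (Category.comp_id _).symm
      · refine (adji'.homEquiv X (i.leftAdjoint.obj X)).injective ?_
        rw [adji'.homEquiv_unit, adji'.homEquiv_unit, Functor.map_comp, reassoc_of% hc, hb,
          CategoryTheory.Functor.map_id]
        exact (Category.comp_id _).symm
    refine ⟨i.map a.inv ≫ h' X, distTriang_of_iso (dist' X)
      (Iso.refl _) (Iso.refl _) (i.mapIso a.symm) ?_ ?_ ?_⟩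
    · exact (Category.comp_id _).trans (Category.id_comp _).symm
    · dsimp
      rw [← ha, Category.assoc, ← Functor.map_comp, Iso.hom_inv_id, CategoryTheory.Functor.map_id]
      exact (Category.comp_id _).trans (Category.id_comp _).symm
    · dsimp
      rw [CategoryTheory.Functor.map_id]
      exact Category.comp_id _
  · exact inferInstanceAs (NatTrans.CommShift (𝟙 i) ℤ)
  · exact inferInstanceAs (NatTrans.CommShift (𝟙 j) ℤ)

end

end MirrorReflective

namespace MirrorReflective

/-! ## The right adjoint of `M ↦ fM` -/

section Coinduced

variable {B : Type u} [Ring B] {f : B} (hf : IsIdempotentElem f)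

/-- The left `B`-module `Hom_{fBf}(fB, N)`. -/
def Coinduced (N : Type u) [AddCommGroup N] [Module hf.Corner N] : Type u :=
  CornerModule hf B →ₗ[hf.Corner] N

instance (N : Type u) [AddCommGroup N] [Module hf.Corner N] : AddCommGroup (Coinduced hf N) :=
  inferInstanceAs (AddCommGroup (CornerModule hf B →ₗ[hf.Corner] N))

section

variable {N N' : Type u} [AddCommGroup N] [Module hf.Corner N] [AddCommGroup N']
  [Module hf.Corner N'] {M : Type u} [AddCommGroup M] [Module B M]

variable {hf}

/-- The value of `h : fB → N` at `y ∈ fB`. -/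
def Coinduced.eval (h : Coinduced hf N) (y : CornerModule hf B) : N :=
  DFunLike.coe (F := CornerModule hf B →ₗ[hf.Corner] N) h y

lemma Coinduced.ext {g h : Coinduced hf N} (H : ∀ y, g.eval y = h.eval y) : g = h :=
  LinearMap.ext (f := g) (g := h) H

lemma Coinduced.eval_add_right (h : Coinduced hf N) (y y' : CornerModule hf B) :
    h.eval (y + y') = h.eval y + h.eval y' :=
  LinearMap.map_add (M := CornerModule hf B) h y y'

lemma Coinduced.eval_smul_right (h : Coinduced hf N) (l : hf.Corner) (y : CornerModule hf B) :
    h.eval (l • y) = l • h.eval y :=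
  LinearMap.map_smul (M := CornerModule hf B) h l y

instance : Module B (Coinduced hf N) where
  smul b h := LinearMap.comp (M₂ := CornerModule hf B) h (rightMul hf b)
  one_smul h := Coinduced.ext fun y => congrArg h.eval (Subtype.ext (mul_one y.1))
  mul_smul b c h := Coinduced.ext fun y => congrArg h.eval (Subtype.ext (mul_assoc y.1 b c).symm)
  smul_zero _ := rfl
  smul_add _ _ _ := rfl
  add_smul b c h := Coinduced.ext fun y =>
    (congrArg h.eval (Subtype.ext (mul_add y.1 b c) :
      rightMul hf (b + c) y = rightMul hf b y + rightMul hf c y)).trans (h.eval_add_right _ _)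
  zero_smul h := Coinduced.ext fun y =>
    (congrArg h.eval (Subtype.ext (mul_zero y.1) : rightMul hf 0 y = 0)).trans
      (LinearMap.map_zero (M := CornerModule hf B) h)

/-- Postcomposition with `g : N → N'`. -/
def Coinduced.map (g : N →ₗ[hf.Corner] N') : Coinduced hf N →ₗ[B] Coinduced hf N' where
  toFun h := LinearMap.comp (M₁ := CornerModule hf B) (M₂ := N) (M₃ := N') g h
  map_add' _ _ := Coinduced.ext fun _ => map_add g _ _
  map_smul' _ _ := Coinduced.ext fun _ => rfl

/-- The element `y m` of `fM`, for `y ∈ fB` and `m ∈ M`. -/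
def CornerModule.act (y : CornerModule hf B) (m : M) : CornerModule hf M :=
  CornerModule.mk hf (y.1 • m) (by rw [smul_smul]; exact congrArg (· • m) y.smul_val)

/-- The map `M → Hom_{fBf}(fB, N)` given by a map `fM → N`. -/
def Coinduced.lift (g : CornerModule hf M →ₗ[hf.Corner] N) : M →ₗ[B] Coinduced hf N where
  toFun m :=
    { toFun := fun y => g (CornerModule.act y m)
      map_add' := fun y y' => (congrArg g (Subtype.ext (add_smul y.1 y'.1 m) :
        CornerModule.act (y + y') m = CornerModule.act y m + CornerModule.act y' m)).trans
          (map_add g _ _)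
      map_smul' := fun l y => (congrArg g (Subtype.ext (mul_smul l.1 y.1 m) :
        CornerModule.act (l • y) m = l • CornerModule.act y m)).trans (map_smul g l _) }
  map_add' m m' := Coinduced.ext fun y => (congrArg g (Subtype.ext (smul_add y.1 m m') :
    CornerModule.act y (m + m') = CornerModule.act y m + CornerModule.act y m')).trans
      (map_add g _ _)
  map_smul' b m := Coinduced.ext fun y => congrArg g (Subtype.ext (mul_smul y.1 b m).symm :
    CornerModule.act y (b • m) = CornerModule.act (rightMul hf b y) m)

/-- The map `fM → N` given by a map `M → Hom_{fBf}(fB, N)`. -/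
def Coinduced.desc (h : M →ₗ[B] Coinduced hf N) : CornerModule hf M →ₗ[hf.Corner] N where
  toFun x := (h x.1).eval (CornerModule.mk hf f hf.eq)
  map_add' x x' := congrArg (Coinduced.eval · _) (map_add h x.1 x'.1)
  map_smul' l x := by
    refine (congrArg (Coinduced.eval · _) (map_smul h l.1 x.1)).trans ?_
    refine Eq.trans ?_ ((h x.1).eval_smul_right l _)
    refine congrArg (h x.1).eval (Subtype.ext ?_)
    obtain ⟨h2, h3⟩ := (Subsemigroup.mem_corner_iff hf).mp l.2
    exact h2.trans h3.symm

lemma Coinduced.desc_lift (g : CornerModule hf M →ₗ[hf.Corner] N) :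
    Coinduced.desc (Coinduced.lift g) = g :=
  LinearMap.ext fun x => congrArg g (Subtype.ext x.smul_val)

lemma Coinduced.lift_desc (h : M →ₗ[B] Coinduced hf N) :
    Coinduced.lift (Coinduced.desc h) = h :=
  LinearMap.ext fun m => Coinduced.ext fun y =>
    (congrArg (Coinduced.eval · _) (map_smul h y.1 m)).trans
      (congrArg (h m).eval (Subtype.ext y.smul_val))

end

/-- The functor `N ↦ Hom_{fBf}(fB, N)`. -/
def coinducedFunctor : ModuleCat.{u} hf.Corner ⥤ ModuleCat.{u} B where
  obj N := ModuleCat.of B (Coinduced hf N)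
  map g := ModuleCat.ofHom (Coinduced.map g.hom)
  map_id _ := rfl
  map_comp _ _ := rfl

/-- The functor `M ↦ fM` is left adjoint to `N ↦ Hom_{fBf}(fB, N)`. -/
def cornerCoinducedAdj : cornerFunctor hf ⊣ coinducedFunctor hf :=
  Adjunction.mkOfHomEquiv
    { homEquiv := fun _ _ =>
        { toFun := fun g => ModuleCat.ofHom (Coinduced.lift g.hom)
          invFun := fun h => ModuleCat.ofHom (Coinduced.desc h.hom)
          left_inv := fun g => ModuleCat.hom_ext (Coinduced.desc_lift g.hom)
          right_inv := fun h => ModuleCat.hom_ext (Coinduced.lift_desc h.hom) }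
      homEquiv_naturality_left_symm := fun _ _ => rfl
      homEquiv_naturality_right := fun _ _ => rfl }

end Coinduced

/-! ## Rings with an idempotent modelled on `(A, e)` -/

section Model

variable {A B : Type u} [Ring A] [Ring B] {e : A} {f : B}

/-- A homomorphism `π : B → A` which restricts to bijections `fBf → eAe`, `Bf → Ae` and
`fB → eA`, with inverses `ψ`, `σ` and `τ`. -/
structure CornerModel (he : IsIdempotentElem e) (hf : IsIdempotentElem f) where
  π : B →+* A
  ψ : he.Corner ≃+* hf.Corner
  σ : LeftIdeal he →+ LeftIdeal hf
  τ : CornerModule he A →+ CornerModule hf B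
  π_ψ (l : he.Corner) : π (ψ l).1 = l.1
  π_σ (x : LeftIdeal he) : π (σ x).1 = x.1
  π_τ (y : CornerModule he A) : π (τ y).1 = y.1
  injOn_left (b : B) : b * f = b → π b = 0 → b = 0
  injOn_right (b : B) : f * b = b → π b = 0 → b = 0

namespace CornerModel

variable {he : IsIdempotentElem e} {hf : IsIdempotentElem f} (m : CornerModel he hf)

lemma _root_.MirrorReflective.CornerModule.mul_val (y : CornerModule hf B) : f * y.1 = y.1 :=
  y.smul_val

lemma π_f : m.π f = e := by
  have := m.π_ψ 1
  rwa [map_one] at this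

variable {m} in
lemma ext_left {b c : B} (hb : b * f = b) (hc : c * f = c) (h : m.π b = m.π c) : b = c :=
  sub_eq_zero.mp (m.injOn_left _ (by rw [sub_mul, hb, hc]) (by rw [map_sub, h, sub_self]))

variable {m} in
lemma ext_right {b c : B} (hb : f * b = b) (hc : f * c = c) (h : m.π b = m.π c) : b = c :=
  sub_eq_zero.mp (m.injOn_right _ (by rw [mul_sub, hb, hc]) (by rw [map_sub, h, sub_self]))

lemma σ_leftMul (b : B) (x : LeftIdeal he) : (m.σ (leftMul he (m.π b) x)).1 = b * (m.σ x).1 :=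
  ext_left (LeftIdeal.val_mul _) (by rw [mul_assoc, LeftIdeal.val_mul])
    (by rw [m.π_σ, map_mul, m.π_σ]; rfl)

lemma mul_σ_ψ (x : LeftIdeal he) (l : he.Corner) :
    (m.σ (MulOpposite.op l • x)).1 = (m.σ x).1 * (m.ψ l).1 :=
  ext_left (LeftIdeal.val_mul _)
    (by rw [mul_assoc, ((Subsemigroup.mem_corner_iff hf).mp (m.ψ l).2).2])
    (by rw [m.π_σ, map_mul, m.π_σ, m.π_ψ]; rfl)

lemma τ_smul (l : he.Corner) (y : CornerModule he A) :
    (m.τ (l • y)).1 = (m.ψ l).1 * (m.τ y).1 :=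
  ext_right (CornerModule.mul_val _)
    (by rw [← mul_assoc, ((Subsemigroup.mem_corner_iff hf).mp (m.ψ l).2).1])
    (by rw [m.π_τ, map_mul, m.π_τ, m.π_ψ]; rfl)

lemma τ_rightMul (b : B) (y : CornerModule he A) :
    (m.τ (rightMul he (m.π b) y)).1 = (m.τ y).1 * b :=
  ext_right (CornerModule.mul_val _)
    (by rw [← mul_assoc]; exact congrArg (· * b) (CornerModule.smul_val (m.τ y)))
    (by rw [m.π_τ, map_mul, m.π_τ]; rfl)

/-- The multiplication map `Ae ⊗_{eAe} eA ≅ Bf ⊗_{fBf} fB → B`. -/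
def mulMap : MirrorBimodule he →+ B :=
  BalancedTensor.lift
    (AddMonoidHom.mk' (fun x => AddMonoidHom.mk' (fun y => (m.σ x).1 * (m.τ y).1)
      (fun y y' => by rw [map_add]; exact mul_add (m.σ x).1 (m.τ y).1 (m.τ y').1))
      (fun x x' => by
        ext y
        change (m.σ (x + x')).1 * (m.τ y).1 = (m.σ x).1 * (m.τ y).1 + (m.σ x').1 * (m.τ y).1
        rw [map_add]
        exact add_mul (m.σ x).1 (m.σ x').1 (m.τ y).1))
    (fun x l y => by
      change (m.σ _).1 * (m.τ y).1 = (m.σ x).1 * (m.τ _).1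
      rw [m.mul_σ_ψ, m.τ_smul, mul_assoc])

lemma mulMap_btmul (x : LeftIdeal he) (y : CornerModule he A) :
    m.mulMap (btmul he.Corner x y) = (m.σ x).1 * (m.τ y).1 := rfl

lemma mulMap_lact (b : B) (t : MirrorBimodule he) :
    m.mulMap (lact he (m.π b) t) = b * m.mulMap t :=
  DFunLike.congr_fun (BalancedTensor.hom_ext (φ := m.mulMap.comp (lact he (m.π b)))
    (ψ := (AddMonoidHom.mulLeft b).comp m.mulMap) (fun x y => by
      change (m.σ _).1 * (m.τ y).1 = b * ((m.σ x).1 * (m.τ y).1)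
      rw [m.σ_leftMul, mul_assoc])) t

lemma mulMap_ract (b : B) (t : MirrorBimodule he) :
    m.mulMap (ract he (m.π b) t) = m.mulMap t * b :=
  DFunLike.congr_fun (BalancedTensor.hom_ext (φ := m.mulMap.comp (ract he (m.π b)))
    (ψ := (AddMonoidHom.mulRight b).comp m.mulMap) (fun x y => by
      change (m.σ x).1 * (m.τ _).1 = ((m.σ x).1 * (m.τ y).1) * b
      rw [m.τ_rightMul, mul_assoc])) t

lemma mulMap_mem (t : MirrorBimodule he) : m.mulMap t ∈ idealOf f := by
  have hf' : f ∈ TwoSidedIdeal.span {f} := TwoSidedIdeal.subset_span rfl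
  induction t using btmul_induction with
  | zero => rw [map_zero]; exact zero_mem _
  | add s t hs ht => rw [map_add]; exact add_mem hs ht
  | tmul x y =>
    rw [mulMap_btmul, ← (m.σ x).val_mul]
    exact TwoSidedIdeal.mem_asIdeal.mpr
      (TwoSidedIdeal.mul_mem_right _ _ _ (TwoSidedIdeal.mul_mem_left _ _ _ hf'))

lemma mulMap_e : m.mulMap (btmul he.Corner (LeftIdeal.mk he e he.eq)
    (CornerModule.mk he e he.eq)) = f := by
  have h1 : (m.σ (LeftIdeal.mk he e he.eq)).1 = f :=
    ext_left (LeftIdeal.val_mul _) hf.eq ((m.π_σ _).trans m.π_f.symm)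
  have h2 : (m.τ (CornerModule.mk he e he.eq)).1 = f :=
    ext_right (CornerModule.mul_val _) hf.eq ((m.π_τ _).trans m.π_f.symm)
  rw [mulMap_btmul, h1, h2, hf.eq]

lemma exists_mulMap_eq {b : B} (hb : b ∈ idealOf f) : ∃ t, m.mulMap t = b := by
  let I : TwoSidedIdeal B := TwoSidedIdeal.mk' (Set.range m.mulMap) ⟨0, map_zero _⟩
    (by rintro _ _ ⟨s, rfl⟩ ⟨t, rfl⟩; exact ⟨s + t, map_add _ _ _⟩)
    (by rintro _ ⟨s, rfl⟩; exact ⟨-s, map_neg _ _⟩)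
    (by rintro b _ ⟨s, rfl⟩; exact ⟨_, m.mulMap_lact b s⟩)
    (by rintro _ b ⟨s, rfl⟩; exact ⟨_, m.mulMap_ract b s⟩)
  have : TwoSidedIdeal.span {f} ≤ I := TwoSidedIdeal.span_le.mpr (by
    rintro _ rfl
    exact (TwoSidedIdeal.mem_mk' (Set.range m.mulMap) _ _ _ _ _ _).mpr ⟨_, m.mulMap_e⟩)
  exact (TwoSidedIdeal.mem_mk' (Set.range m.mulMap) _ _ _ _ _ _).mp (this hb)

/-- The functor `M ↦ fM`, with values in modules over `eAe ≅ fBf`. -/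
def cornerFunctor : ModuleCat.{u} B ⥤ ModuleCat.{u} he.Corner :=
  MirrorReflective.cornerFunctor hf ⋙ ModuleCat.restrictScalars.{u} (m.ψ : he.Corner →+* hf.Corner)

instance : m.cornerFunctor.Additive :=
  inferInstanceAs (MirrorReflective.cornerFunctor hf ⋙ _).Additive

instance : PreservesFiniteLimits m.cornerFunctor :=
  inferInstanceAs (PreservesFiniteLimits (MirrorReflective.cornerFunctor hf ⋙ _))

instance : PreservesFiniteColimits m.cornerFunctor :=
  inferInstanceAs (PreservesFiniteColimits (MirrorReflective.cornerFunctor hf ⋙ _))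

/-- The functor `M ↦ fM` has a right adjoint. -/
def cornerAdj : m.cornerFunctor ⊣
    ModuleCat.coextendScalars.{u, u, u} (m.ψ : he.Corner →+* hf.Corner) ⋙ coinducedFunctor hf :=
  (cornerCoinducedAdj hf).comp (ModuleCat.restrictCoextendScalarsAdj _)

/-- The `B`-module `Ae ⊗_{eAe} N ≅ Bf ⊗_{fBf} N`. -/
def Induced (_ : CornerModel he hf) (N : Type u) [AddCommGroup N] [Module he.Corner N] : Type u :=
  BalancedTensor he.Corner (LeftIdeal he) N

section

variable (N : Type u) [AddCommGroup N] [Module he.Corner N]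

instance : AddCommGroup (m.Induced N) :=
  inferInstanceAs (AddCommGroup (BalancedTensor he.Corner (LeftIdeal he) N))

/-- The element `x ⊗ n` of `Ae ⊗_{eAe} N`. -/
def Induced.tmul {N : Type u} [AddCommGroup N] [Module he.Corner N] (x : LeftIdeal he) (n : N) :
    m.Induced N :=
  btmul he.Corner x n

/-- Left multiplication by `a` on `Ae ⊗_{eAe} N`. -/
def leftAct (a : A) : BalancedTensor he.Corner (LeftIdeal he) N →+
    BalancedTensor he.Corner (LeftIdeal he) N :=
  BalancedTensor.map (leftMul he a) LinearMap.id

omit [Ring B] in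
lemma leftAct_add (a b : A) (t : BalancedTensor he.Corner (LeftIdeal he) N) :
    leftAct N (a + b) t = leftAct N a t + leftAct N b t :=
  DFunLike.congr_fun (BalancedTensor.hom_ext (φ := leftAct N (a + b))
    (ψ := leftAct N a + leftAct N b) (fun x n => by
      have h : leftMul he (a + b) x = leftMul he a x + leftMul he b x :=
        Subtype.ext (add_mul a b x.1)
      exact (congrArg (btmul he.Corner · n) h).trans (add_btmul (M := LeftIdeal he) _ _ n))) t

instance : Module B (m.Induced N) where
  smul b := leftAct N (m.π b)
  one_smul := DFunLike.congr_fun (BalancedTensor.hom_ext (φ := leftAct N (m.π 1))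
    (ψ := AddMonoidHom.id _) (fun x n => congrArg (btmul he.Corner · n) (Subtype.ext (by
      change m.π 1 * x.1 = x.1
      rw [map_one, one_mul]))))
  mul_smul b c := DFunLike.congr_fun (BalancedTensor.hom_ext (φ := leftAct N (m.π (b * c)))
    (ψ := (leftAct N (m.π b)).comp (leftAct N (m.π c)))
    (fun x n => congrArg (btmul he.Corner · n) (Subtype.ext (by
      change m.π (b * c) * x.1 = m.π b * (m.π c * x.1)
      rw [map_mul, mul_assoc]))))
  smul_zero b := map_zero (leftAct N (m.π b))
  smul_add b := map_add (leftAct N (m.π b))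
  add_smul b c t := by
    refine (congrArg (leftAct N · t) (map_add m.π b c)).trans ?_
    exact leftAct_add N _ _ t
  zero_smul := DFunLike.congr_fun (BalancedTensor.hom_ext (φ := leftAct N (m.π 0)) (ψ := 0)
    (fun x n => by
      have h : leftMul he (m.π 0) x = 0 := Subtype.ext (by
        change m.π 0 * x.1 = 0
        rw [map_zero, zero_mul])
      change btmul he.Corner (leftMul he (m.π 0) x) n = 0
      rw [h]
      have := add_btmul (Λ := he.Corner) (0 : LeftIdeal he) 0 n
      rwa [add_zero, left_eq_add] at this))

lemma smul_tmul (b : B) (x : LeftIdeal he) (n : N) :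
    b • Induced.tmul m x n = Induced.tmul m (leftMul he (m.π b) x) n := rfl

end

end CornerModel

end Model

end MirrorReflective

namespace MirrorReflective

namespace CornerModel

variable {A B : Type u} [Ring A] [Ring B] {e : A} {f : B}
variable {he : IsIdempotentElem e} {hf : IsIdempotentElem f} (m : CornerModel he hf)

section

variable {N N' : Type u} [AddCommGroup N] [Module he.Corner N] [AddCommGroup N']
  [Module he.Corner N'] {M : Type u} [AddCommGroup M] [Module B M]

variable {m} in
lemma Induced.hom_ext {P : Type*} [AddCommGroup P] {g h : m.Induced N →+ P}
    (H : ∀ x n, g (Induced.tmul m x n) = h (Induced.tmul m x n)) : g = h :=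
  BalancedTensor.hom_ext (Λ := he.Corner) (M := LeftIdeal he) (N := N) H

variable {m} in
lemma Induced.linearMap_ext {g h : m.Induced N →ₗ[B] M}
    (H : ∀ x n, g (Induced.tmul m x n) = h (Induced.tmul m x n)) : g = h :=
  LinearMap.toAddMonoidHom_injective (Induced.hom_ext H)

lemma Induced.tmul_add (x : LeftIdeal he) (n n' : N) :
    Induced.tmul m x (n + n') = Induced.tmul m x n + Induced.tmul m x n' := btmul_add x n n'

lemma Induced.tmul_smul (x : LeftIdeal he) (l : he.Corner) (n : N) :
    Induced.tmul m x (l • n) = Induced.tmul m (MulOpposite.op l • x) n :=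
  (btmul_balanced x l n).symm

/-- The map `Ae ⊗ g`. -/
def Induced.map (g : N →ₗ[he.Corner] N') : m.Induced N →ₗ[B] m.Induced N' where
  toFun := BalancedTensor.map (LinearMap.id (R := he.Cornerᵐᵒᵖ) (M := LeftIdeal he)) g
  map_add' := map_add (BalancedTensor.map (LinearMap.id (R := he.Cornerᵐᵒᵖ) (M := LeftIdeal he)) g)
  map_smul' b := DFunLike.congr_fun (BalancedTensor.hom_ext
    (φ := (BalancedTensor.map LinearMap.id g).comp (leftAct N (m.π b)))
    (ψ := (leftAct N' (m.π b)).comp (BalancedTensor.map LinearMap.id g)) (fun _ _ => rfl))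

/-- `fM` as a module over `eAe ≅ fBf`. -/
def Restricted (_ : CornerModel he hf) (M : Type u) [AddCommGroup M] [Module B M] : Type u :=
  CornerModule hf M

instance : AddCommGroup (m.Restricted M) := inferInstanceAs (AddCommGroup (CornerModule hf M))

instance : Module he.Corner (m.Restricted M) :=
  Module.compHom (CornerModule hf M) (m.ψ : he.Corner →+* hf.Corner)

variable {m}

/-- The inclusion `fM → M`. -/
def Restricted.val : m.Restricted M →+ M where
  toFun x := Subtype.val (p := (· ∈ (DistribSMul.toAddMonoidHom M f).range)) x
  map_zero' := rfl
  map_add' _ _ := rfl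

/-- The element of `fM` given by `x : M` with `f x = x`. -/
def Restricted.mk (x : M) (hx : f • x = x) : m.Restricted M := CornerModule.mk hf x hx

lemma Restricted.ext {x y : m.Restricted M} (h : x.val = y.val) : x = y := Subtype.ext h

lemma Restricted.val_smul (l : he.Corner) (x : m.Restricted M) :
    (l • x).val = (m.ψ l).1 • x.val := rfl

lemma Restricted.f_smul_val (x : m.Restricted M) : f • x.val = x.val := CornerModule.smul_val x

variable (m)

/-- The element `e` of `Ae`. -/
abbrev gen (he : IsIdempotentElem e) : LeftIdeal he := LeftIdeal.mk he e he.eq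

lemma f_smul_tmul_gen (n : N) :
    f • Induced.tmul m (gen he) n = Induced.tmul m (gen he) n := by
  rw [smul_tmul]
  refine congrArg (Induced.tmul m · n) (Subtype.ext ?_)
  change m.π f * e = e
  rw [m.π_f, he.eq]

lemma tmul_gen_smul (l : he.Corner) (n : N) :
    Induced.tmul m (gen he) (l • n) = (m.ψ l).1 • Induced.tmul m (gen he) n := by
  rw [smul_tmul, Induced.tmul_smul]
  refine congrArg (Induced.tmul m · n) (Subtype.ext ?_)
  change e * l.1 = m.π (m.ψ l).1 * e
  obtain ⟨h1, h2⟩ := (Subsemigroup.mem_corner_iff he).mp l.2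
  rw [m.π_ψ, h1, h2]

lemma tmul_eq_smul (x : LeftIdeal he) (n : N) :
    Induced.tmul m x n = (m.σ x).1 • Induced.tmul m (gen he) n := by
  rw [smul_tmul]
  refine congrArg (Induced.tmul m · n) (Subtype.ext ?_)
  change x.1 = m.π (m.σ x).1 * e
  rw [m.π_σ, x.val_mul]

/-- The map `N → fM` given by a map `Bf ⊗ N → M`. -/
def restrict (g : m.Induced N →ₗ[B] M) : N →ₗ[he.Corner] m.Restricted M where
  toFun n := Restricted.mk (g (Induced.tmul m (gen he) n))
    (by rw [← map_smul, f_smul_tmul_gen])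
  map_add' n n' := Restricted.ext ((congrArg g (Induced.tmul_add m _ n n')).trans (map_add g _ _))
  map_smul' l n := Restricted.ext ((congrArg g (tmul_gen_smul m l n)).trans (map_smul g _ _))

lemma val_restrict (g : m.Induced N →ₗ[B] M) (n : N) :
    (m.restrict g n).val = g (Induced.tmul m (gen he) n) := rfl

/-- The additive map `Bf ⊗ N → M` given by a map `N → fM`. -/
def extendAdd (h : N →ₗ[he.Corner] m.Restricted M) :
    BalancedTensor he.Corner (LeftIdeal he) N →+ M :=
  BalancedTensor.lift
    (AddMonoidHom.mk' (fun x => AddMonoidHom.mk' (fun n => (m.σ x).1 • (h n).val)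
      (fun n n' => by rw [map_add, map_add, smul_add]))
      (fun x x' => by
        ext n
        change (m.σ (x + x')).1 • (h n).val = (m.σ x).1 • (h n).val + (m.σ x').1 • (h n).val
        rw [map_add, ← add_smul]
        rfl))
    (fun x l n => by
      change (m.σ _).1 • (h n).val = (m.σ x).1 • (h _).val
      rw [m.mul_σ_ψ, mul_smul, map_smul, Restricted.val_smul])

/-- The map `Bf ⊗ N → M` given by a map `N → fM`. -/
def extend (h : N →ₗ[he.Corner] m.Restricted M) : m.Induced N →ₗ[B] M where
  toFun := m.extendAdd h
  map_add' := map_add (m.extendAdd h)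
  map_smul' b := DFunLike.congr_fun (BalancedTensor.hom_ext
    (φ := (m.extendAdd h).comp (leftAct N (m.π b)))
    (ψ := (DistribSMul.toAddMonoidHom M b).comp (m.extendAdd h)) (fun x n => by
      change (m.σ (leftMul he (m.π b) x)).1 • (h n).val = b • (m.σ x).1 • (h n).val
      rw [m.σ_leftMul, mul_smul]))

lemma extend_tmul (h : N →ₗ[he.Corner] m.Restricted M) (x : LeftIdeal he) (n : N) :
    m.extend h (Induced.tmul m x n) = (m.σ x).1 • (h n).val := rfl

lemma extend_restrict (g : m.Induced N →ₗ[B] M) : m.extend (m.restrict g) = g :=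
  Induced.linearMap_ext fun x n => by
    rw [extend_tmul, val_restrict, ← map_smul, ← tmul_eq_smul]

lemma restrict_extend (h : N →ₗ[he.Corner] m.Restricted M) : m.restrict (m.extend h) = h :=
  LinearMap.ext fun n => Restricted.ext (by
    rw [val_restrict, extend_tmul]
    have h1 : (m.σ (gen he)).1 = f :=
      ext_left (LeftIdeal.val_mul _) hf.eq ((m.π_σ _).trans m.π_f.symm)
    rw [h1, Restricted.f_smul_val])

variable (he) in
/-- The map `Ae → eAe`, `x ↦ e x`. -/
def leftCorner : LeftIdeal he →+ he.Corner :=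
  AddMonoidHom.mk' (fun x => ⟨e * x.1, x.1, by
    change e * x.1 * e = e * x.1
    rw [mul_assoc, x.val_mul]⟩) (fun x x' => Subtype.ext (mul_add e x.1 x'.1))

/-- The map `Bf ⊗ N → N`, `x ⊗ n ↦ (e x) n`. -/
def retraction : m.Induced N →+ N :=
  BalancedTensor.lift (Λ := he.Corner)
    (AddMonoidHom.mk' (fun x => AddMonoidHom.mk' (fun n => leftCorner he x • n)
      (fun n n' => smul_add _ n n'))
      (fun x x' => by
        ext n
        refine Eq.trans ?_ (add_smul _ _ n)
        exact congrArg (· • n) (map_add (leftCorner he) x x')))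
    (fun x l n => by
      refine Eq.trans ?_ (mul_smul (leftCorner he x) l n)
      exact congrArg (fun a : he.Corner => a • n) (Subtype.ext (mul_assoc e x.1 l.1).symm))

lemma f_smul_eq (t : m.Induced N) : f • t = Induced.tmul m (gen he) (m.retraction t) :=
  DFunLike.congr_fun (Induced.hom_ext (g := DistribSMul.toAddMonoidHom _ f)
    (h := (AddMonoidHom.mk' (Induced.tmul m (gen he)) (Induced.tmul_add m _)).comp m.retraction)
    (fun x n => by
      change Induced.tmul m (leftMul he (m.π f) x) n = Induced.tmul m (gen he) (leftCorner he x • n)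
      rw [Induced.tmul_smul]
      refine congrArg (Induced.tmul m · n) (Subtype.ext ?_)
      change m.π f * x.1 = e * (e * x.1)
      rw [m.π_f, ← mul_assoc, he.eq])) t

lemma restrict_id_bijective :
    Function.Bijective (m.restrict (LinearMap.id : m.Induced N →ₗ[B] m.Induced N)) := by
  constructor
  · intro n n' h
    have h1 : Induced.tmul m (gen he) n = Induced.tmul m (gen he) n' :=
      congrArg Restricted.val h
    have h2 (n : N) : m.retraction (Induced.tmul m (gen he) n) = n := by
      refine Eq.trans ?_ (one_smul he.Corner n)
      exact congrArg (fun a : he.Corner => a • n) (Subtype.ext he.eq)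
    rw [← h2 n, h1, h2]
  · intro t
    exact ⟨m.retraction t.val, Restricted.ext ((f_smul_eq m _).symm.trans t.f_smul_val)⟩

end

/-- The functor `N ↦ Ae ⊗_{eAe} N`, with values in `B`-modules. -/
def inducedFunctor : ModuleCat.{u} he.Corner ⥤ ModuleCat.{u} B where
  obj N := ModuleCat.of B (m.Induced N)
  map g := ModuleCat.ofHom (Induced.map m g.hom)
  map_id _ := ModuleCat.hom_ext (Induced.linearMap_ext fun _ _ => rfl)
  map_comp _ _ := ModuleCat.hom_ext (Induced.linearMap_ext fun _ _ => rfl)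

/-- The functor `N ↦ Ae ⊗_{eAe} N` is left adjoint to `M ↦ fM`. -/
def inducedAdj : m.inducedFunctor ⊣ m.cornerFunctor :=
  Adjunction.mkOfHomEquiv
    { homEquiv := fun N M =>
        { toFun := fun g => ModuleCat.ofHom (X := N) (Y := m.Restricted M) (m.restrict g.hom)
          invFun := fun h => ModuleCat.ofHom (m.extend (M := M) h.hom)
          left_inv := fun g => ModuleCat.hom_ext (m.extend_restrict g.hom)
          right_inv := fun h => ModuleCat.hom_ext (m.restrict_extend h.hom) }
      homEquiv_naturality_left_symm := fun _ _ =>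
        ModuleCat.hom_ext (Induced.linearMap_ext fun _ _ => rfl)
      homEquiv_naturality_right := fun _ _ => rfl }

instance (N : ModuleCat.{u} he.Corner) : IsIso (m.inducedAdj.unit.app N) := by
  rw [ConcreteCategory.isIso_iff_bijective]
  exact m.restrict_id_bijective

instance : IsIso m.inducedAdj.unit := NatIso.isIso_of_isIso_app _

instance : m.inducedFunctor.Full := m.inducedAdj.fullyFaithfulLOfIsIsoUnit.full

instance : m.inducedFunctor.Faithful := m.inducedAdj.fullyFaithfulLOfIsIsoUnit.faithful

instance : m.inducedFunctor.Additive := m.inducedAdj.left_adjoint_additive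

/-- The composition of `N ↦ Ae ⊗_{eAe} N` with the forgetful functor to abelian groups. -/
def inducedForget : m.inducedFunctor ⋙ ModuleCat.restrictScalars.{u} (Int.castRingHom B) ≅
    tensorFunctor he.Corner (LeftIdeal he) :=
  NatIso.ofComponents (fun N =>
    { hom := ModuleCat.ofHom (X := (ModuleCat.restrictScalars.{u} (Int.castRingHom B)).obj
        (m.inducedFunctor.obj N)) (Y := BalancedTensor he.Corner (LeftIdeal he) N)
        { toFun := id
          map_add' := fun _ _ => rfl
          map_smul' := fun n t => Int.cast_smul_eq_zsmul B n (show m.Induced N from t) }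
      inv := ModuleCat.ofHom (Y := (ModuleCat.restrictScalars.{u} (Int.castRingHom B)).obj
        (m.inducedFunctor.obj N)) (X := BalancedTensor he.Corner (LeftIdeal he) N)
        { toFun := id
          map_add' := fun _ _ => rfl
          map_smul' := fun n t => (Int.cast_smul_eq_zsmul B n (show m.Induced N from t)).symm }
      hom_inv_id := rfl
      inv_hom_id := rfl })
    (fun _ => rfl)

end CornerModel

end MirrorReflective

/-! ## Vanishing of `Ext` -/

namespace CategoryTheory.Abelian.Ext

variable {C : Type*} [Category* C] [Abelian C] [HasExt.{w} C]

lemma subsingleton_zero_iff {X Y : C} : Subsingleton (Ext.{w} X Y 0) ↔ Subsingleton (X ⟶ Y) :=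
  homEquiv₀.subsingleton_congr

lemma subsingleton_of_iso {X X' : C} (i : X ≅ X') {Y : C} {n : ℕ} [Subsingleton (Ext.{w} X Y n)] :
    Subsingleton (Ext.{w} X' Y n) := by
  refine subsingleton_of_forall_eq 0 fun x ↦ ?_
  have h : (mk₀ i.hom).comp x (zero_add n) = 0 := Subsingleton.elim _ _
  rw [← mk₀_id_comp x, ← i.inv_hom_id, ← mk₀_comp_mk₀_assoc, h, comp_zero]

section

variable {S : ShortComplex C} (hS : S.ShortExact) {Y : C} {n : ℕ}

include hS

lemma subsingleton_X₃ [Subsingleton (Ext.{w} S.X₁ Y n)] [Subsingleton (Ext.{w} S.X₂ Y (n + 1))] :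
    Subsingleton (Ext.{w} S.X₃ Y (n + 1)) := by
  refine subsingleton_of_forall_eq 0 fun x ↦ ?_
  obtain ⟨y, rfl⟩ := contravariant_sequence_exact₃ hS Y x (Subsingleton.elim _ _) (add_comm 1 n)
  rw [Subsingleton.elim y 0, comp_zero]

lemma subsingleton_X₁ [Subsingleton (Ext.{w} S.X₂ Y n)] [Subsingleton (Ext.{w} S.X₃ Y (n + 1))] :
    Subsingleton (Ext.{w} S.X₁ Y n) := by
  refine subsingleton_of_forall_eq 0 fun x ↦ ?_
  obtain ⟨y, rfl⟩ := contravariant_sequence_exact₁ hS Y x (add_comm 1 n) (Subsingleton.elim _ _)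
  rw [Subsingleton.elim y 0, comp_zero]

end

lemma subsingleton_pt_of_isColimit_cofan [EnoughInjectives C] {J : Type*} {X : J → C} {c : Cofan X}
    (hc : IsColimit c) {Y : C} {n : ℕ} (h : ∀ j, Subsingleton (Ext.{w} (X j) Y (n + 1))) :
    Subsingleton (Ext.{w} c.pt Y (n + 1)) := by
  induction n generalizing Y with
  | zero =>
    let I : InjectivePresentation Y := Classical.arbitrary _
    let S := ShortComplex.mk _ _ (cokernel.condition I.f)
    have hS : S.ShortExact := { exact := ShortComplex.exact_cokernel I.f }
    have (Z : C) (k : ℕ) : Subsingleton (Ext.{w} Z S.X₂ (k + 1)) := subsingleton_of_injective _ _ _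
    refine subsingleton_of_forall_eq 0 fun x ↦ ?_
    obtain ⟨y, rfl⟩ := covariant_sequence_exact₁ _ hS x (Subsingleton.elim _ _) rfl
    obtain ⟨g, rfl⟩ := homEquiv₀.symm.surjective y
    have hg (j : J) : ∃ l : X j ⟶ S.X₂, l ≫ S.g = c.inj j ≫ g := by
      obtain ⟨l, hl⟩ := covariant_sequence_exact₃ _ hS (mk₀ (c.inj j ≫ g)) rfl
        ((h j).elim _ _)
      obtain ⟨l, rfl⟩ := homEquiv₀.symm.surjective l
      refine ⟨l, homEquiv₀.symm.injective ?_⟩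
      exact (mk₀_comp_mk₀ l S.g).symm.trans hl
    choose l hl using hg
    have : g = Cofan.IsColimit.desc hc l ≫ S.g :=
      Cofan.IsColimit.hom_ext hc _ _ fun j ↦ by
        rw [← hl j, ← Category.assoc, Cofan.IsColimit.fac]
    change (mk₀ g).comp hS.extClass _ = 0
    rw [this, ← mk₀_comp_mk₀, comp_assoc_of_second_deg_zero, ShortComplex.ShortExact.comp_extClass,
      comp_zero]
  | succ n hn =>
    let I : InjectivePresentation Y := Classical.arbitrary _
    let S := ShortComplex.mk _ _ (cokernel.condition I.f)
    have hS : S.ShortExact := { exact := ShortComplex.exact_cokernel I.f }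
    have (Z : C) (k : ℕ) : Subsingleton (Ext.{w} Z S.X₂ (k + 1)) := subsingleton_of_injective _ _ _
    have h3 : Subsingleton (Ext.{w} c.pt S.X₃ (n + 1)) := by
      refine hn (Y := S.X₃) (fun j ↦ subsingleton_of_forall_eq 0 fun x ↦ ?_)
      obtain ⟨y, rfl⟩ := covariant_sequence_exact₃ _ hS x rfl ((h j).elim _ _)
      rw [Subsingleton.elim y 0, zero_comp]
    refine subsingleton_of_forall_eq 0 fun x ↦ ?_
    obtain ⟨y, rfl⟩ := covariant_sequence_exact₁ _ hS x (Subsingleton.elim _ _) rfl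
    rw [Subsingleton.elim y 0, zero_comp]

section Syzygies

variable {M K : ℕ → C} (g : ∀ k, M (k + 1) ⟶ K k) (p : ∀ k, K k ⟶ M k)
  (zero : ∀ k, g k ≫ p k = 0) (exact : ∀ k, (ShortComplex.mk _ _ (zero k)).Exact)
  [∀ k, Epi (p k)] [∀ k, Projective (K k)] {P : ObjectProperty C}
  (orth : ∀ k Y, P Y → Subsingleton (K k ⟶ Y)) (ker : ∀ k, P (kernel (g k)))

include exact orth ker

/-- For a sequence of exact sequences `M (k + 1) ⟶ K k ⟶ M k ⟶ 0` such that there are no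
extensions of `K k` by the objects with property `P`, the vanishing of the extensions of `M k` in
small degrees detects that the first few of the maps `M (k + 1) ⟶ K k` are monomorphisms. -/
theorem subsingleton_iff_mono_of_syzygies (s k : ℕ) :
    (∀ Y, P Y → ∀ i ≤ s + 1, Subsingleton (Ext.{w} (M k) Y i)) ↔ ∀ j < s, Mono (g (k + j)) := by
  have orthM (k : ℕ) (Y : C) (hY : P Y) : Subsingleton (M k ⟶ Y) :=
    ⟨fun a b ↦ by rw [← cancel_epi (p k)]; exact (orth k Y hY).elim _ _⟩
  let S (k : ℕ) := ShortComplex.mk (kernel.ι (p k)) (p k) (kernel.condition _)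
  have hS (k : ℕ) : (S k).ShortExact := { exact := ShortComplex.exact_kernel _ }
  let q (k : ℕ) : M (k + 1) ⟶ kernel (p k) := kernel.lift _ (g k) (zero k)
  have hq (k : ℕ) : Epi (q k) := (ShortComplex.exact_iff_epi_kernel_lift _).1 (exact k)
  have projK (k : ℕ) (Y : C) (i : ℕ) : Subsingleton (Ext.{w} (S k).X₂ Y (i + 1)) :=
    subsingleton_of_projective (K k) _ _
  have projK₀ (k : ℕ) (Y : C) (hY : P Y) (i : ℕ) : Subsingleton (Ext.{w} (S k).X₂ Y i) := by
    cases i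
    · rw [subsingleton_zero_iff]; exact orth _ _ hY
    · infer_instance
  have one (k : ℕ) (Y : C) (hY : P Y) (i : ℕ) (hi : i ≤ 1) : Subsingleton (Ext.{w} (M k) Y i) := by
    obtain rfl | rfl : i = 0 ∨ i = 1 := by lia
    · rw [subsingleton_zero_iff]; exact orthM _ _ hY
    · have : Subsingleton (Ext.{w} (S k).X₁ Y 0) := by
        rw [subsingleton_zero_iff]
        exact ⟨fun a b ↦ by rw [← cancel_epi (q k)]; exact (orthM (k + 1) Y hY).elim _ _⟩
      exact subsingleton_X₃ (hS k)
  have step (k : ℕ) (hk : Mono (g k)) (Y : C) (hY : P Y) (i : ℕ) :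
      Subsingleton (Ext.{w} (M k) Y (i + 1)) ↔ Subsingleton (Ext.{w} (M (k + 1)) Y i) := by
    have : Mono (q k) := by
      have : Mono (q k ≫ kernel.ι (p k)) := by rw [kernel.lift_ι]; exact hk
      exact mono_of_mono (q k) (kernel.ι (p k))
    have : IsIso (q k) := isIso_of_mono_of_epi _
    have := projK₀ k Y hY
    constructor
    · intro (_ : Subsingleton (Ext.{w} (S k).X₃ Y (i + 1)))
      have : Subsingleton (Ext.{w} (kernel (p k)) Y i) := subsingleton_X₁ (hS k)
      exact subsingleton_of_iso (asIso (q k)).symm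
    · intro _
      have : Subsingleton (Ext.{w} (S k).X₁ Y i) := subsingleton_of_iso (asIso (q k))
      exact subsingleton_X₃ (hS k)
  induction s generalizing k with
  | zero => exact ⟨fun _ _ h ↦ absurd h (Nat.not_lt_zero _), fun _ Y hY i hi ↦ one k Y hY i hi⟩
  | succ s hs =>
    constructor
    · intro h
      have hk : Mono (g k) := by
        let T := ShortComplex.mk (kernel.ι (q k)) (q k) (kernel.condition _)
        have hT : T.ShortExact := { exact := ShortComplex.exact_kernel _ }
        have e : kernel (q k) ≅ kernel (g k) := by
          refine (kernelCompMono (q k) (kernel.ι (p k))).symm ≪≫ kernelIsoOfEq (by simp [q])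
        have hP := ker k
        have h2 : Subsingleton (Ext.{w} (S k).X₃ (kernel (g k)) (1 + 1)) := h _ hP _ (by lia)
        have := projK₀ k _ hP 1
        have h1 : Subsingleton (Ext.{w} T.X₃ (kernel (g k)) (0 + 1)) := subsingleton_X₁ (hS k)
        have h0 : Subsingleton (Ext.{w} T.X₂ (kernel (g k)) 0) :=
          subsingleton_zero_iff.2 (orthM _ _ hP)
        have := subsingleton_zero_iff.1 (subsingleton_X₁ (n := 0) hT (Y := kernel (g k)))
        have hz : IsZero (kernel (g k)) := by
          rw [IsZero.iff_id_eq_zero, ← cancel_epi e.hom]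
          exact this.elim _ _
        exact Preadditive.mono_of_isZero_kernel _ hz
      have h' := (hs (k + 1)).1 fun Y hY i hi ↦ (step k hk Y hY i).1 (h Y hY _ (by lia))
      rintro (_ | j) hj
      · exact hk
      · have e : k + 1 + j = k + (j + 1) := by lia
        exact e ▸ h' j (by lia)
    · intro h Y hY i hi
      cases i with
      | zero => exact one k Y hY 0 (by lia)
      | succ i =>
        refine (step k (h 0 (by lia)) Y hY i).2 ((hs (k + 1)).2 (fun j hj ↦ ?_) Y hY i (by lia))
        have e : k + (j + 1) = k + 1 + j := by lia
        exact e ▸ h (j + 1) (by lia)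

end Syzygies

end CategoryTheory.Abelian.Ext

namespace CategoryTheory

open Abelian

section

variable {C : Type*} [Category* C] [Abelian C] {D : Type*} [Category* D] [Abelian D]
  (F : C ⥤ D) [F.Additive] [PreservesFiniteLimits F] [PreservesFiniteColimits F]

attribute [local simp] Ext.mapExactFunctor_comp Ext.mapExactFunctor_mk₀ Ext.mapExactFunctor_extClass

attribute [local instance] Ext.subsingleton_of_projective in
/-- A version of `Functor.mapExt_bijective_of_preservesProjectiveObjects` in bounded degrees. -/
lemma Functor.mapExt_bijective_of_subsingleton [F.Full] [F.Faithful] [HasExt.{w} C]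
    [HasExt.{w} D] (n : ℕ)
    (h : ∀ X : C, ∃ (W : C) (p : W ⟶ X), Epi p ∧ Projective W ∧
      ∀ Y : C, ∀ i < n, Subsingleton (Ext.{w} (F.obj W) (F.obj Y) (i + 1)))
    (X Y : C) (i : ℕ) (hi : i ≤ n) : Function.Bijective (F.mapExtAddHom X Y i) := by
  induction i generalizing X with
  | zero => simpa [Ext.mapExactFunctor₀] using ⟨Faithful.map_injective, Full.map_surjective⟩
  | succ i hn =>
    obtain ⟨W, p, _, _, hW⟩ := h X
    let S := ShortComplex.mk _ _ (kernel.condition p)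
    have hS : S.ShortExact := { exact := ShortComplex.exact_kernel p }
    have : Subsingleton (Ext.{w} (S.map F).X₂ (F.obj Y) (i + 1)) := hW Y i hi
    have : Projective S.X₂ := ‹Projective W›
    have hn := fun X ↦ hn X (by lia)
    exact AddMonoidHom.bijective_of_surjective_of_bijective_of_right_exact _ _ _ _
      (F.mapExtAddHom S.X₂ Y i) (F.mapExtAddHom S.X₁ Y i) (F.mapExtAddHom S.X₃ Y (i + 1))
      (by cat_disch) (by cat_disch)
      ((ShortComplex.ab_exact_iff_function_exact _).1
        (Ext.contravariant_sequence_exact₁' hS Y i (i + 1) (add_comm 1 i)))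
      ((ShortComplex.ab_exact_iff_function_exact _).1
        (Ext.contravariant_sequence_exact₁' (hS.map F) (F.obj Y) i (i + 1) (add_comm 1 i)))
      (hn _).surjective (hn _)
      (fun x₃ ↦ Ext.contravariant_sequence_exact₃ hS _ x₃ (by subsingleton) (add_comm 1 i))
      (fun y₃ ↦ Ext.contravariant_sequence_exact₃ (hS.map F) _ y₃ (by subsingleton) (add_comm 1 i))

end

end CategoryTheory

namespace ModuleCat

variable {B C : Type u} [Ring B] [Ring C] (φ : B →+* C)

lemma exists_epi_sigma (X : ModuleCat.{u} C) :
    ∃ p : (∐ fun _ : X ↦ ModuleCat.of C C) ⟶ X, Epi p := by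
  refine ⟨Sigma.desc fun x ↦ ModuleCat.ofHom (LinearMap.toSpanSingleton C X x), ?_⟩
  rw [ModuleCat.epi_iff_surjective]
  intro x
  refine ⟨Sigma.ι (fun _ : X ↦ ModuleCat.of C C) x (1 : C), ?_⟩
  rw [← ConcreteCategory.comp_apply, Sigma.ι_desc]
  exact one_smul C x

lemma full_restrictScalars (hφ : Function.Surjective φ) : (restrictScalars.{u} φ).Full where
  map_surjective {X Y} g := ⟨ModuleCat.ofHom
    { toFun := fun x ↦ g x
      map_add' := fun x y ↦ map_add g.hom x y
      map_smul' := fun c x ↦ by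
        obtain ⟨b, rfl⟩ := hφ c
        exact g.hom.map_smul b (show (restrictScalars.{u} φ).obj X from x) }, rfl⟩

lemma subsingleton_ext_restrictScalars_sigma {J : Type u} {Y : ModuleCat.{u} B} {n : ℕ}
    (h : Subsingleton (Abelian.Ext.{u} ((restrictScalars φ).obj (ModuleCat.of C C)) Y (n + 1))) :
    Subsingleton (Abelian.Ext.{u} ((restrictScalars φ).obj (∐ fun _ : J ↦ ModuleCat.of C C)) Y
      (n + 1)) := by
  have : PreservesColimitsOfSize.{u, u} (restrictScalars.{u} φ) :=
    (restrictCoextendScalarsAdj.{u} φ).leftAdjoint_preservesColimits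
  have hc := isColimitCofanMkObjOfIsColimit (restrictScalars.{u} φ) _ _
    (coproductIsCoproduct fun _ : J ↦ ModuleCat.of C C)
  exact Abelian.Ext.subsingleton_pt_of_isColimit_cofan hc fun _ ↦ h

end ModuleCat

namespace MirrorReflective

lemma isNIdempotent_iff {B : Type u} [Ring B] (I : Ideal B) [I.IsTwoSided] (n : ℕ) :
    IsNIdempotent I n ↔ ∀ (Y : ModuleCat.{u} (B ⧸ I)) (i : ℕ), i < n →
      Subsingleton (Abelian.Ext.{u}
        ((ModuleCat.restrictScalars (Ideal.Quotient.mk I)).obj (ModuleCat.of (B ⧸ I) (B ⧸ I)))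
        ((ModuleCat.restrictScalars (Ideal.Quotient.mk I)).obj Y) (i + 1)) := by
  have := ModuleCat.full_restrictScalars _ (Ideal.Quotient.mk_surjective (I := I))
  have : Projective (ModuleCat.of (B ⧸ I) (B ⧸ I)) :=
    ModuleCat.projective_of_free (Module.Basis.singleton Unit (B ⧸ I))
  constructor
  · intro h Y i hi
    have h := h (ModuleCat.of (B ⧸ I) (B ⧸ I)) Y (i + 1) (by lia) hi
    have := Abelian.Ext.subsingleton_of_projective.{u} (ModuleCat.of (B ⧸ I) (B ⧸ I)) Y i
    exact h.surjective.subsingleton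
  · intro h X Y i _ hi
    refine Functor.mapExt_bijective_of_subsingleton _ n (fun X ↦ ?_) X Y i hi
    obtain ⟨p, hp⟩ := ModuleCat.exists_epi_sigma X
    exact ⟨_, p, hp, inferInstance, fun Y i hi ↦
      ModuleCat.subsingleton_ext_restrictScalars_sigma _ (h Y i hi)⟩

end MirrorReflective

namespace CategoryTheory

open Abelian

lemma isZero_homology_succ_iff {C : Type*} [Category* C] [Abelian C] (K : ChainComplex C ℕ)
    (n : ℕ) : IsZero (K.homology (n + 1)) ↔ Mono (K.fromOpcycles (n + 1) n) := by
  have h := K.homologyIsKernel (n + 1) n (by simp)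
  constructor
  · intro h0
    refine Preadditive.mono_of_cancel_zero _ fun g hg ↦ ?_
    obtain ⟨l, hl⟩ := KernelFork.IsLimit.lift' h g hg
    rw [← hl, h0.eq_of_tgt l 0, zero_comp]
  · intro _
    rw [IsZero.iff_id_eq_zero, ← cancel_mono (K.homologyι (n + 1)),
      ← cancel_mono (K.fromOpcycles (n + 1) n)]
    simp

section

variable {C D : Type*} [Category* C] [Category* D] [Abelian C] [Abelian D] [HasExt.{w} D]
  {G : C ⥤ D} {F : D ⥤ C} [G.Additive] [F.Additive] [PreservesFiniteLimits F]
  [PreservesFiniteColimits F] (adj : G ⊣ F) [IsIso adj.unit]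

omit [HasExt.{w} D] in
include adj in
lemma isZero_map_homology_succ {X : C} (P : ProjectiveResolution X) (n : ℕ) :
    IsZero (F.obj (((G.mapHomologicalComplex _).obj P.complex).homology (n + 1))) := by
  let S := P.complex.sc (n + 1)
  let i : S ≅ (S.map G).map F := S.mapNatIso (asIso adj.unit)
  have h : ((S.map G).map F).Exact := ShortComplex.exact_of_iso i (P.complex_exactAt_succ n)
  exact ((ShortComplex.exact_iff_isZero_homology _).1 h).of_iso
    ((S.map G).mapHomologyIso F).symm

include adj in
/-- Let `G` be a fully faithful left adjoint of an exact functor `F`. The vanishing of the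
extensions of `G X` by the objects in the kernel of `F` is measured by the left derived functors
of `G` at `X`. -/
theorem subsingleton_ext_iff_isZero_leftDerived [EnoughProjectives C] (X : C) (s : ℕ) :
    (∀ Y : D, IsZero (F.obj Y) → ∀ i ≤ s + 1, Subsingleton (Ext.{w} (G.obj X) Y i)) ↔
      ∀ j < s, IsZero ((G.leftDerived (j + 1)).obj X) := by
  let P := projectiveResolution X
  let K := (G.mapHomologicalComplex _).obj P.complex
  have : PreservesFiniteColimits G := ⟨fun _ _ _ ↦
    have := adj.leftAdjoint_preservesColimits.{0, 0}
    inferInstance⟩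
  have (n : ℕ) : Projective (K.X n) := adj.map_projective _ (P.projective n)
  have hzero (n : ℕ) : K.fromOpcycles (n + 1) n ≫ K.pOpcycles n = 0 := by
    rw [← cancel_epi (K.pOpcycles (n + 1))]
    simp
  have hexact (n : ℕ) : (ShortComplex.mk _ _ (hzero n)).Exact := by
    exact ShortComplex.exact_of_g_is_cokernel _
      (isCokernelOfComp _ _ (K.opcyclesIsCokernel (n + 1) n (by simp)) (hzero n)
        (K.p_fromOpcycles (n + 1) n))
  have ι : K.opcycles 0 ≅ G.obj X := asIso (P.fromLeftDerivedZero' G)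
  have key := Ext.subsingleton_iff_mono_of_syzygies (M := fun n ↦ K.opcycles n) (K := K.X)
    (g := fun n ↦ K.fromOpcycles (n + 1) n) (p := fun n ↦ K.pOpcycles n) hzero hexact (P := fun Y ↦ IsZero (F.obj Y))
    (fun n Y hY ↦ ⟨fun a b ↦ (adj.homEquiv _ _).injective (hY.eq_of_tgt _ _)⟩)
    (fun n ↦ by
      have e : K.homology (n + 1) ≅ kernel (K.fromOpcycles (n + 1) n) :=
        IsLimit.conePointUniqueUpToIso (K.homologyIsKernel (n + 1) n (by simp)) (limit.isLimit _)
      exact (isZero_map_homology_succ adj P n).of_iso (F.mapIso e.symm)) s 0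
  have h1 (Y : D) (i : ℕ) : Subsingleton (Ext.{w} (G.obj X) Y i) ↔
      Subsingleton (Ext.{w} (K.opcycles 0) Y i) :=
    ⟨fun _ ↦ Ext.subsingleton_of_iso ι.symm, fun _ ↦ Ext.subsingleton_of_iso ι⟩
  have h2 (j : ℕ) : IsZero ((G.leftDerived (j + 1)).obj X) ↔
      Mono (K.fromOpcycles (0 + j + 1) (0 + j)) := by
    rw [zero_add, ← isZero_homology_succ_iff]
    exact (P.isoLeftDerivedObj G (j + 1)).isZero_iff
  simp only [h1, h2]
  exact key

end

end CategoryTheory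

lemma CategoryTheory.Abelian.Ext.subsingleton_of_iso_right {C : Type*} [Category* C] [Abelian C]
    [HasExt.{w} C] {X Y Y' : C} (i : Y ≅ Y') {n : ℕ} [Subsingleton (Abelian.Ext.{w} X Y n)] :
    Subsingleton (Abelian.Ext.{w} X Y' n) := by
  refine subsingleton_of_forall_eq 0 fun x ↦ ?_
  have h : x.comp (mk₀ i.inv) (add_zero n) = 0 := Subsingleton.elim _ _
  rw [← comp_mk₀_id x, ← i.inv_hom_id, ← mk₀_comp_mk₀,
    ← comp_assoc_of_third_deg_zero, h, zero_comp]

namespace MirrorReflective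

lemma mem_idealOf {B : Type u} [Ring B] (f : B) : f ∈ idealOf f := by
  have h : f ∈ TwoSidedIdeal.span {f} := TwoSidedIdeal.subset_span rfl
  exact h

namespace CornerModel

open Abelian

variable {A B : Type u} [Ring A] [Ring B] {e : A} {f : B}
variable {he : IsIdempotentElem e} {hf : IsIdempotentElem f} (m : CornerModel he hf)

lemma isZero_cornerFunctor_obj_iff (Y : ModuleCat.{u} B) :
    IsZero (m.cornerFunctor.obj Y) ↔ ∀ y : Y, f • y = 0 := by
  have h : Subsingleton (m.cornerFunctor.obj Y) ↔ ∀ y : Y, f • y = 0 := by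
    change Subsingleton (CornerModule hf Y) ↔ _
    constructor
    · intro h y
      have := h.elim (CornerModule.mk hf (f • y) (by rw [smul_smul, hf.eq])) 0
      exact congrArg Subtype.val this
    · intro h
      refine subsingleton_of_forall_eq 0 fun y ↦ Subtype.ext ?_
      exact y.smul_val.symm.trans (h y.1)
  rw [← h]
  exact ⟨fun h ↦ ModuleCat.subsingleton_of_isZero h, fun _ ↦ ModuleCat.isZero_of_subsingleton _⟩

lemma isZero_cornerFunctor_obj_restrictScalars {C : Type u} [Ring C] (φ : B →+* C) (hφ : φ f = 0)
    (Y : ModuleCat.{u} C) : IsZero (m.cornerFunctor.obj ((ModuleCat.restrictScalars φ).obj Y)) := by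
  rw [isZero_cornerFunctor_obj_iff]
  intro y
  have : φ f • (show Y from y) = 0 := by rw [hφ, zero_smul]
  exact this

include m in
lemma smul_eq_zero_of_mem_idealOf {Y : ModuleCat.{u} B} (hY : ∀ y : Y, f • y = 0) {b : B}
    (hb : b ∈ idealOf f) (y : Y) : b • y = 0 := by
  obtain ⟨t, rfl⟩ := m.exists_mulMap_eq hb
  induction t using btmul_induction with
  | zero => rw [map_zero, zero_smul]
  | add s t hs ht => rw [map_add, add_smul, hs (m.mulMap_mem s), ht (m.mulMap_mem t), add_zero]
  | tmul x z => rw [mulMap_btmul, ← CornerModule.mul_val (m.τ z), mul_smul, mul_smul, hY, smul_zero]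

lemma exists_iso_restrictScalars_quotient {Y : ModuleCat.{u} B}
    (hY : IsZero (m.cornerFunctor.obj Y)) :
    ∃ Z : ModuleCat.{u} (B ⧸ idealOf f),
      Nonempty (Y ≅ (ModuleCat.restrictScalars (Ideal.Quotient.mk (idealOf f))).obj Z) := by
  rw [isZero_cornerFunctor_obj_iff] at hY
  have h : Module.IsTorsionBySet B Y (idealOf f : Set B) := fun y b ↦
    m.smul_eq_zero_of_mem_idealOf hY b.2 y
  let := h.module
  let Z := (ModuleCat.restrictScalars (Ideal.Quotient.mk (idealOf f))).obj
    (ModuleCat.of (B ⧸ idealOf f) Y)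
  exact ⟨ModuleCat.of (B ⧸ idealOf f) Y, ⟨{
    hom := ModuleCat.ofHom (Y := Z)
      { toFun := fun y ↦ y, map_add' := fun _ _ ↦ rfl, map_smul' := fun _ _ ↦ rfl }
    inv := ModuleCat.ofHom (X := Z) (Y := Y)
      { toFun := fun y ↦ y, map_add' := fun _ _ ↦ rfl, map_smul' := fun _ _ ↦ rfl } }⟩⟩

/-- The multiplication map `Bf ⊗ fB → BfB`. -/
def toIdeal : m.Induced (CornerModule he A) →ₗ[B] idealOf f where
  toFun t := ⟨m.mulMap t, m.mulMap_mem t⟩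
  map_add' s t := Subtype.ext (map_add m.mulMap s t)
  map_smul' b t := Subtype.ext (m.mulMap_lact b t)

lemma toIdeal_bijective (hm : Function.Injective m.mulMap) : Function.Bijective m.toIdeal :=
  ⟨fun _ _ h ↦ hm (congrArg Subtype.val h), fun b ↦ by
    obtain ⟨t, ht⟩ := m.exists_mulMap_eq b.2
    exact ⟨t, Subtype.ext ht⟩⟩

/-- The isomorphism `Bf ⊗ fB ≅ BfB`. -/
def idealIso (hm : Function.Injective m.mulMap) :
    m.inducedFunctor.obj (ModuleCat.of he.Corner (CornerModule he A)) ≅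
      ModuleCat.of B (idealOf f) :=
  (LinearEquiv.ofBijective m.toIdeal (m.toIdeal_bijective hm)).toModuleIso

end CornerModel

section

variable {B C : Type u} [Ring B] [Ring C] (φ : B →+* C) (I : Ideal B)

/-- The complex `I ⟶ B ⟶ C` of `B`-modules given by an ideal `I` of `B` in the kernel of a
homomorphism `B → C`. -/
def idealShortComplex (h : I ≤ RingHom.ker φ) : ShortComplex (ModuleCat.{u} B) :=
  ShortComplex.mk (X₁ := ModuleCat.of B I) (X₂ := ModuleCat.of B B)
    (X₃ := (ModuleCat.restrictScalars φ).obj (ModuleCat.of C C))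
    (ModuleCat.ofHom I.subtype)
    (ModuleCat.ofHom (Y := (ModuleCat.restrictScalars φ).obj (ModuleCat.of C C))
      { toFun := fun b ↦ φ b
        map_add' := fun a b ↦ map_add φ a b
        map_smul' := fun a b ↦ map_mul φ a b })
    (ModuleCat.hom_ext (LinearMap.ext fun x ↦ h x.2))

lemma idealShortComplex_shortExact (h : I = RingHom.ker φ) (hφ : Function.Surjective φ) :
    (idealShortComplex φ I h.le).ShortExact :=
  ModuleCat.shortComplex_shortExact _
    (fun b ↦ ⟨fun hb ↦ ⟨⟨b, h ▸ hb⟩, rfl⟩, fun ⟨x, hx⟩ ↦ hx ▸ h.le x.2⟩)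
    Subtype.val_injective hφ

end

namespace CornerModel

open Abelian

variable {A B : Type u} [Ring A] [Ring B] {e : A} {f : B}
variable {he : IsIdempotentElem e} {hf : IsIdempotentElem f} (m : CornerModel he hf)

lemma isZero_leftDerived_iff (n : ℕ) :
    IsZero ((m.inducedFunctor.leftDerived n).obj (ModuleCat.of he.Corner (CornerModule he A))) ↔
      IsZero (NCTor he.Corner (LeftIdeal he) (CornerModule he A) n) := by
  let X := ModuleCat.of he.Corner (CornerModule he A)
  let P := projectiveResolution X
  let U := ModuleCat.restrictScalars.{u} (Int.castRingHom B)
  let S := P.complex.sc n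
  obtain ⟨_, _⟩ : PreservesFiniteLimits U ∧ PreservesFiniteColimits U :=
    ((Functor.exact_tfae U).out 1 3).mp (fun S h => by
      rw [ShortComplex.ShortExact.moduleCat_exact_iff_function_exact] at h ⊢
      exact h)
  have i : S.map (tensorFunctor he.Corner (LeftIdeal he)) ≅ (S.map m.inducedFunctor).map U :=
    S.mapNatIso m.inducedForget.symm
  rw [(P.isoLeftDerivedObj m.inducedFunctor n).isZero_iff]
  have h := (P.isoLeftDerivedObj (tensorFunctor he.Corner (LeftIdeal he)) n).isZero_iff
  refine Iff.trans ?_ h.symm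
  have j : (S.map (tensorFunctor he.Corner (LeftIdeal he))).homology ≅
      U.obj (S.map m.inducedFunctor).homology :=
    ShortComplex.homologyMapIso i ≪≫ (S.map m.inducedFunctor).mapHomologyIso U
  have hU (Y : ModuleCat.{u} B) : IsZero (U.obj Y) ↔ IsZero Y := by
    constructor
    · intro h
      have : Subsingleton (U.obj Y) := ModuleCat.subsingleton_of_isZero h
      have : Subsingleton Y := this
      exact ModuleCat.isZero_of_subsingleton _
    · exact fun h ↦ U.map_isZero h
  exact (hU _).symm.trans j.isZero_iff.symm

variable (hm : Function.Injective m.mulMap)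
include hm

theorem isNIdempotent_iff (s : ℕ) : IsNIdempotent (idealOf f) (s + 2) ↔
    ∀ j < s, IsZero (NCTor he.Corner (LeftIdeal he) (CornerModule he A) (j + 1)) := by
  simp only [← m.isZero_leftDerived_iff]
  rw [← subsingleton_ext_iff_isZero_leftDerived.{u} m.inducedAdj, MirrorReflective.isNIdempotent_iff]
  let S := idealShortComplex (Ideal.Quotient.mk (idealOf f)) (idealOf f) (Ideal.mk_ker).ge
  have hS : S.ShortExact := idealShortComplex_shortExact _ _ Ideal.mk_ker.symm
    Ideal.Quotient.mk_surjective
  have : Projective S.X₂ :=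
    ModuleCat.projective_of_free (Module.Basis.singleton Unit B)
  have hX₂ (Y : ModuleCat.{u} B) (i : ℕ) : Subsingleton (Ext.{u} S.X₂ Y (i + 1)) :=
    Ext.subsingleton_of_projective _ _ _
  let α : m.inducedFunctor.obj (ModuleCat.of he.Corner (CornerModule he A)) ≅ S.X₁ :=
    m.idealIso hm
  constructor
  · intro h Y hY i hi
    obtain _ | i := i
    · rw [Ext.subsingleton_zero_iff]
      exact ⟨fun a b ↦ (m.inducedAdj.homEquiv _ _).injective (hY.eq_of_tgt _ _)⟩
    · obtain ⟨Z, ⟨β⟩⟩ := m.exists_iso_restrictScalars_quotient hY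
      have h : Subsingleton (Ext.{u} S.X₃ _ (i + 1 + 1)) := h Z (i + 1) (by lia)
      have := Ext.subsingleton_X₁ (n := i + 1) hS
        (Y := (ModuleCat.restrictScalars (Ideal.Quotient.mk (idealOf f))).obj Z)
      have := Ext.subsingleton_of_iso α.symm
        (Y := (ModuleCat.restrictScalars (Ideal.Quotient.mk (idealOf f))).obj Z) (n := i + 1)
      exact Ext.subsingleton_of_iso_right β.symm
  · intro h Y i hi
    let Y' := (ModuleCat.restrictScalars (Ideal.Quotient.mk (idealOf f))).obj Y
    have := h Y'
      (m.isZero_cornerFunctor_obj_restrictScalars _ (Ideal.Quotient.eq_zero_iff_mem.2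
        (mem_idealOf f)) Y) i (by lia)
    have : Subsingleton (Ext.{u} S.X₁ Y' i) := Ext.subsingleton_of_iso α
    exact Ext.subsingleton_X₃ hS

end CornerModel

end MirrorReflective

/-! ## Morphisms from single complexes of projective objects in the derived category -/

namespace CochainComplex

open HomComplex

variable {C : Type u} [Category.{v} C] [Abelian C]

/-- The stalk complex in degree `0`. -/
abbrev stalk (X : C) : CochainComplex C ℤ := (singleFunctor C 0).obj X

/-- The term in degree `0` of a stalk complex. -/
def stalkIso (X : C) : X ≅ (stalk X).X 0 := (HomologicalComplex.singleObjXSelf (.up ℤ) 0 X).symm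

instance (X : C) [Projective X] : (stalk X).IsKProjective :=
  have (n : ℤ) : Projective ((stalk X).X n) := by
    by_cases hn : n = 0
    · subst hn
      exact Projective.of_iso (stalkIso X) ‹_›
    · exact (HomologicalComplex.isZero_single_obj_X (.up ℤ) 0 X n hn).projective
  isKProjective_of_projective _ 0

variable {X : C} {K L : CochainComplex C ℤ}

/-- The value of a morphism from a stalk complex. -/
def evalStalk (f : stalk X ⟶ K) : X ⟶ K.X 0 :=
  (stalkIso X).hom ≫ f.f 0

lemma evalStalk_comp_d (f : stalk X ⟶ K) : evalStalk f ≫ K.d 0 1 = 0 := by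
  rw [evalStalk, Category.assoc, f.comm, singleFunctor_obj_d, zero_comp, comp_zero]

lemma evalStalk_comp (f : stalk X ⟶ K) (g : K ⟶ L) :
    evalStalk (f ≫ g) = evalStalk f ≫ g.f 0 := by
  rw [evalStalk, evalStalk, HomologicalComplex.comp_f, Category.assoc]

lemma exists_evalStalk_eq (x : X ⟶ K.X 0) (hx : x ≫ K.d 0 1 = 0) :
    ∃ f : stalk X ⟶ K, evalStalk f = x := by
  refine ⟨HomologicalComplex.mkHomFromSingle x ?_, ?_⟩
  · rintro k hk
    obtain rfl : k = 1 := by simpa using hk.symm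
    exact hx
  · refine (congrArg ((stalkIso X).hom ≫ ·) (HomologicalComplex.mkHomFromSingle_f x _)).trans ?_
    exact (stalkIso X).hom_inv_id_assoc x

lemma evalStalk_injective {f g : stalk X ⟶ K} (h : evalStalk f = evalStalk g) : f = g := by
  have h' : f.f 0 = g.f 0 := (cancel_epi (stalkIso X).hom).1 h
  exact HomologicalComplex.from_single_hom_ext h'

lemma quotient_map_stalk_eq_zero_iff (f : stalk X ⟶ K) :
    (HomotopyCategory.quotient C (.up ℤ)).map f = 0 ↔
      ∃ g : X ⟶ K.X (-1), g ≫ K.d (-1) 0 = evalStalk f := by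
  rw [HomotopyCategory.quotient_map_eq_zero_iff]
  have h : Cocycle.ofHom f = Cocycle.fromSingleMk (evalStalk f) (add_zero 0) 1 rfl
      (evalStalk_comp_d f) := by
    obtain ⟨x, hx, h⟩ := Cocycle.fromSingleMk_surjective (Cocycle.ofHom f) 0 (add_zero 0) 1 rfl
    have hx' : x = evalStalk f := by
      have := congrArg (fun z : Cocycle (stalk X) K 0 ↦ z.1.v 0 0 (add_zero 0)) h
      simp at this
      rw [evalStalk, ← this]
      exact ((stalkIso X).hom_inv_id_assoc x).symm
    rw [← h]
    congr
  rw [← Cocycle.fromSingleMk_mem_coboundaries_iff (evalStalk f) (add_zero 0) 1 rfl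
    (evalStalk_comp_d f) (-1) rfl, ← h, mem_coboundaries_iff _ (-1) (by simp : (-1 : ℤ) + 1 = 0)]
  constructor
  · rintro ⟨φ⟩
    obtain ⟨z, hz⟩ := Cochain.equivHomotopy _ _ φ
    exact ⟨z, by simpa using hz.symm⟩
  · rintro ⟨z, hz⟩
    exact ⟨(Cochain.equivHomotopy _ _).symm ⟨z, by simpa using hz.symm⟩⟩

end CochainComplex

namespace DerivedCategory

open CochainComplex

variable {C : Type u} [Category.{v} C] [Abelian C] [HasDerivedCategory.{w} C]

lemma Q_map_eq_zero_iff {P K : CochainComplex C ℤ} [P.IsKProjective] (f : P ⟶ K) :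
    Q.map f = 0 ↔ (HomotopyCategory.quotient C (.up ℤ)).map f = 0 := by
  have h := (quotientCompQhIso C).hom.naturality f
  constructor
  · intro h0
    refine (IsKProjective.Qh_map_bijective P _).injective ?_
    rw [Functor.map_zero, ← cancel_mono ((quotientCompQhIso C).hom.app K), zero_comp]
    refine h.trans ?_
    rw [h0, comp_zero]
  · intro h0
    rw [← cancel_epi ((quotientCompQhIso C).hom.app P), comp_zero, ← h]
    exact (congrArg (· ≫ (quotientCompQhIso C).hom.app K)
      ((congrArg Qh.map h0).trans (Functor.map_zero Qh _ _))).trans zero_comp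

lemma Q_map_surjective {P K : CochainComplex C ℤ} [P.IsKProjective] (g : Q.obj P ⟶ Q.obj K) :
    ∃ f : P ⟶ K, Q.map f = g := by
  obtain ⟨f, hf⟩ := (IsKProjective.Qh_map_bijective P _).surjective
    ((quotientCompQhIso C).hom.app P ≫ g ≫ (quotientCompQhIso C).inv.app K)
  obtain ⟨f, rfl⟩ := (HomotopyCategory.quotient C (.up ℤ)).map_surjective f
  refine ⟨f, ?_⟩
  have h := (quotientCompQhIso C).hom.naturality f
  rw [← cancel_epi ((quotientCompQhIso C).hom.app P), ← h]
  refine (congrArg (· ≫ _) hf).trans ?_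
  simp

end DerivedCategory

namespace DerivedCategory

open CochainComplex

section

variable {C : Type u} [Category.{v} C] [Abelian C] [HasDerivedCategory.{w} C]

lemma isZero_Q_obj_iff (K : CochainComplex C ℤ) :
    IsZero (Q.obj K) ↔ ∀ n, IsZero (K.homology n) := by
  constructor
  · exact fun h n ↦ ((homologyFunctor C n).map_isZero h).of_iso
      ((homologyFunctorFactors C n).app K).symm
  · intro h
    refine (isZero_Qh_obj ?_).of_iso ((quotientCompQhIso C).symm.app K)
    exact (HomotopyCategory.quotient_obj_mem_subcategoryAcyclic_iff_exactAt K).2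
      fun n ↦ (K.exactAt_iff_isZero_homology n).2 (h n)

end

section

variable {B : Type u} [Ring B] [HasDerivedCategory.{w} (ModuleCat.{u} B)]

/-- The derived category of a ring `B` is generated by `B`. -/
lemma isZero_of_stalk_hom_eq_zero (V : DerivedCategory (ModuleCat.{u} B))
    (h : ∀ (n : ℤ) (g : Q.obj (stalk (ModuleCat.of B B)) ⟶ V⟦n⟧), g = 0) : IsZero V := by
  have : Projective (ModuleCat.of B B) :=
    ModuleCat.projective_of_free (Module.Basis.singleton Unit B)
  let K := Q.objPreimage V
  let e : Q.obj K ≅ V := Q.objObjPreimageIso V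
  refine IsZero.of_iso ((isZero_Q_obj_iff K).2 fun n ↦ ?_) e.symm
  let L := K⟦n⟧
  let eL : Q.obj L ≅ V⟦n⟧ := (Q.commShiftIso n).app K ≪≫ (CategoryTheory.shiftFunctor _ n).mapIso e
  have hL : L.ExactAt 0 := by
    rw [L.exactAt_iff' (-1) 0 1 (by simp) (by simp), ShortComplex.moduleCat_exact_iff]
    intro x hx
    obtain ⟨f, hf⟩ := exists_evalStalk_eq (K := L)
      (ModuleCat.ofHom (LinearMap.toSpanSingleton B (L.X 0) x)) (by
        ext
        exact (congrArg (L.d 0 1) (one_smul B x)).trans hx)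
    have h0 : Q.map f = 0 := by
      rw [← cancel_mono eL.hom, zero_comp]
      exact h n _
    rw [Q_map_eq_zero_iff, quotient_map_stalk_eq_zero_iff] at h0
    obtain ⟨g, hg⟩ := h0
    rw [hf] at hg
    exact ⟨g (1 : B), (ConcreteCategory.congr_hom hg (1 : B)).trans (one_smul B x)⟩
  exact ((L.exactAt_iff_isZero_homology 0).1 hL).of_iso
    (((HomologicalComplex.homologyFunctor (ModuleCat.{u} B) (.up ℤ) 0).shiftIso n 0 n
      (add_zero n)).symm.app K)

end

section

variable {C D : Type*} [Category* C] [Category* D] [Abelian C] [Abelian D]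
  [HasDerivedCategory.{w} C] [HasDerivedCategory.{w} D] {F : C ⥤ D} [F.Additive]
  [PreservesFiniteLimits F] [PreservesFiniteColimits F] {X : D} {Z : C} {η : X ⟶ F.obj Z}
  (hη : ∀ Y : C, Function.Bijective (fun g : Z ⟶ Y ↦ η ≫ F.map g))
  {θ : stalk X ⟶ (F.mapHomologicalComplex (.up ℤ)).obj (stalk Z)}
  (hθ : evalStalk θ = η ≫ F.map (stalkIso Z).hom)

omit [HasDerivedCategory.{w} C] [HasDerivedCategory.{w} D] [PreservesFiniteLimits F]
  [PreservesFiniteColimits F] in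
include hθ in
lemma evalStalk_comp_map {K : CochainComplex C ℤ} (g : stalk Z ⟶ K) :
    evalStalk (θ ≫ (F.mapHomologicalComplex (.up ℤ)).map g) = η ≫ F.map (evalStalk g) := by
  rw [evalStalk_comp, hθ, evalStalk, F.map_comp]
  exact Category.assoc η (F.map (stalkIso Z).hom) (F.map (g.f 0))

include hη hθ in
lemma stalk_universal [Projective X] [Projective Z] (Y : DerivedCategory C) :
    Function.Bijective (fun g : Q.obj (stalk Z) ⟶ Y ↦
      (Q.map θ ≫ F.mapDerivedCategoryFactors.inv.app (stalk Z)) ≫ F.mapDerivedCategory.map g) := by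
  let K := Q.objPreimage Y
  let e : Q.obj K ≅ Y := Q.objObjPreimageIso Y
  have key (g : stalk Z ⟶ K) :
      (Q.map θ ≫ F.mapDerivedCategoryFactors.inv.app (stalk Z)) ≫
        F.mapDerivedCategory.map (Q.map g) =
      Q.map (θ ≫ (F.mapHomologicalComplex (.up ℤ)).map g) ≫
        F.mapDerivedCategoryFactors.inv.app K := by
    have := F.mapDerivedCategoryFactors.inv.naturality g
    rw [Q.map_comp, Category.assoc, Category.assoc]
    exact congrArg (Q.map θ ≫ ·) this.symm
  have key0 (g : stalk Z ⟶ K) (hg : (Q.map θ ≫ F.mapDerivedCategoryFactors.inv.app (stalk Z)) ≫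
        F.mapDerivedCategory.map (Q.map g) = 0) : Q.map g = 0 := by
    rw [key, ← zero_comp (f := F.mapDerivedCategoryFactors.inv.app K), cancel_mono,
      Q_map_eq_zero_iff, quotient_map_stalk_eq_zero_iff] at hg
    rw [Q_map_eq_zero_iff, quotient_map_stalk_eq_zero_iff]
    obtain ⟨h, hh⟩ := hg
    obtain ⟨h', rfl⟩ := (hη (K.X (-1))).2 h
    refine ⟨h', (hη (K.X 0)).1 ?_⟩
    dsimp only
    rw [F.map_comp, ← Category.assoc, ← evalStalk_comp_map hθ, ← hh]
    rfl
  have surj (g : Q.obj (stalk X) ⟶ F.mapDerivedCategory.obj (Q.obj K)) :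
      ∃ h : stalk Z ⟶ K, (Q.map θ ≫ F.mapDerivedCategoryFactors.inv.app (stalk Z)) ≫
        F.mapDerivedCategory.map (Q.map h) = g := by
    obtain ⟨f, hf⟩ := Q_map_surjective (K := (F.mapHomologicalComplex (.up ℤ)).obj K)
      (g ≫ F.mapDerivedCategoryFactors.hom.app K)
    obtain ⟨c, hc⟩ := (hη (K.X 0)).2 (evalStalk f)
    dsimp only at hc
    obtain ⟨h, rfl⟩ := exists_evalStalk_eq c ((hη (K.X 1)).1 (by
      dsimp only
      rw [F.map_comp, ← Category.assoc, hc, F.map_zero, comp_zero]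
      exact evalStalk_comp_d f))
    refine ⟨h, ?_⟩
    rw [key]
    have : θ ≫ (F.mapHomologicalComplex (.up ℤ)).map h = f :=
      evalStalk_injective ((evalStalk_comp_map hθ h).trans hc)
    rw [this, hf, Category.assoc]
    simp
  constructor
  · intro a b hab
    obtain ⟨c, hc⟩ := Q_map_surjective ((a - b) ≫ e.inv)
    have h0 : Q.map c = 0 := key0 c (by
      rw [hc, Functor.map_comp, Functor.map_sub, Preadditive.sub_comp, Preadditive.comp_sub,
        ← Category.assoc, ← Category.assoc, sub_eq_zero]
      exact congrArg (· ≫ F.mapDerivedCategory.map e.inv) hab)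
    rw [← sub_eq_zero, ← cancel_mono e.inv, ← hc, h0, zero_comp]
  · intro g
    obtain ⟨h, hh⟩ := surj (g ≫ F.mapDerivedCategory.map e.inv)
    refine ⟨Q.map h ≫ e.hom, ?_⟩
    dsimp only
    rw [Functor.map_comp, ← Category.assoc, hh, Category.assoc, ← Functor.map_comp, e.inv_hom_id,
      CategoryTheory.Functor.map_id, Category.comp_id]

end

end DerivedCategory

namespace CategoryTheory

section

variable {C : Type*} {D : Type*} [Category* C] [Category* D] [Abelian C]
  [Abelian D] {G : C ⥤ D} {F : D ⥤ C} [G.Additive] [F.Additive] (adj : G ⊣ F)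

omit [F.Additive] in
include adj in
/-- A left adjoint `G` of an exact functor preserves projective resolutions of objects on which the
higher left derived functors of `G` vanish. -/
lemma exists_projectiveResolution_of_isZero_leftDerived [F.PreservesEpimorphisms] {X : C}
    [EnoughProjectives C] (P : ProjectiveResolution X)
    (h : ∀ n, IsZero ((G.leftDerived (n + 1)).obj X)) :
    ∃ R : ProjectiveResolution (G.obj X), R.complex = (G.mapHomologicalComplex _).obj P.complex := by
  have : PreservesFiniteColimits G := ⟨fun _ _ _ ↦
    have := adj.leftAdjoint_preservesColimits.{0, 0}
    inferInstance⟩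
  let S := ShortComplex.mk (P.complex.d 1 0) (P.π.f 0) P.complex_d_comp_π_f_zero
  have hS : S.Exact := ShortComplex.exact_of_g_is_cokernel _ P.isColimitCokernelCofork
  have : Epi S.g := inferInstanceAs (Epi (P.π.f 0))
  have hGS : (S.map G).Exact := hS.map_of_epi_of_preservesCokernel G inferInstance inferInstance
  have : Epi (S.map G).g := inferInstanceAs (Epi (G.map S.g))
  let K : ChainComplex D ℕ := (G.mapHomologicalComplex _).obj P.complex
  let p : K.X 0 ⟶ G.obj X := (S.map G).g
  have hp : K.d 1 0 ≫ p = 0 := (S.map G).zero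
  let π : K ⟶ (ChainComplex.single₀ D).obj (G.obj X) :=
    (ChainComplex.toSingle₀Equiv K _).symm ⟨p, hp⟩
  have hπ : π.f 0 = p := ChainComplex.toSingle₀Equiv_symm_apply_f_zero p hp
  refine ⟨{ complex := K, projective := fun n ↦ adj.map_projective _ (P.projective n),
            π := π, quasiIso := ⟨fun n ↦ ?_⟩ }, rfl⟩
  cases n with
  | zero =>
    rw [ChainComplex.quasiIsoAt₀_iff, ShortComplex.quasiIso_iff_of_zeros' _ ?_ ?_ ?_]
    · have (q : K.X 0 ⟶ G.obj X) (hq : q = p) (z : K.d 1 0 ≫ q = 0) :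
          (ShortComplex.mk _ _ z).Exact ∧ Epi q := by
        subst hq
        exact ⟨hGS, ‹Epi (S.map G).g›⟩
      exact this _ hπ (hπ ▸ hp)
    · exact K.shape _ _ (by simp)
    all_goals rfl
  | succ n =>
    rw [quasiIsoAt_iff_exactAt' _ _ (ChainComplex.exactAt_succ_single_obj _ _),
      K.exactAt_iff_isZero_homology]
    exact (h n).of_iso (P.isoLeftDerivedObj G (n + 1)).symm

/-- Morphisms from `K` to a complex `L` are null-homotopic if `K` comes from a K-projective complex
and `L` becomes acyclic under the right adjoint. -/
lemma quotient_map_eq_zero_of_adjunction {K L : CochainComplex D ℤ}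
    (hK : ∀ n, IsIso (adj.counit.app (K.X n)))
    [CochainComplex.IsKProjective ((F.mapHomologicalComplex (.up ℤ)).obj K)]
    (hL : ((F.mapHomologicalComplex (.up ℤ)).obj L).Acyclic) (f : K ⟶ L) :
    (HomotopyCategory.quotient D (.up ℤ)).map f = 0 := by
  obtain ⟨h⟩ := CochainComplex.IsKProjective.nonempty_homotopy_zero
    ((F.mapHomologicalComplex (.up ℤ)).map f) hL
  have (n : ℤ) : IsIso ((adj.counitComplex K).f n) := hK n
  have : IsIso (adj.counitComplex K) := HomologicalComplex.Hom.isIso_of_components _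
  have nat : adj.counitComplex K ≫ f = (G.mapHomologicalComplex (.up ℤ)).map
      ((F.mapHomologicalComplex (.up ℤ)).map f) ≫ adj.counitComplex L :=
    HomologicalComplex.hom_ext _ _ fun n ↦ (adj.counit.naturality (f.f n)).symm
  have h0 : (HomotopyCategory.quotient D (.up ℤ)).map ((G.mapHomologicalComplex (.up ℤ)).map
      ((F.mapHomologicalComplex (.up ℤ)).map f)) = 0 :=
    (HomotopyCategory.quotient_map_eq_zero_iff _).2
      ⟨(G.mapHomotopy h).trans (.ofEq (Functor.map_zero _ _ _))⟩
  rw [← cancel_epi ((HomotopyCategory.quotient D (.up ℤ)).map (adj.counitComplex K)),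
    ← Functor.map_comp, nat, Functor.map_comp, h0, zero_comp, comp_zero]

end

end CategoryTheory

namespace DerivedCategory

open CochainComplex

variable {C : Type*} {D : Type*} [Category* C] [Category* D] [Abelian C]
  [Abelian D] [HasDerivedCategory.{w} C] [HasDerivedCategory.{w} D]
  {G : C ⥤ D} {F : D ⥤ C} [G.Additive] [F.Additive]
  [PreservesFiniteLimits F] [PreservesFiniteColimits F] (adj : G ⊣ F) [IsIso adj.unit]

include adj in
lemma eq_zero_of_isZero_mapDerivedCategory_obj [EnoughProjectives C] {X : C}
    (h : ∀ n, IsZero ((G.leftDerived (n + 1)).obj X)) {V : DerivedCategory D}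
    (hV : IsZero (F.mapDerivedCategory.obj V)) (g : Q.obj (stalk (G.obj X)) ⟶ V) : g = 0 := by
  have : F.PreservesEpimorphisms := inferInstance
  let P := projectiveResolution X
  obtain ⟨R, hR⟩ := exists_projectiveResolution_of_isZero_leftDerived adj P h
  let K := Q.objPreimage V
  let e : Q.obj K ≅ V := Q.objObjPreimageIso V
  let r : Q.obj R.cochainComplex ≅ Q.obj (stalk (G.obj X)) := asIso (Q.map R.π')
  have : R.cochainComplex.IsKProjective := isKProjective_of_projective _ 0
  have hFK : ((F.mapHomologicalComplex (.up ℤ)).obj K).Acyclic := by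
    have : IsZero (Q.obj ((F.mapHomologicalComplex (.up ℤ)).obj K)) :=
      hV.of_iso ((F.mapDerivedCategoryFactors.app K).symm ≪≫ F.mapDerivedCategory.mapIso e)
    rw [isZero_Q_obj_iff] at this
    exact fun n ↦ (HomologicalComplex.exactAt_iff_isZero_homology _ _).2 (this n)
  have hG : G.FullyFaithful := adj.fullyFaithfulLOfIsIsoUnit
  have := hG.full
  have := hG.faithful
  have hterm (n : ℤ) : IsZero (R.cochainComplex.X n) ∨
      ∃ k, Nonempty (R.cochainComplex.X n ≅ G.obj (P.complex.X k)) := by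
    by_cases hn : n ≤ 0
    · obtain ⟨k, rfl⟩ := Int.exists_eq_neg_ofNat hn
      exact .inr ⟨k, ⟨R.cochainComplexXIso (-k) k ≪≫ eqToIso (by rw [hR]; rfl)⟩⟩
    · exact .inl (CochainComplex.isZero_of_isStrictlyLE _ 0 _)
  have hcounit (n : ℤ) : IsIso (adj.counit.app (R.cochainComplex.X n)) := by
    obtain h0 | ⟨k, ⟨i⟩⟩ := hterm n
    · exact ⟨0, (G.map_isZero (F.map_isZero h0)).eq_of_src _ _, h0.eq_of_tgt _ _⟩
    · exact adj.isIso_counit_app_of_iso i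
  have : CochainComplex.IsKProjective ((F.mapHomologicalComplex (.up ℤ)).obj R.cochainComplex) := by
    have (n : ℤ) : Projective (((F.mapHomologicalComplex (.up ℤ)).obj R.cochainComplex).X n) := by
      obtain h0 | ⟨k, ⟨i⟩⟩ := hterm n
      · exact (F.map_isZero h0).projective
      · exact Projective.of_iso (asIso (adj.unit.app (P.complex.X k)) ≪≫ F.mapIso i.symm)
          (P.projective k)
    have : CochainComplex.IsStrictlyLE ((F.mapHomologicalComplex (.up ℤ)).obj R.cochainComplex) 0 :=
      HomologicalComplex.map_isStrictlySupported _ _ _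
    exact isKProjective_of_projective _ 0
  obtain ⟨f, hf⟩ := Q_map_surjective (r.hom ≫ g ≫ e.inv)
  have h0 : Q.map f = 0 :=
    (Q_map_eq_zero_iff f).2 (quotient_map_eq_zero_of_adjunction adj hcounit hFK f)
  rw [h0] at hf
  rw [← cancel_epi r.hom, ← cancel_mono e.inv, Category.assoc, ← hf, comp_zero, zero_comp]

end DerivedCategory

namespace CochainComplex

variable {C D : Type*} [Category* C] [Category* D] [Abelian C] [Abelian D]

lemma evalStalk_map_comp {X X' : C} (g : X ⟶ X') {K : CochainComplex C ℤ} (f : stalk X' ⟶ K) :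
    evalStalk ((singleFunctor C 0).map g ≫ f) = g ≫ evalStalk f := by
  have h : ((singleFunctor C 0).map g).f 0 = (stalkIso X).inv ≫ g ≫ (stalkIso X').hom :=
    HomologicalComplex.single_map_f_self _ _ _
  rw [evalStalk, evalStalk, HomologicalComplex.comp_f, h]
  simp

lemma exists_stalk_iso (F : C ⥤ D) [F.Additive] (Z : C) :
    ∃ κ : stalk (F.obj Z) ≅ (F.mapHomologicalComplex (.up ℤ)).obj (stalk Z),
      evalStalk κ.hom = F.map (stalkIso Z).hom := by
  refine ⟨((HomologicalComplex.singleMapHomologicalComplex F (.up ℤ) 0).app Z).symm, ?_⟩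
  refine (congrArg ((stalkIso (F.obj Z)).hom ≫ ·)
    (HomologicalComplex.singleMapHomologicalComplex_inv_app_self F (.up ℤ) 0 Z)).trans ?_
  exact (stalkIso (F.obj Z)).hom_inv_id_assoc _

end CochainComplex

namespace MirrorReflective

open DerivedCategory CochainComplex

lemma IsNIdempotent.mono {B : Type u} [Ring B] {I : Ideal B} [I.IsTwoSided] {n n' : ℕ}
    (h : IsNIdempotent I n') (hn : n ≤ n') : IsNIdempotent I n :=
  fun X Y i h1 hi ↦ h X Y i h1 (hi.trans hn)

variable {A B C : Type u} [Ring A] [Ring B] [Ring C] {e : A} {f : B}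
  {he : IsIdempotentElem e} {hf : IsIdempotentElem f} (m : CornerModel he hf)
  (hm : Function.Injective m.mulMap)
  (hT : ∀ i : ℕ, 1 ≤ i → IsZero (NCTor he.Corner (LeftIdeal he) (CornerModule he A) i))

include hm hT

lemma CornerModel.isStrongIdempotent : IsStrongIdempotent (idealOf f) := fun n _ ↦
  ((m.isNIdempotent_iff hm n).2 fun j _ ↦ hT (j + 1) (by lia)).mono (by lia)

theorem CornerModel.exists_isStandardRecollement
    [HasDerivedCategory.{w} (ModuleCat.{u} B)] [HasDerivedCategory.{w} (ModuleCat.{u} C)]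
    [HasDerivedCategory.{w} (ModuleCat.{u} he.Corner)] (φ : B →+* C)
    (hφ : Function.Surjective φ) (hker : RingHom.ker φ = idealOf f) :
    ∃ Rc : Recollement (DerivedCategory.{w} (ModuleCat.{u} C))
      (DerivedCategory.{w} (ModuleCat.{u} B)) (DerivedCategory.{w} (ModuleCat.{u} he.Corner)),
      IsStandardRecollement hf φ m.ψ Rc := by
  let F := ModuleCat.restrictScalars.{u} φ
  let i := F.mapDerivedCategory
  let j := m.cornerFunctor.mapDerivedCategory
  have hφf : φ f = 0 := by
    have : f ∈ RingHom.ker φ := hker ▸ mem_idealOf f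
    exact this
  have : Projective (ModuleCat.of B B) :=
    ModuleCat.projective_of_free (Module.Basis.singleton Unit B)
  have : Projective (ModuleCat.of C C) :=
    ModuleCat.projective_of_free (Module.Basis.singleton Unit C)
  have hi : i.IsLeftAdjoint := isLeftAdjoint_mapDerivedCategory
    (ModuleCat.restrictCoextendScalarsAdj.{u} φ) (ModuleCat.exists_isKInjective B)
  obtain ⟨jS, adjS, hjS⟩ := exists_leftAdjoint_mapDerivedCategory m.inducedAdj
    (ModuleCat.exists_isKProjective he.Corner)
  obtain ⟨_, _⟩ := hjS ⟨inferInstance, inferInstance⟩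
  have hj : j.IsLeftAdjoint := isLeftAdjoint_mapDerivedCategory m.cornerAdj
    (ModuleCat.exists_isKInjective he.Corner)
  have zero (X : DerivedCategory (ModuleCat.{u} C)) : IsZero (j.obj (i.obj X)) := by
    let K := Q.objPreimage X
    let L := (m.cornerFunctor.mapHomologicalComplex (.up ℤ)).obj
      ((F.mapHomologicalComplex (.up ℤ)).obj K)
    have hL : IsZero L := by
      rw [IsZero.iff_id_eq_zero]
      ext1 n
      exact (m.isZero_cornerFunctor_obj_restrictScalars φ hφf (K.X n)).eq_of_src _ _
    let a : j.obj (i.obj X) ≅ Q.obj L :=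
      j.mapIso (i.mapIso (Q.objObjPreimageIso X).symm ≪≫ F.mapDerivedCategoryFactors.app K) ≪≫
        m.cornerFunctor.mapDerivedCategoryFactors.app _
    exact (Q.map_isZero hL).of_iso a
  let S := idealShortComplex φ (idealOf f) hker.ge
  have hS : S.ShortExact := idealShortComplex_shortExact φ _ hker.symm hφ
  let η : ModuleCat.of B B ⟶ F.obj (ModuleCat.of C C) := S.g
  have hη (Y : ModuleCat.{u} C) :
      Function.Bijective (fun g : ModuleCat.of C C ⟶ Y ↦ η ≫ F.map g) := by
    constructor
    · intro g g' h
      ext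
      obtain ⟨b, hb⟩ := hφ 1
      have := ConcreteCategory.congr_hom h b
      exact (congrArg g hb).symm.trans (this.trans (congrArg g' hb))
    · intro h
      refine ⟨ModuleCat.ofHom (LinearMap.toSpanSingleton C Y (h (1 : B))), ?_⟩
      ext
      refine (congrArg (· • (show Y from h (1 : B))) (map_one φ)).trans ?_
      exact one_smul C (show Y from h (1 : B))
  obtain ⟨κ, hκ⟩ := exists_stalk_iso F (ModuleCat.of C C)
  let θ : stalk (ModuleCat.of B B) ⟶ (F.mapHomologicalComplex (.up ℤ)).obj
    (stalk (ModuleCat.of C C)) := (CochainComplex.singleFunctor _ 0).map η ≫ κ.hom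
  have hθ : evalStalk θ = η ≫ F.map (stalkIso (ModuleCat.of C C)).hom :=
    (evalStalk_map_comp η κ.hom).trans (congrArg (η ≫ ·) hκ)
  have hT' (n : ℕ) := (m.isZero_leftDerived_iff (n + 1)).2 (hT (n + 1) (by lia))
  let c : Q.obj (stalk (F.obj (ModuleCat.of C C))) ≅ i.obj (Q.obj (stalk (ModuleCat.of C C))) :=
    Q.mapIso κ ≪≫ (F.mapDerivedCategoryFactors.app _).symm
  have hc : Q.map θ ≫ F.mapDerivedCategoryFactors.inv.app _ =
      Q.map ((CochainComplex.singleFunctor _ 0).map η) ≫ c.hom :=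
    (congrArg (· ≫ F.mapDerivedCategoryFactors.inv.app _) (Q.map_comp _ κ.hom)).trans
      (Category.assoc _ _ _)
  have hS' : (S.map (CochainComplex.singleFunctor _ 0)).ShortExact :=
    hS.map_of_exact (HomologicalComplex.single _ (.up ℤ) 0)
  have dist := triangleOfSES_distinguished hS'
  have dist' : Triangle.mk (Q.map ((CochainComplex.singleFunctor _ 0).map S.f))
      (Q.map θ ≫ F.mapDerivedCategoryFactors.inv.app _) (c.inv ≫ triangleOfSESδ hS') ∈ distTriang _ := by
    refine distTriang_of_iso dist (Iso.refl _) (Iso.refl _) c.symm ?_ ?_ ?_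
    · exact (Category.comp_id _).trans (Category.id_comp _).symm
    · refine Eq.trans ?_ (Category.id_comp _).symm
      refine (congrArg (· ≫ c.inv) hc).trans ((Category.assoc _ _ _).trans ?_)
      exact (congrArg (Q.map ((CochainComplex.singleFunctor _ 0).map η) ≫ ·) c.hom_inv_id).trans
        (Category.comp_id _)
    · exact (congrArg ((c.inv ≫ triangleOfSESδ hS') ≫ ·) (CategoryTheory.Functor.map_id _ _)).trans
        (Category.comp_id _)
  let α : stalk (m.inducedFunctor.obj (ModuleCat.of he.Corner (CornerModule he A))) ≅ stalk S.X₁ :=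
    (CochainComplex.singleFunctor _ 0).mapIso (m.idealIso hm)
  obtain ⟨_, _, ker⟩ := fullyFaithful_and_essImage (i := i) (j := j)
    (Adjunction.ofIsLeftAdjoint i) zero (Q.map θ ≫ F.mapDerivedCategoryFactors.inv.app _)
    isZero_of_stalk_hom_eq_zero isZero_of_stalk_hom_eq_zero (stalk_universal hη hθ) dist'
    (fun V hV g ↦ by
      rw [← cancel_epi (Q.map α.hom), comp_zero]
      exact eq_zero_of_isZero_mapDerivedCategory_obj m.inducedAdj hT' hV _)
  obtain ⟨Rc, h1, h2⟩ := exists_recollement (i := i) (j := j) adjS (Adjunction.ofIsLeftAdjoint j)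
    zero ker
  exact ⟨Rc, m.isStrongIdempotent hm hT, hφ, hker, h1, h2⟩

end MirrorReflective

namespace MirrorReflective

/-! ## The mirror-reflective algebras as models of `(A, e)` -/

section OfSection

variable {A B : Type u} [Ring A] [Ring B] {e : A} {f : B}

/-- The model given by a retraction `π : B → A` of rings which sends `f` to `e` and is injective
on `Bf` and on `fB`. -/
def CornerModel.ofSection (he : IsIdempotentElem e) (hf : IsIdempotentElem f) (π : B →+* A)
    (ι : A →+* B) (hι : ∀ a, π (ι a) = a) (hπ : π f = e)
    (hl : ∀ b, b * f = b → π b = 0 → b = 0) (hr : ∀ b, f * b = b → π b = 0 → b = 0) :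
    CornerModel he hf where
  π := π
  ψ :=
    have key (l : he.Corner) : f * (ι l.1 * f) = ι l.1 * f := by
      obtain ⟨h1, h2⟩ := (Subsemigroup.mem_corner_iff he).mp l.2
      refine sub_eq_zero.mp (hl _ ?_ ?_)
      · rw [sub_mul, mul_assoc, mul_assoc, hf.eq]
      · rw [map_sub, map_mul, map_mul, hι, hπ, ← mul_assoc, h1, sub_self]
    { toFun := fun l => ⟨ι l.1 * f, ι l.1 * f, by
        change f * (ι l.1 * f) * f = _
        rw [key, mul_assoc, hf.eq]⟩
      invFun := fun r => ⟨π r.1, π r.1, by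
        obtain ⟨h1, h2⟩ := (Subsemigroup.mem_corner_iff hf).mp r.2
        change e * π r.1 * e = π r.1
        rw [← hπ, ← map_mul, ← map_mul, h1, h2]⟩
      left_inv := fun l => Subtype.ext (by
        change π (ι l.1 * f) = l.1
        rw [map_mul, hι, hπ]
        exact ((Subsemigroup.mem_corner_iff he).mp l.2).2)
      right_inv := fun r => Subtype.ext (by
        obtain ⟨h1, h2⟩ := (Subsemigroup.mem_corner_iff hf).mp r.2
        change ι (π r.1) * f = r.1
        refine sub_eq_zero.mp (hl _ ?_ ?_)
        · rw [sub_mul, mul_assoc, hf.eq, h2]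
        · rw [map_sub, map_mul, hι, ← map_mul, h2, sub_self])
      map_mul' := fun a b => Subtype.ext (by
        change ι (a.1 * b.1) * f = ι a.1 * f * (ι b.1 * f)
        rw [mul_assoc _ f, key, map_mul, mul_assoc])
      map_add' := fun a b => Subtype.ext (by
        change ι (a.1 + b.1) * f = ι a.1 * f + ι b.1 * f
        rw [map_add, add_mul]) }
  σ := AddMonoidHom.mk' (fun x => LeftIdeal.mk hf (ι x.1 * f) (by rw [mul_assoc, hf.eq]))
    (fun x y => Subtype.ext (by
      change ι (x.1 + y.1) * f = ι x.1 * f + ι y.1 * f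
      rw [map_add, add_mul]))
  τ := AddMonoidHom.mk' (fun y => CornerModule.mk hf (f * ι y.1)
      (by rw [smul_eq_mul, ← mul_assoc, hf.eq]))
    (fun x y => Subtype.ext (by
      change f * ι (x.1 + y.1) = f * ι x.1 + f * ι y.1
      rw [map_add, mul_add]))
  π_ψ l := by
    change π (ι l.1 * f) = l.1
    rw [map_mul, hι, hπ]
    exact ((Subsemigroup.mem_corner_iff he).mp l.2).2
  π_σ x := by
    change π (ι x.1 * f) = x.1
    rw [map_mul, hι, hπ, x.val_mul]
  π_τ y := by
    change π (f * ι y.1) = y.1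
    rw [map_mul, hι, hπ]
    exact y.smul_val
  injOn_left := hl
  injOn_right := hr

end OfSection

variable {A : Type u} [Ring A] {e : A}

namespace Mirror

variable {he : IsIdempotentElem e}

lemma incl_mul_eBar_mul_eBar_mul_incl (x : LeftIdeal he) (y : CornerModule he A) :
    incl he x.1 * eBar he * (eBar he * incl he y.1) = ⟨0, btmul he.Corner x y⟩ := by
  have hx : leftMul he x.1 (LeftIdeal.mk he e he.eq) = x := Subtype.ext x.val_mul
  have hy : rightMul he y.1 (CornerModule.mk he e he.eq) = y := Subtype.ext y.smul_val
  rw [mul_assoc, ← mul_assoc (eBar he), (eBar_idem he).eq, mul_incl, incl_mul]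
  refine Mirror.ext (by change x.1 * (0 * y.1) = 0; rw [zero_mul, mul_zero]) ?_
  change btmul he.Corner (leftMul he x.1 (LeftIdeal.mk he e he.eq))
    (rightMul he y.1 (CornerModule.mk he e he.eq)) = _
  rw [hx, hy]

lemma eBar_mul (r : Mirror he) : eBar he * r = eBar he * incl he (r.base + mulMap he r.tens) := by
  have h : mulMap he (eBar he).tens = e := he.eq
  rw [mul_incl, mul_def]
  refine Mirror.ext ((zero_mul r.base).trans (zero_mul _).symm) ?_
  change lact he 0 _ + ract he r.base (eBar he).tens + lact he (mulMap he (eBar he).tens) r.tens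
    = ract he _ _
  rw [lact_zero, zero_add, lact_mulMap_eq_ract, ← ract_add]

lemma incl_sub_eBar_idem (he : IsIdempotentElem e) :
    IsIdempotentElem (incl he e - eBar he) := by
  change (incl he e - eBar he) * (incl he e - eBar he) = _
  rw [sub_mul, mul_sub, mul_sub, incl_mul_eBar, eBar_mul_incl, (eBar_idem he).eq, sub_self,
    sub_zero, ← map_mul, he.eq]

/-- `(R, ē)` is a model of `(A, e)` via `π₂`. -/
def eBarModel (k : Type v) [CommRing k] [Algebra k A] (he : IsIdempotentElem e) :
    CornerModel he (eBar_idem he) :=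
  CornerModel.ofSection he (eBar_idem he) (piTwo k he : Mirror he →+* A) (incl he)
    (piTwo_incl k) (piTwo_eBar k)
    (fun b hb h => by
      rw [← hb, mul_eBar]
      refine (congrArg (incl he · * eBar he) h).trans ?_
      rw [map_zero, zero_mul])
    (fun b hb h => by
      rw [← hb, eBar_mul]
      refine (congrArg (eBar he * incl he ·) h).trans ?_
      rw [map_zero, mul_zero])

lemma mulMap_eBarModel (k : Type v) [CommRing k] [Algebra k A] (t : MirrorBimodule he) :
    (eBarModel k he).mulMap t = ⟨0, t⟩ := by
  induction t using btmul_induction with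
  | zero => exact map_zero _
  | add s t hs ht =>
    rw [map_add, hs, ht]
    exact Mirror.ext (add_zero 0) rfl
  | tmul x y => exact incl_mul_eBar_mul_eBar_mul_incl x y

lemma mulMap_eBarModel_injective (k : Type v) [CommRing k] [Algebra k A] :
    Function.Injective (eBarModel k he).mulMap := fun s t h => by
  rw [mulMap_eBarModel, mulMap_eBarModel] at h
  exact congrArg tens h

/-- `(R, e - ē)` is a model of `(A, e)` via `π₁`. -/
def inclSubEBarModel (k : Type v) [CommRing k] [Algebra k A] (he : IsIdempotentElem e) :
    CornerModel he (incl_sub_eBar_idem he) :=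
  have h0 : mulMap he (eBar he).tens = e := he.eq
  CornerModel.ofSection he (incl_sub_eBar_idem he) (piOne k he : Mirror he →+* A) (incl he)
    (fun _ => rfl) (by
      refine (map_sub (piOne k he : Mirror he →+* A) _ _).trans ?_
      exact sub_zero e)
    (fun b hb h => by
      have hb0 : b.base = 0 := h
      rw [← hb, mul_sub, mul_eBar, mul_incl, incl_mul, sub_eq_zero, hb0, zero_add]
      refine Mirror.ext ((zero_mul e).trans (mul_zero _).symm) ?_
      change ract he e b.tens = lact he (mulMap he b.tens) (eBar he).tens
      rw [lact_mulMap_eq_ract, h0])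
    (fun b hb h => by
      have hb0 : b.base = 0 := h
      rw [← hb, sub_mul, eBar_mul, mul_incl, incl_mul, sub_eq_zero, hb0, zero_add]
      refine Mirror.ext ((mul_zero e).trans (zero_mul _).symm) ?_
      change lact he e b.tens = ract he (mulMap he b.tens) (eBar he).tens
      rw [← lact_mulMap_eq_ract, h0])

lemma mulMap_inclSubEBarModel (k : Type v) [CommRing k] [Algebra k A] (t : MirrorBimodule he) :
    (inclSubEBarModel k he).mulMap t = ⟨MirrorReflective.mulMap he t, -t⟩ := by
  induction t using btmul_induction with
  | zero =>
    refine (map_zero _).trans (Mirror.ext (map_zero _).symm neg_zero.symm)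
  | add s t hs ht =>
    rw [map_add, hs, ht]
    exact Mirror.ext (map_add _ _ _).symm (neg_add s t).symm
  | tmul x y =>
    have h : incl he x.1 * (incl he e - eBar he) * ((incl he e - eBar he) * incl he y.1) =
        incl he (x.1 * y.1) - incl he x.1 * eBar he * (eBar he * incl he y.1) := by
      have hx : incl he x.1 * incl he e = incl he x.1 := by rw [← map_mul, x.val_mul]
      have hy : incl he e * incl he y.1 = incl he y.1 := by
        rw [← map_mul]
        exact congrArg _ y.smul_val
      have h1 : incl he x.1 * (eBar he * incl he y.1) =
          incl he x.1 * eBar he * (eBar he * incl he y.1) := by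
        rw [mul_assoc, ← mul_assoc (eBar he), (eBar_idem he).eq]
      have h2 : incl he x.1 * eBar he * incl he y.1 =
          incl he x.1 * eBar he * (eBar he * incl he y.1) := by
        rw [mul_assoc, h1]
      have h3 : (incl he e - eBar he) * incl he y.1 = incl he y.1 - eBar he * incl he y.1 := by
        rw [sub_mul, hy]
      rw [mul_sub, hx, h3, sub_mul, mul_sub, mul_sub, h1, h2, sub_self, sub_zero, map_mul]
    refine h.trans ?_
    rw [incl_mul_eBar_mul_eBar_mul_incl, sub_eq_add_neg]
    exact Mirror.ext ((congrArg (x.1 * y.1 + ·) neg_zero).trans (add_zero _)) (zero_add _)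

lemma mulMap_inclSubEBarModel_injective (k : Type v) [CommRing k] [Algebra k A] :
    Function.Injective (inclSubEBarModel k he).mulMap := fun s t h => by
  rw [mulMap_inclSubEBarModel, mulMap_inclSubEBarModel] at h
  exact neg_injective (congrArg tens h)

lemma piOne_surjective (k : Type v) [CommRing k] [Algebra k A] :
    Function.Surjective (piOne k he : Mirror he →+* A) :=
  fun a => ⟨incl he a, rfl⟩

lemma ker_piOne (k : Type v) [CommRing k] [Algebra k A] :
    RingHom.ker (piOne k he : Mirror he →+* A) = idealOf (eBar he) := by
  ext r
  constructor
  · intro h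
    have h : r = (eBarModel k he).mulMap r.tens :=
      (Mirror.ext h rfl : r = ⟨0, r.tens⟩).trans (mulMap_eBarModel k r.tens).symm
    rw [h]
    exact (eBarModel k he).mulMap_mem r.tens
  · intro h
    obtain ⟨t, rfl⟩ := (eBarModel k he).exists_mulMap_eq h
    rw [mulMap_eBarModel]
    rfl

end Mirror

namespace ReducedMirror

open Mirror

variable {he : IsIdempotentElem e}

lemma mem_of_base_eq_zero {r : Mirror he} (hr : r.base = 0) :
    r ∈ Subsemigroup.corner (eZero he) :=
  (mem_iff r).mpr ⟨0, by
    change (1 - e) * 0 * (1 - e) = r.base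
    rw [hr, mul_zero, zero_mul]⟩

lemma mem_of_mul_eBar {r : Mirror he} (hr : r * Mirror.eBar he = r) :
    r ∈ Subsemigroup.corner (eZero he) :=
  mem_of_base_eq_zero (by
    rw [← hr]
    exact mul_zero r.base)

lemma mem_of_eBar_mul {r : Mirror he} (hr : Mirror.eBar he * r = r) :
    r ∈ Subsemigroup.corner (eZero he) :=
  mem_of_base_eq_zero (by
    rw [← hr]
    exact zero_mul r.base)

/-- `(S, ē)` is a model of `(A, e)` via the restriction of `π₂`. -/
def eBarModel (k : Type v) [CommRing k] [Algebra k A] (he : IsIdempotentElem e) :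
    CornerModel he (eBar_idem he) where
  π :=
    { toFun := fun s => (Mirror.eBarModel k he).π s.1
      map_one' := by
        refine (map_add (Mirror.piTwo k he) (Mirror.incl he (1 - e)) (Mirror.eBar he)).trans ?_
        rw [Mirror.piTwo_incl, Mirror.piTwo_eBar, sub_add_cancel]
      map_zero' := map_zero _
      map_add' := fun _ _ => map_add _ _ _
      map_mul' := fun _ _ => map_mul _ _ _ }
  ψ := (cornerEquiv k he : he.Corner ≃+* (eBar_idem he).Corner)
  σ := AddMonoidHom.mk' (fun x => LeftIdeal.mk _
      ⟨((Mirror.eBarModel k he).σ x).1, mem_of_mul_eBar ((Mirror.eBarModel k he).σ x).val_mul⟩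
      (Subtype.ext ((Mirror.eBarModel k he).σ x).val_mul))
    (fun x y => Subtype.ext (Subtype.ext
      (congrArg (fun z : LeftIdeal (Mirror.eBar_idem he) => z.1)
        (map_add (Mirror.eBarModel k he).σ x y))))
  τ := AddMonoidHom.mk' (fun y => CornerModule.mk _
      ⟨((Mirror.eBarModel k he).τ y).1, mem_of_eBar_mul ((Mirror.eBarModel k he).τ y).smul_val⟩
      (Subtype.ext ((Mirror.eBarModel k he).τ y).smul_val))
    (fun x y => Subtype.ext (Subtype.ext
      (congrArg (fun z : CornerModule (Mirror.eBar_idem he) (Mirror he) => z.1)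
        (map_add (Mirror.eBarModel k he).τ x y))))
  π_ψ l := (Mirror.eBarModel k he).π_ψ l
  π_σ x := (Mirror.eBarModel k he).π_σ x
  π_τ y := (Mirror.eBarModel k he).π_τ y
  injOn_left b hb h :=
    Subtype.ext ((Mirror.eBarModel k he).injOn_left b.1 (congrArg Subtype.val hb) h)
  injOn_right b hb h :=
    Subtype.ext ((Mirror.eBarModel k he).injOn_right b.1 (congrArg Subtype.val hb) h)

lemma mulMap_eBarModel (k : Type v) [CommRing k] [Algebra k A] (t : MirrorBimodule he) :
    ((eBarModel k he).mulMap t).1 = ⟨0, t⟩ := by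
  refine Eq.trans ?_ (Mirror.mulMap_eBarModel k t)
  induction t using btmul_induction with
  | zero => rfl
  | add s t hs ht =>
    rw [map_add, map_add, ← hs, ← ht]
    rfl
  | tmul x y => rfl

lemma mulMap_eBarModel_injective (k : Type v) [CommRing k] [Algebra k A] :
    Function.Injective (eBarModel k he).mulMap := fun s t h => by
  have h := congrArg Subtype.val h
  rw [mulMap_eBarModel, mulMap_eBarModel] at h
  exact congrArg tens h

lemma piOne_surjective (k : Type v) [CommRing k] [Algebra k A] :
    Function.Surjective (piOne k he : ReducedMirror he →+* he.one_sub.Corner) :=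
  fun a => ⟨⟨incl he a.1, (mem_iff _).mpr a.2⟩, rfl⟩

lemma ker_piOne (k : Type v) [CommRing k] [Algebra k A] :
    RingHom.ker (piOne k he : ReducedMirror he →+* he.one_sub.Corner) = idealOf (eBar he) := by
  ext r
  constructor
  · intro h
    have h0 : r.1.base = 0 := congrArg Subtype.val h
    have h : r = (eBarModel k he).mulMap r.1.tens := Subtype.ext
      ((Mirror.ext h0 rfl : r.1 = ⟨0, r.1.tens⟩).trans (mulMap_eBarModel k r.1.tens).symm)
    rw [h]
    exact (eBarModel k he).mulMap_mem r.1.tens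
  · intro h
    obtain ⟨t, rfl⟩ := (eBarModel k he).exists_mulMap_eq h
    exact Subtype.ext (congrArg base (mulMap_eBarModel k t))

end ReducedMirror

end MirrorReflective

end

theorem proposition3p6 {k : Type v} [CommRing k] {A : Type u} [Ring A] [Algebra k A] {e : A}
    (he : IsIdempotentElem e)
    [HasDerivedCategory.{w} (ModuleCat.{u} A)]
    [HasDerivedCategory.{w} (ModuleCat.{u} he.Corner)]
    [HasDerivedCategory.{w} (ModuleCat.{u} he.one_sub.Corner)]
    [HasDerivedCategory.{w} (ModuleCat.{u} (Mirror he))]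
    [HasDerivedCategory.{w} (ModuleCat.{u} (ReducedMirror he))] :
    -- `I = RēR` and `J = R(e-ē)R` are `2`-idempotent
    (IsNIdempotent (idealOf (Mirror.eBar he)) 2 ∧
      IsNIdempotent (idealOf (Mirror.incl he e - Mirror.eBar he)) 2) ∧
    -- `(n+2)`-idempotency of `I`, of `J`, and vanishing of `Tor` in degrees `1, …, n`
    (∀ n : ℕ, 1 ≤ n → List.TFAE
      [IsNIdempotent (idealOf (Mirror.eBar he)) (n + 2),
        IsNIdempotent (idealOf (Mirror.incl he e - Mirror.eBar he)) (n + 2),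
        ∀ i : ℕ, 1 ≤ i → i ≤ n →
          IsZero (NCTor he.Corner (LeftIdeal he) (CornerModule he A) i)]) ∧
    -- the standard recollements
    ((∀ i : ℕ, 1 ≤ i → IsZero (NCTor he.Corner (LeftIdeal he) (CornerModule he A) i)) →
      (∃ Rc : Recollement (DerivedCategory.{w} (ModuleCat.{u} A))
          (DerivedCategory.{w} (ModuleCat.{u} (Mirror he)))
          (DerivedCategory.{w} (ModuleCat.{u} he.Corner)),
        IsStandardRecollement (Mirror.eBar_idem he) (Mirror.piOne k he : Mirror he →+* A)
          (Mirror.cornerEquiv k he : he.Corner ≃+* (Mirror.eBar_idem he).Corner) Rc) ∧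
      (∃ Rc : Recollement (DerivedCategory.{w} (ModuleCat.{u} he.one_sub.Corner))
          (DerivedCategory.{w} (ModuleCat.{u} (ReducedMirror he)))
          (DerivedCategory.{w} (ModuleCat.{u} he.Corner)),
        IsStandardRecollement (ReducedMirror.eBar_idem he)
          (ReducedMirror.piOne k he : ReducedMirror he →+* he.one_sub.Corner)
          (ReducedMirror.cornerEquiv k he : he.Corner ≃+* (ReducedMirror.eBar_idem he).Corner)
          Rc)) := by
  have h1 := (Mirror.eBarModel k he).isNIdempotent_iff (Mirror.mulMap_eBarModel_injective k)
  have h2 := (Mirror.inclSubEBarModel k he).isNIdempotent_iff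
    (Mirror.mulMap_inclSubEBarModel_injective k)
  have hTor (n : ℕ) : (∀ j < n, IsZero (NCTor he.Corner (LeftIdeal he) (CornerModule he A) (j + 1)))
      ↔ ∀ i : ℕ, 1 ≤ i → i ≤ n → IsZero (NCTor he.Corner (LeftIdeal he) (CornerModule he A) i) := by
    refine ⟨fun h i hi hin => ?_, fun h j hj => h (j + 1) (Nat.le_add_left 1 j) hj⟩
    obtain ⟨j, rfl⟩ := Nat.exists_eq_add_of_le' hi
    exact h j hin
  refine ⟨⟨(h1 0).mpr fun j hj => absurd hj j.not_lt_zero,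
    (h2 0).mpr fun j hj => absurd hj j.not_lt_zero⟩, fun n _ => ?_, fun hT => ⟨?_, ?_⟩⟩
  · rw [h1, h2, hTor]
    tfae_have 1 ↔ 2 := Iff.rfl
    tfae_have 2 ↔ 3 := Iff.rfl
    tfae_finish
  · exact (Mirror.eBarModel k he).exists_isStandardRecollement
      (Mirror.mulMap_eBarModel_injective k) hT _ (Mirror.piOne_surjective k) (Mirror.ker_piOne k)
  · exact (ReducedMirror.eBarModel k he).exists_isStandardRecollement
      (ReducedMirror.mulMap_eBarModel_injective k) hT _ (ReducedMirror.piOne_surjective k)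
      (ReducedMirror.ker_piOne k)
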